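/- Let $N=\{1,\dots,n\}$ be a non-empty set of agents and $M=\{1,\dots,m\}$ a non-empty set of indivisible goods, where $n$ divides $m$, and put $k=m/n$. Every agent $i$ has an additive valuation with nonnegative values $v_{ij}$ ($j\in M$), that is, $v_i(X)=\sum_{j\in X}v_{ij}$ for $X\subseteq M$. Suppose that there are at most two agent types, i.e. there are $u_1,u_2\colon M\to\mathbb{R}_{\ge 0}$ such that for every agent $i$ either $v_{ij}=u_1(j)$ for all $j$, or $v_{ij}=u_2(j)$ for all $j$. An allocation is an ordered partition $A=(A_1,\dots,A_n)$ of $M$; it is balanced if $|A_i|=k$ for all $i$. It is EF1 (envy-free up to one good) if for all $i,i'\in N$ either $A_{i'}=\emptyset$ or there is a good $j\in A_{i'}$ with $v_i(A_i)\ge v_i(A_{i'}\setminus\{j\})$. A balanced allocation $A$ is fPO (fractionally Pareto optimal) if there is no balanced fractional allocation, i.e. no matrix $x\in\mathbb{R}_{\ge0}^{N\times M}$ with $\sum_{j}x_{ij}=k$ for all $i$ and $\sum_i x_{ij}=1$ for all $j$, such that $\sum_j v_{ij}x_{ij}\ge v_i(A_i)$ for all $i\in N$, with strict inequality for at least one $i$.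 **Theorem.** 1. For every such instance with real values $v_{ij}\ge 0$ there exists a balanced allocation that is both EF1 and fPO. 2. Such an allocation can be found in polynomial time: there is a single algorithm that, for every such instance with rational values $v_{ij}\ge0$ (the input consists of $n$, $m$ and the numerators and denominators of the $v_{ij}$, in binary), outputs a balanced allocation that is both EF1 and fPO, in time bounded by a polynomial in the bit length of the input. Here time is measured on a random-access machine under the logarithmic cost criterion: operations on integers and memory accesses are charged the bit lengths of the integers and addresses involved. -/

import Mathlib

open scoped BigOperators

namespace FairDivision

/-! ## Balanced allocations, EF1 and fPO

There are `n` agents and `m` goods; `v i j` is the value of good `j` for agent `i`. -/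

/-- The additive value of a set `X` of goods, when `w j` is the value of the single good `j`. -/
noncomputable def value {m : ℕ} (w : Fin m → ℝ) (X : Finset (Fin m)) : ℝ :=
  ∑ j ∈ X, w j

/-- `A` is an ordered partition of the goods: `A i` is the bundle of agent `i`. -/
def IsAllocation {n m : ℕ} (A : Fin n → Finset (Fin m)) : Prop :=
  (∀ i i' : Fin n, i ≠ i' → Disjoint (A i) (A i')) ∧ ∀ j : Fin m, ∃ i : Fin n, j ∈ A i

/-- A balanced allocation: every agent receives exactly `m / n` goods
(used only when `n` divides `m`). -/
def IsBalanced {n m : ℕ} (A : Fin n → Finset (Fin m)) : Prop :=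
  IsAllocation A ∧ ∀ i : Fin n, (A i).card = m / n

/-- A balanced fractional allocation: a nonnegative matrix with row sums `m / n` and
column sums `1` (used only when `n` divides `m`). -/
def IsBalancedFractional {n m : ℕ} (x : Fin n → Fin m → ℝ) : Prop :=
  (∀ i j, 0 ≤ x i j) ∧ (∀ i, ∑ j, x i j = ((m / n : ℕ) : ℝ)) ∧ ∀ j, ∑ i, x i j = 1

/-- The `0`-`1` matrix of an allocation. -/
noncomputable def toMatrix {n m : ℕ} (A : Fin n → Finset (Fin m)) : Fin n → Fin m → ℝ :=
  fun i j => if j ∈ A i then 1 else 0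

/-- `x` Pareto-dominates `x'`. -/
def ParetoDominates {n m : ℕ} (v : Fin n → Fin m → ℝ) (x x' : Fin n → Fin m → ℝ) : Prop :=
  (∀ i, ∑ j, v i j * x' i j ≤ ∑ j, v i j * x i j) ∧
    ∃ i, ∑ j, v i j * x' i j < ∑ j, v i j * x i j

/-- Fractional Pareto optimality of a balanced allocation `A`: no balanced fractional allocation
Pareto-dominates it. -/
def IsFPO {n m : ℕ} (v : Fin n → Fin m → ℝ) (A : Fin n → Finset (Fin m)) : Prop :=
  ∀ x : Fin n → Fin m → ℝ, IsBalancedFractional x → ¬ ParetoDominates v x (toMatrix A)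

/-- Envy-freeness up to one good. -/
def IsEF1 {n m : ℕ} (v : Fin n → Fin m → ℝ) (A : Fin n → Finset (Fin m)) : Prop :=
  ∀ i i' : Fin n, A i' = ∅ ∨ ∃ j ∈ A i', value (v i) (A i' \ {j}) ≤ value (v i) (A i)

/-- There are at most two agent types: every agent has one of two valuations. -/
def AtMostTwoTypes {n m : ℕ} {R : Type*} (v : Fin n → Fin m → R) : Prop :=
  ∃ u₁ u₂ : Fin m → R, ∀ i, v i = u₁ ∨ v i = u₂

/-! ## Random-access programs with logarithmic (bit) cost -/

/-- The number of bits of an integer, one bit being reserved for the sign. -/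
def bits (z : ℤ) : ℕ := Nat.size z.natAbs + 1

/-- A memory: `s a l` is the content of cell `l` of the array named `a`. -/
abbrev Mem : Type := ℕ → ℕ → ℤ

/-- Integer expressions; `read a e` is the cell of array `a` whose index is the value of `e`. -/
inductive Expr : Type
  | const (z : ℤ) : Expr
  | read (a : ℕ) (e : Expr) : Expr
  | add (e₁ e₂ : Expr) : Expr
  | sub (e₁ e₂ : Expr) : Expr
  | mul (e₁ e₂ : Expr) : Expr
  | div (e₁ e₂ : Expr) : Expr

/-- The value of an expression. A negative index is read as `0`; `div` is the integer quotient,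
with value `0` for the divisor `0`. -/
def Expr.eval (s : Mem) : Expr → ℤ
  | .const z => z
  | .read a e => s a (e.eval s).toNat
  | .add e₁ e₂ => e₁.eval s + e₂.eval s
  | .sub e₁ e₂ => e₁.eval s - e₂.eval s
  | .mul e₁ e₂ => e₁.eval s * e₂.eval s
  | .div e₁ e₂ => e₁.eval s / e₂.eval s

/-- The time taken to evaluate an expression: every constant, memory access and arithmetic
operation is charged the bit length of the integers involved (arguments, indices, result). -/
def Expr.cost (s : Mem) : Expr → ℕ
  | .const z => bits z
  | .read a e => e.cost s + bits ((Expr.read a e).eval s)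
  | .add e₁ e₂ => e₁.cost s + e₂.cost s + bits ((Expr.add e₁ e₂).eval s)
  | .sub e₁ e₂ => e₁.cost s + e₂.cost s + bits ((Expr.sub e₁ e₂).eval s)
  | .mul e₁ e₂ => e₁.cost s + e₂.cost s + bits ((Expr.mul e₁ e₂).eval s)
  | .div e₁ e₂ => e₁.cost s + e₂.cost s + bits ((Expr.div e₁ e₂).eval s)

/-- Programs. `write a i e` is the assignment `a[i] := e`; the tests in `branch e c₁ c₂`
("if `e > 0` then `c₁` else `c₂`") and `loop e c` ("while `e > 0` do `c`") are for
positivity. -/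
inductive Program : Type
  | skip : Program
  | write (a : ℕ) (i e : Expr) : Program
  | seq (c₁ c₂ : Program) : Program
  | branch (e : Expr) (c₁ c₂ : Program) : Program
  | loop (e : Expr) (c : Program) : Program

/-- The memory `s` after the assignment of `z` to cell `l` of array `a`. -/
def Mem.set (s : Mem) (a l : ℕ) (z : ℤ) : Mem :=
  Function.update s a (Function.update (s a) l z)

/-- `Run c s s' t`: started in memory `s`, the program `c` halts in memory `s'` after exactly
time `t`. -/
inductive Run : Program → Mem → Mem → ℕ → Prop
  | skip (s : Mem) : Run .skip s s 1
  | write (a : ℕ) (i e : Expr) (s : Mem) :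
      Run (.write a i e) s (s.set a (i.eval s).toNat (e.eval s)) (i.cost s + e.cost s + 1)
  | seq {c₁ c₂ : Program} {s s' s'' : Mem} {t₁ t₂ : ℕ} :
      Run c₁ s s' t₁ → Run c₂ s' s'' t₂ → Run (.seq c₁ c₂) s s'' (t₁ + t₂ + 1)
  | branch_pos {e : Expr} {c₁ c₂ : Program} {s s' : Mem} {t : ℕ} :
      0 < e.eval s → Run c₁ s s' t → Run (.branch e c₁ c₂) s s' (e.cost s + t + 1)
  | branch_nonpos {e : Expr} {c₁ c₂ : Program} {s s' : Mem} {t : ℕ} :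
      e.eval s ≤ 0 → Run c₂ s s' t → Run (.branch e c₁ c₂) s s' (e.cost s + t + 1)
  | loop_done {e : Expr} {c : Program} {s : Mem} :
      e.eval s ≤ 0 → Run (.loop e c) s s (e.cost s + 1)
  | loop_step {e : Expr} {c : Program} {s s' s'' : Mem} {t₁ t₂ : ℕ} :
      0 < e.eval s → Run c s s' t₁ → Run (.loop e c) s' s'' t₂ →
      Run (.loop e c) s s'' (e.cost s + t₁ + t₂ + 1)

/-- The memory that holds a rational instance: array `0` holds `n` and `m`, and the cells
`i * m + j` of the arrays `1` and `2` hold the numerator and the denominator (in lowest terms)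
of `v i j`. All other cells are `0`. -/
def inputMem {n m : ℕ} (v : Fin n → Fin m → ℚ) : Mem := fun a l =>
  if a = 0 then
    if l = 0 then (n : ℤ) else if l = 1 then (m : ℤ) else 0
  else if a = 1 then
    if h : l < n * m then (v (Fin.divNat ⟨l, h⟩) (Fin.modNat ⟨l, h⟩)).num else 0
  else if a = 2 then
    if h : l < n * m then ((v (Fin.divNat ⟨l, h⟩) (Fin.modNat ⟨l, h⟩)).den : ℤ) else 0
  else 0

/-- The bit length of a rational instance. -/
def inputSize {n m : ℕ} (v : Fin n → Fin m → ℚ) : ℕ :=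
  bits n + bits m + ∑ i, ∑ j, (bits (v i j).num + bits (v i j).den)

/-- The memory `s` holds the allocation `A` as output: cell `j` of array `3` is the agent who
receives good `j`. -/
def Outputs {n m : ℕ} (s : Mem) (A : Fin n → Finset (Fin m)) : Prop :=
  ∀ (i : Fin n) (j : Fin m), j ∈ A i ↔ s 3 j = ((i : ℕ) : ℤ)

end FairDivision

/-!
Let `n₁` agents have the valuation `u₁` and `n₂` agents the valuation `u₂`, let `k = m / n`, and let
`S` be the set of the `n₁ * k` goods that go to the first group. If, for some `lam > 0`, these are
the goods on which `u₁ - lam * u₂` is largest, then every division of `S` and of its complement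
inside the groups maximizes the sum of values with weights `1` and `lam` over all balanced
fractional allocations, so it is fPO (`isFPO_of_isWeightOptimal`). It remains to achieve EF1.

*Inside the groups.* Sort `S` by `u₁` and cut it into `k` blocks of `n₁` consecutive goods; do the
same for `u₂`, and for the complement with blocks of `n₂` goods. Goods are the edges of a bipartite
graph whose vertices are the blocks for `u₁` and those for `u₂`, and a proper edge colouring by the
agents of the group, which exists by König's theorem and is found by Kempe chains
(`KempeState.step`), gives every agent exactly one good of every block, in both senses. For such
bundles EF1 follows from a comparison of the worst goods of the blocks of one set with the best
goods of all blocks but the first of the other one (`NoGroupEnvy`, `IsTransversal.ef1`); inside a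
group the comparison always holds.

*Between the groups.* Exchange a good of `S` for one outside that has the same weighted difference.
If the second group envies before the exchange, then the first one does not envy
afterwards (`noGroupEnvy_or_of_exchange`): both comparisons are about the goods that stay, on which
`u₁` is at least an increasing affine function of `u₂` for those in `S` and at most that function
for the others. For small `lam` the first group does not envy, for large `lam` the second one does
not. Hence, on the way through the critical values of `lam` and through single exchanges at each of
them, some `S` leaves neither group with envy (`exists_noGroupEnvy`).

*The algorithm.* A critical `lam` is given by two goods and a place on the way by a number less than
`m`, so all candidates for `S` can be tried; then the goods are coloured one by one. The tests are
written as terms with sums and products over the goods. Every term compiles to a program that runs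
in polynomial time (`Term.exists_compilesTo`), because a bounded number of nested sums and products
of `m` factors keeps bit lengths polynomial. `Triple` is a Hoare logic for programs built from such
terms, with polynomials bounding the time and with loops of `m` rounds.
-/

namespace FairDivision
open Finset

/-! ### Ranks and order statistics -/

section OrderStatistics

variable {α κ : Type*} [LinearOrder α] [LinearOrder κ]

/-- The position of `a` (counted from `0`) when `S` is sorted by decreasing `f`, ties being broken
by the order of `α`. -/
def rank (f : α → κ) (S : Finset α) (a : α) : ℕ :=
  #{b ∈ S | f a < f b ∨ (f a = f b ∧ b < a)}

theorem rank_lt_rank {f : α → κ} {S : Finset α} {a b : α} (hb : b ∈ S)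
    (h : f a < f b ∨ (f a = f b ∧ b < a)) : rank f S b < rank f S a := by
  apply card_lt_card
  refine ⟨fun c hc => ?_, fun hs => ?_⟩
  · simp only [mem_filter] at hc ⊢
    refine ⟨hc.1, ?_⟩
    grind
  · have : b ∈ ({c ∈ S | f b < f c ∨ (f b = f c ∧ c < b)} : Finset α) := hs (by simp [hb, h])
    simp at this

theorem rank_injOn (f : α → κ) (S : Finset α) : Set.InjOn (rank f S) S := by
  intro a ha b hb hab
  by_contra hne
  rcases lt_trichotomy (f a) (f b) with h | h | h
  · exact absurd hab (rank_lt_rank hb (.inl h)).ne'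
  · rcases lt_or_gt_of_ne hne with h' | h'
    · exact absurd hab (rank_lt_rank ha (.inr ⟨h.symm, h'⟩)).ne
    · exact absurd hab (rank_lt_rank hb (.inr ⟨h, h'⟩)).ne'
  · exact absurd hab (rank_lt_rank ha (.inl h)).ne

theorem rank_lt_card {f : α → κ} {S : Finset α} {a : α} (ha : a ∈ S) : rank f S a < #S := by
  refine card_lt_card ⟨filter_subset _ _, fun hs => ?_⟩
  have := hs ha
  simp at this

theorem image_rank (f : α → κ) (S : Finset α) : S.image (rank f S) = range #S := by
  apply eq_of_subset_of_card_le
  · intro r hr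
    obtain ⟨a, ha, rfl⟩ := mem_image.1 hr
    exact mem_range.2 (rank_lt_card ha)
  · rw [card_range, card_image_of_injOn (rank_injOn f S)]

theorem exists_rank_eq (f : α → κ) {S : Finset α} {r : ℕ} (hr : r < #S) :
    ∃ a ∈ S, rank f S a = r := by
  have : r ∈ S.image (rank f S) := by rw [image_rank]; exact mem_range.2 hr
  simpa using this

theorem card_filter_rank (f : α → κ) {S : Finset α} {I : Finset ℕ} (hI : I ⊆ range #S) :
    #{a ∈ S | rank f S a ∈ I} = #I := by
  rw [← card_image_of_injOn (f := rank f S) (s := {a ∈ S | rank f S a ∈ I})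
    ((rank_injOn f S).mono (fun a ha => (mem_filter.1 ha).1))]
  congr 1
  ext r
  simp only [mem_image, mem_filter]
  constructor
  · rintro ⟨a, ⟨_, h⟩, rfl⟩; exact h
  · intro h
    obtain ⟨a, ha, rfl⟩ := exists_rank_eq f (mem_range.1 (hI h))
    exact ⟨a, ⟨ha, h⟩, rfl⟩

theorem rank_congr {κ' : Type*} [LinearOrder κ'] {f : α → κ} {g : α → κ'}
    (h : ∀ a b, f a < f b ↔ g a < g b) : rank f = rank g := by
  have h2 : ∀ a b, f a = f b ↔ g a = g b := fun a b => by
    rw [le_antisymm_iff, le_antisymm_iff, ← not_lt, ← not_lt, ← not_lt, ← not_lt, h, h]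
  funext S a
  simp only [rank, h, h2]

theorem exists_top {f : α → κ} {S : Finset α} {N : ℕ} (hN : N ≤ #S) :
    #{a ∈ S | rank f S a < N} = N ∧
      ∀ a ∈ S, ∀ b ∈ S, rank f S a < N → ¬ rank f S b < N → f b ≤ f a := by
  refine ⟨?_, fun a ha b hb h1 h2 => ?_⟩
  · simpa using card_filter_rank f (S := S) (I := range N) (by simpa using hN)
  · by_contra hlt
    have := rank_lt_rank hb (.inl (not_le.1 hlt))
    omega

/-- The value at position `r` (counted from `0`) of the values of `f` on `S` in decreasing order;
it is `0` beyond the size of `S`. -/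
noncomputable def orderStat (f : α → ℝ) (S : Finset α) (r : ℕ) : ℝ :=
  ∑ a ∈ S with rank f S a = r, f a

theorem orderStat_rank {f : α → ℝ} {S : Finset α} {a : α} (ha : a ∈ S) :
    orderStat f S (rank f S a) = f a := by
  rw [orderStat, show ({b ∈ S | rank f S b = rank f S a} : Finset α) = {a} by
    ext b
    simp only [mem_filter, mem_singleton]
    exact ⟨fun h => rank_injOn f S h.1 ha h.2, by rintro rfl; exact ⟨ha, rfl⟩⟩, sum_singleton]

theorem orderStat_eq_zero {f : α → ℝ} {S : Finset α} {r : ℕ} (h : #S ≤ r) :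
    orderStat f S r = 0 := by
  rw [orderStat, filter_eq_empty_iff.2, sum_empty]
  intro a ha
  have := rank_lt_card (f := f) ha
  omega

theorem orderStat_nonneg {f : α → ℝ} (hf : ∀ a, 0 ≤ f a) (S : Finset α) (r : ℕ) :
    0 ≤ orderStat f S r :=
  sum_nonneg fun a _ => hf a

theorem orderStat_mem (f : α → ℝ) {S : Finset α} {r : ℕ} (h : r < #S) :
    ∃ a ∈ S, orderStat f S r = f a := by
  obtain ⟨a, ha, rfl⟩ := exists_rank_eq f h
  exact ⟨a, ha, orderStat_rank ha⟩

/-- The characterization through upper level sets from which all comparisons of order statistics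
follow. -/
theorem le_orderStat_iff (f : α → ℝ) {S : Finset α} {r : ℕ} (h : r < #S) (τ : ℝ) :
    τ ≤ orderStat f S r ↔ r < #{a ∈ S | τ ≤ f a} := by
  obtain ⟨a, ha, rfl⟩ := exists_rank_eq f h
  rw [orderStat_rank ha]
  constructor
  · intro hτ
    refine card_lt_card ⟨fun b hb => ?_, fun hs => ?_⟩
    · simp only [mem_filter] at hb ⊢
      refine ⟨hb.1, ?_⟩
      rcases hb.2 with h | h <;> linarith [h]
    · have := hs (mem_filter.2 ⟨ha, hτ⟩)
      simp at this
  · intro hr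
    by_contra hτ
    refine absurd hr (not_lt.2 (card_le_card fun b hb => ?_))
    simp only [mem_filter] at hb ⊢
    exact ⟨hb.1, .inl (by linarith [hb.2])⟩

theorem orderStat_antitone {f : α → ℝ} {S : Finset α} {r r' : ℕ} (h : r' < #S) (hr : r ≤ r') :
    orderStat f S r' ≤ orderStat f S r := by
  rw [le_orderStat_iff f (hr.trans_lt h)]
  exact hr.trans_lt ((le_orderStat_iff f h _).1 le_rfl)

theorem orderStat_mono_fun {f g : α → ℝ} {S : Finset α} {r : ℕ} (h : r < #S)
    (hfg : ∀ a ∈ S, f a ≤ g a) : orderStat f S r ≤ orderStat g S r := by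
  rw [le_orderStat_iff g h]
  refine ((le_orderStat_iff f h _).1 le_rfl).trans_le (card_le_card fun a ha => ?_)
  simp only [mem_filter] at ha ⊢
  exact ⟨ha.1, ha.2.trans (hfg a ha.1)⟩

theorem orderStat_le_of_card_le {f : α → ℝ} {S S' : Finset α} {r r' : ℕ} (h : r < #S)
    (h' : r' < #S')
    (hc : ∀ τ, r < #{a ∈ S | τ ≤ f a} → r' < #{a ∈ S' | τ ≤ f a}) :
    orderStat f S r ≤ orderStat f S' r' :=
  (le_orderStat_iff f h' _).2 (hc _ ((le_orderStat_iff f h _).1 le_rfl))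

theorem orderStat_le_insert {f : α → ℝ} {Y : Finset α} {b : α} {r : ℕ} (h : r < #Y) :
    orderStat f Y r ≤ orderStat f (insert b Y) r := by
  refine orderStat_le_of_card_le h (h.trans_le (card_le_card (subset_insert _ _))) fun τ hτ => ?_
  exact hτ.trans_le (card_le_card (filter_subset_filter _ (subset_insert _ _)))

theorem orderStat_insert_succ_le {f : α → ℝ} {Y : Finset α} {b : α} {r : ℕ} (hb : b ∉ Y)
    (h : r < #Y) : orderStat f (insert b Y) (r + 1) ≤ orderStat f Y r := by
  refine orderStat_le_of_card_le (by rw [card_insert_of_notMem hb]; omega) h fun τ hτ => ?_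
  have h1 : ({a ∈ insert b Y | τ ≤ f a} : Finset α) ⊆ insert b {a ∈ Y | τ ≤ f a} := by
    intro a; simp only [mem_filter, mem_insert]; tauto
  have := (card_le_card h1).trans (card_insert_le _ _)
  omega

theorem orderStat_affine (f : α → ℝ) {S : Finset α} {r : ℕ} (h : r < #S) {p c : ℝ} (hp : 0 < p) :
    orderStat (fun a => p * f a + c) S r = p * orderStat f S r + c := by
  have hr : rank (fun a => p * f a + c) = rank f :=
    rank_congr fun a b => by simp [hp]
  obtain ⟨a, ha, rfl⟩ := exists_rank_eq f h
  rw [orderStat_rank ha, ← hr, orderStat_rank ha]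

end OrderStatistics

/-! ### Optimal sets of goods without envy between the groups -/

section Selection

variable {α : Type*}

/-- The multiplier `1`, or one at which two goods, one of them better for both types, become equally
attractive. Only at such multipliers do the sets that maximize the weighted value change. -/
def IsCritical (u₁ u₂ : α → ℝ) (lam : ℝ) : Prop :=
  lam = 1 ∨ ∃ a b, u₁ b < u₁ a ∧ u₂ b < u₂ a ∧ lam = (u₁ a - u₁ b) / (u₂ a - u₂ b)

theorem IsCritical.pos {u₁ u₂ : α → ℝ} {lam : ℝ} (h : IsCritical u₁ u₂ lam) : 0 < lam := by
  rcases h with rfl | ⟨a, b, h1, h2, rfl⟩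
  · exact one_pos
  · exact div_pos (by linarith) (by linarith)

theorem finite_isCritical [Fintype α] (u₁ u₂ : α → ℝ) : {lam | IsCritical u₁ u₂ lam}.Finite := by
  refine ((Set.finite_range fun p : α × α =>
    (u₁ p.1 - u₁ p.2) / (u₂ p.1 - u₂ p.2)).union (Set.finite_singleton 1)).subset ?_
  rintro lam (rfl | ⟨a, b, -, -, rfl⟩)
  · exact .inr rfl
  · exact .inl ⟨(a, b), rfl⟩

variable [LinearOrder α]

/-- Group-wise absence of envy: `n₁` agents with valuation `f` share `S`, and `n₂` agents share `T`,
in bundles of `k` goods. The worst goods of all blocks of `n₁` consecutive goods of `S` are together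
worth at least as much as the best goods of all blocks of `n₂` goods of `T` but the first.
(Positions are counted from `0`, so block `b` ends at position `(b + 1) * n₁ - 1`; the last block
of `S` is not needed.) -/
def NoGroupEnvy (f : α → ℝ) (k n₁ : ℕ) (S : Finset α) (n₂ : ℕ) (T : Finset α) : Prop :=
  ∑ b ∈ Ico 1 k, orderStat f T (b * n₂) ≤ ∑ b ∈ Ico 1 k, orderStat f S (b * n₁ - 1)

/-- The goods of `S` are those on which the weighted difference `u₁ - lam * u₂` is largest. -/
def IsWeightOptimal (u₁ u₂ : α → ℝ) (lam : ℝ) (S : Finset α) : Prop :=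
  ∀ a ∈ S, ∀ b ∉ S, u₁ b - lam * u₂ b ≤ u₁ a - lam * u₂ a

/-- The way from `A` to `B` in single exchanges: the first `d` goods of `A \ B` have been replaced
by the first `d` goods of `B \ A`. -/
def walk [Fintype α] (A B : Finset α) (d : ℕ) : Finset α :=
  {j | (j ∈ A ∧ j ∈ B) ∨ (j ∈ A ∧ j ∉ B ∧ d ≤ rank (fun _ => ()) (A \ B) j) ∨
    (j ∉ A ∧ j ∈ B ∧ rank (fun _ => ()) (B \ A) j < d)}

theorem IsWeightOptimal.insert_erase {u₁ u₂ : α → ℝ} {lam : ℝ} {S : Finset α}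
    (h : IsWeightOptimal u₁ u₂ lam S) {a b : α} (ha : a ∈ S) (hb : b ∉ S)
    (hab : u₁ a - lam * u₂ a = u₁ b - lam * u₂ b) :
    IsWeightOptimal u₁ u₂ lam (insert b (S.erase a)) := by
  intro x hx y hy
  simp only [mem_insert, mem_erase, not_or, not_and] at hx hy
  have hb' := h a ha
  have ha' : ∀ x ∈ S, u₁ b - lam * u₂ b ≤ u₁ x - lam * u₂ x := fun x hx => h x hx b hb
  by_cases hya : y = a
  · subst hya
    rcases hx with rfl | hx
    · exact hab.le
    · exact hab.le.trans (ha' x hx.2)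
  · have hyS := hy.2 hya
    rcases hx with rfl | hx
    · exact hab ▸ h a ha y hyS
    · exact h x hx.2 y hyS

/-- If every good of `S` is worth at least as much as every good of `T`, there is no envy. -/
theorem NoGroupEnvy.of_forall_le {f : α → ℝ} {S T : Finset α} {k n₁ n₂ : ℕ} (hf : ∀ a, 0 ≤ f a)
    (h₁ : 0 < n₁) (hS : #S = n₁ * k) (hT : #T = n₂ * k) (h : ∀ a ∈ S, ∀ b ∈ T, f b ≤ f a) :
    NoGroupEnvy f k n₁ S n₂ T := by
  refine sum_le_sum fun r hr => ?_
  rw [mem_Ico] at hr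
  rcases n₂.eq_zero_or_pos with h0 | h0
  · rw [orderStat_eq_zero (by simp [hT, h0])]
    exact orderStat_nonneg hf _ _
  · obtain ⟨a, ha, ea⟩ := orderStat_mem f (S := S) (r := r * n₁ - 1) (by
      have : r * n₁ + n₁ ≤ n₁ * k := by nlinarith
      omega)
    obtain ⟨b, hb, eb⟩ := orderStat_mem f (S := T) (r := r * n₂) (by
      have : r * n₂ + n₂ ≤ n₂ * k := by nlinarith
      omega)
    rw [ea, eb]
    exact h a ha b hb

variable [Fintype α]

theorem walk_zero (A B : Finset α) : walk A B 0 = A := by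
  ext j; simp only [walk, mem_filter, mem_univ, true_and]; grind

theorem walk_of_card_le {A B : Finset α} (h : #A = #B) {d : ℕ} (hd : #(A \ B) ≤ d) :
    walk A B d = B := by
  ext j
  have h' : #(A \ B) = #(B \ A) := by
    rw [card_sdiff_comm h]
  have h1 : j ∈ A → j ∉ B → rank (fun _ => ()) (A \ B) j < d := fun ha hb =>
    (rank_lt_card (mem_sdiff.2 ⟨ha, hb⟩)).trans_le hd
  have h2 : j ∈ B → j ∉ A → rank (fun _ => ()) (B \ A) j < d := fun ha hb =>
    (rank_lt_card (mem_sdiff.2 ⟨ha, hb⟩)).trans_le (h' ▸ hd)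
  simp only [walk, mem_filter, mem_univ, true_and]
  by_cases ha : j ∈ A <;> by_cases hb : j ∈ B <;> simp [ha, hb]
  · exact h1 ha hb
  · exact h2 hb ha

theorem walk_succ {A B : Finset α} (h : #A = #B) {d : ℕ} (hd : d < #(A \ B)) :
    ∃ a ∈ A \ B, ∃ b ∈ B \ A, a ∈ walk A B d ∧ b ∉ walk A B d ∧
      walk A B (d + 1) = insert b ((walk A B d).erase a) := by
  obtain ⟨a, ha, hra⟩ := exists_rank_eq (fun _ => ()) hd
  obtain ⟨b, hb, hrb⟩ := exists_rank_eq (fun _ => ()) (card_sdiff_comm h ▸ hd)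
  have ia : ∀ j ∈ A \ B, rank (fun _ => ()) (A \ B) j = d ↔ j = a := fun j hj =>
    ⟨fun h => rank_injOn _ _ hj ha (h.trans hra.symm), fun h => h ▸ hra⟩
  have ib : ∀ j ∈ B \ A, rank (fun _ => ()) (B \ A) j = d ↔ j = b := fun j hj =>
    ⟨fun h => rank_injOn _ _ hj hb (h.trans hrb.symm), fun h => h ▸ hrb⟩
  refine ⟨a, ha, b, hb, ?_, ?_, ?_⟩
  · rw [mem_sdiff] at ha
    simp [walk, ha, hra]
  · rw [mem_sdiff] at hb
    simp [walk, hb, hrb]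
  · ext j
    have ia' := ia j
    have ib' := ib j
    rw [mem_sdiff] at ha hb ia' ib'
    simp only [walk, mem_filter, mem_univ, true_and, mem_insert, mem_erase]
    by_cases hjA : j ∈ A <;> by_cases hjB : j ∈ B
    · have h1 : j ≠ a := fun h => ha.2 (h ▸ hjB)
      simp [hjA, hjB, h1]
    · have h1 : j ≠ b := fun h => hjB (h ▸ hb.1)
      have e := ia' ⟨hjA, hjB⟩
      simp only [hjA, hjB, h1, ne_eq, ← e]
      simp only [true_and, and_false, false_or, not_true, not_false_eq_true, false_and, or_false]
      omega
    · have h1 : j ≠ a := fun h => hjA (h ▸ ha.1)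
      have e := ib' ⟨hjB, hjA⟩
      simp only [hjA, hjB, h1, ne_eq, ← e]
      simp only [true_and, false_and, false_or, not_true, not_false_eq_true]
      omega
    · have h1 : j ≠ b := fun h => hjB (h ▸ hb.1)
      simp [hjA, hjB, h1]

/-- The exchange lemma: on an indifferent exchange of one good, the envy of the second group before
the exchange and the envy of the first group after it exclude each other. -/
theorem noGroupEnvy_or_of_exchange {u₁ u₂ : α → ℝ} {lam : ℝ} (hlam : 0 < lam) {S : Finset α}
    {k n₁ n₂ : ℕ} (h₁ : 0 < n₁) (hS : #S = n₁ * k) (hT : #Sᶜ = n₂ * k)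
    (hopt : IsWeightOptimal u₁ u₂ lam S) {a b : α} (ha : a ∈ S) (hb : b ∉ S)
    (hab : u₁ a - lam * u₂ a = u₁ b - lam * u₂ b) :
    NoGroupEnvy u₂ k n₂ Sᶜ n₁ S ∨
      NoGroupEnvy u₁ k n₁ (insert b (S.erase a)) n₂ (insert b (S.erase a))ᶜ := by
  by_contra hcon
  rw [not_or, NoGroupEnvy, NoGroupEnvy, not_le, not_le] at hcon
  obtain ⟨hc2, hc1⟩ := hcon
  set Y := S.erase a with hY
  set Z := Sᶜ.erase b with hZ
  set c := u₁ a - lam * u₂ a with hc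
  have hbS : b ∈ Sᶜ := mem_compl.2 hb
  have haY : a ∉ Y := notMem_erase a S
  have hbZ : b ∉ Z := notMem_erase b _
  have hSY : S = insert a Y := (insert_erase ha).symm
  have hTZ : Sᶜ = insert b Z := (insert_erase hbS).symm
  have hT' : (insert b Y)ᶜ = insert a Z := by
    ext x
    simp only [hY, hZ, mem_compl, mem_insert, mem_erase]
    grind
  have haZ : a ∉ Z := by simp [hZ, ha]
  have cY : #Y + 1 = n₁ * k := by rw [← hS, hY, card_erase_add_one ha]
  have cZ : #Z + 1 = n₂ * k := by rw [← hT, hZ, card_erase_add_one hbS]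
  have h₂ : 0 < n₂ := Nat.pos_of_ne_zero fun h => by simp [h] at cZ
  have ineq : ∀ r ∈ Ico 1 k, r * n₁ - 1 + 1 = r * n₁ ∧ r * n₂ - 1 + 1 = r * n₂ ∧
      r * n₁ - 1 < #Y ∧ r * n₂ - 1 < #Z := by
    intro r hr
    rw [mem_Ico] at hr
    have e1 : r * n₁ + n₁ ≤ n₁ * k := by nlinarith
    have e2 : r * n₂ + n₂ ≤ n₂ * k := by nlinarith
    have e3 : 0 < r * n₁ := Nat.mul_pos hr.1 h₁
    have e4 : 0 < r * n₂ := Nat.mul_pos hr.1 h₂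
    omega
  rw [hT'] at hc1
  -- Without `a` and `b`, positions shift by at most one: this is `b1` to `b4`. By optimality,
  -- `u₁` is at least `lam * u₂ + c` on `Y` and at most that on `Z`: this is `b5` and `b6`.
  have b1 : ∑ r ∈ Ico 1 k, orderStat u₁ (insert a Z) (r * n₂) ≤
      ∑ r ∈ Ico 1 k, orderStat u₁ Z (r * n₂ - 1) := sum_le_sum fun r hr => by
    obtain ⟨-, e, -, l⟩ := ineq r hr
    rw [← e, Nat.add_sub_cancel]
    exact orderStat_insert_succ_le haZ l
  have b2 : ∑ r ∈ Ico 1 k, orderStat u₁ Y (r * n₁ - 1) ≤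
      ∑ r ∈ Ico 1 k, orderStat u₁ (insert b Y) (r * n₁ - 1) := sum_le_sum fun r hr =>
    orderStat_le_insert (ineq r hr).2.2.1
  have b3 : ∑ r ∈ Ico 1 k, orderStat u₂ S (r * n₁) ≤
      ∑ r ∈ Ico 1 k, orderStat u₂ Y (r * n₁ - 1) := sum_le_sum fun r hr => by
    obtain ⟨e, -, l, -⟩ := ineq r hr
    rw [← e, Nat.add_sub_cancel, hSY]
    exact orderStat_insert_succ_le haY l
  have b4 : ∑ r ∈ Ico 1 k, orderStat u₂ Z (r * n₂ - 1) ≤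
      ∑ r ∈ Ico 1 k, orderStat u₂ Sᶜ (r * n₂ - 1) := sum_le_sum fun r hr => by
    rw [hTZ]
    exact orderStat_le_insert (ineq r hr).2.2.2
  have b5 : ∑ r ∈ Ico 1 k, (lam * orderStat u₂ Y (r * n₁ - 1) + c) ≤
      ∑ r ∈ Ico 1 k, orderStat u₁ Y (r * n₁ - 1) := sum_le_sum fun r hr => by
    rw [← orderStat_affine u₂ (ineq r hr).2.2.1 hlam]
    refine orderStat_mono_fun (ineq r hr).2.2.1 fun x hx => ?_
    have := hopt x (mem_of_mem_erase hx) b hb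
    linarith
  have b6 : ∑ r ∈ Ico 1 k, orderStat u₁ Z (r * n₂ - 1) ≤
      ∑ r ∈ Ico 1 k, (lam * orderStat u₂ Z (r * n₂ - 1) + c) := sum_le_sum fun r hr => by
    rw [← orderStat_affine u₂ (ineq r hr).2.2.2 hlam]
    refine orderStat_mono_fun (ineq r hr).2.2.2 fun x hx => ?_
    have := hopt a ha x (mem_compl.1 (mem_of_mem_erase hx))
    linarith
  rw [sum_add_distrib, ← mul_sum] at b5 b6
  have := mul_lt_mul_of_pos_left (b4.trans_lt (hc2.trans_le b3)) hlam
  linarith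

theorem card_compl_of_card {S : Finset α} {k n₁ n₂ : ℕ} (hS : #S = n₁ * k)
    (hα : Fintype.card α = (n₁ + n₂) * k) : #Sᶜ = n₂ * k := by
  rw [card_compl, hS, hα, add_mul]; omega

theorem walk_succ_of_isWeightOptimal {u₁ u₂ : α → ℝ} {lam : ℝ} {A B : Finset α} (hAB : #A = #B)
    (hoA : IsWeightOptimal u₁ u₂ lam A) (hoB : IsWeightOptimal u₁ u₂ lam B) {d : ℕ}
    (hd : d < #(A \ B)) : ∃ a ∈ walk A B d, ∃ b ∉ walk A B d,
      u₁ a - lam * u₂ a = u₁ b - lam * u₂ b ∧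
      walk A B (d + 1) = insert b ((walk A B d).erase a) := by
  obtain ⟨a, ha, b, hb, haw, hbw, he⟩ := walk_succ hAB hd
  rw [mem_sdiff] at ha hb
  exact ⟨a, haw, b, hbw, le_antisymm (hoB b hb.1 a ha.2) (hoA a ha.1 b hb.2), he⟩

theorem walk_spec {u₁ u₂ : α → ℝ} {lam : ℝ} {A B : Finset α} {N : ℕ} (hA : #A = N)
    (hB : #B = N) (hoA : IsWeightOptimal u₁ u₂ lam A) (hoB : IsWeightOptimal u₁ u₂ lam B) {d : ℕ}
    (hd : d ≤ #(A \ B)) : #(walk A B d) = N ∧ IsWeightOptimal u₁ u₂ lam (walk A B d) := by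
  induction d with
  | zero => rw [walk_zero]; exact ⟨hA, hoA⟩
  | succ d ih =>
    obtain ⟨hc, ho⟩ := ih (by omega)
    obtain ⟨a, ha, b, hb, hab, he⟩ :=
      walk_succ_of_isWeightOptimal (hA.trans hB.symm) hoA hoB (Nat.lt_of_succ_le hd)
    rw [he]
    refine ⟨?_, ho.insert_erase ha hb hab⟩
    rw [card_insert_of_notMem (fun h => hb (mem_of_mem_erase h)), card_erase_add_one ha, hc]

/-- On a way between two optimal sets that starts without envy of the first group, either some set
leaves neither group with envy, or in the end the second group envies and the first one still does
not. -/
theorem exists_walk_or {u₁ u₂ : α → ℝ} {lam : ℝ} (hlam : 0 < lam) {A B : Finset α}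
    {k n₁ n₂ : ℕ} (h₁ : 0 < n₁) (hA : #A = n₁ * k) (hB : #B = n₁ * k)
    (hα : Fintype.card α = (n₁ + n₂) * k)
    (hoA : IsWeightOptimal u₁ u₂ lam A) (hoB : IsWeightOptimal u₁ u₂ lam B)
    (hPA : NoGroupEnvy u₁ k n₁ A n₂ Aᶜ) :
    (∃ d ≤ #(A \ B), NoGroupEnvy u₁ k n₁ (walk A B d) n₂ (walk A B d)ᶜ ∧
        NoGroupEnvy u₂ k n₂ (walk A B d)ᶜ n₁ (walk A B d)) ∨
      (NoGroupEnvy u₁ k n₁ B n₂ Bᶜ ∧ ¬ NoGroupEnvy u₂ k n₂ Bᶜ n₁ B) := by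
  by_contra hcon
  rw [not_or] at hcon
  obtain ⟨hno, hB'⟩ := hcon
  have hAB : #A = #B := hA.trans hB.symm
  have key : ∀ d ≤ #(A \ B), NoGroupEnvy u₁ k n₁ (walk A B d) n₂ (walk A B d)ᶜ := by
    intro d
    induction d with
    | zero => intro _; rwa [walk_zero]
    | succ d ih =>
      intro hd
      have hP := ih (by omega)
      obtain ⟨hc, ho⟩ := walk_spec hA hB hoA hoB (d := d) (by omega)
      obtain ⟨a, ha, b, hb, hab, he⟩ :=
        walk_succ_of_isWeightOptimal hAB hoA hoB (Nat.lt_of_succ_le hd)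
      rw [he]
      exact (noGroupEnvy_or_of_exchange hlam h₁ hc (card_compl_of_card hc hα) ho ha hb
        hab).resolve_left fun h => hno ⟨d, by omega, hP, h⟩
  have hl := key _ le_rfl
  have hno' : ¬ NoGroupEnvy u₂ k n₂ (walk A B #(A \ B))ᶜ n₁ (walk A B #(A \ B)) := fun h =>
    hno ⟨_, le_rfl, hl, h⟩
  rw [walk_of_card_le hAB le_rfl] at hl hno'
  exact hB' ⟨hl, hno'⟩

/-- An optimal set without envy of the first group stays so if ties are broken in favour of
that group. -/
theorem NoGroupEnvy.of_tie_breaking {u₁ u₂ : α → ℝ} {lam : ℝ} {S A : Finset α}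
    {k n₁ n₂ : ℕ} (h₁ : 0 < n₁) (hu : ∀ a, 0 ≤ u₁ a) (hS : #S = n₁ * k) (hA : #A = n₁ * k)
    (hα : Fintype.card α = (n₁ + n₂) * k) (ho : IsWeightOptimal u₁ u₂ lam S)
    (hoA : ∀ a ∈ A, ∀ b ∉ A, u₁ b - lam * u₂ b < u₁ a - lam * u₂ a ∨
      (u₁ b - lam * u₂ b = u₁ a - lam * u₂ a ∧ u₁ b ≤ u₁ a))
    (hP : NoGroupEnvy u₁ k n₁ S n₂ Sᶜ) : NoGroupEnvy u₁ k n₁ A n₂ Aᶜ := by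
  have hcompl : ∀ X : Finset α, #X = n₁ * k → #Xᶜ = n₂ * k := fun X hX =>
    card_compl_of_card hX hα
  have hlev : ∀ τ, #{a ∈ S | τ ≤ u₁ a} ≤ #{a ∈ A | τ ≤ u₁ a} := by
    intro τ
    have hsplit : ∀ X Y : Finset α, #{a ∈ X | τ ≤ u₁ a} =
        #{a ∈ X ∩ Y | τ ≤ u₁ a} + #{a ∈ X \ Y | τ ≤ u₁ a} := fun X Y => by
      rw [← card_union_of_disjoint]
      · congr 1; ext x; simp only [mem_filter, mem_union, mem_inter, mem_sdiff]; tauto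
      · refine disjoint_left.2 fun x => ?_
        simp only [mem_filter, mem_inter, mem_sdiff]; tauto
    rw [hsplit S A, hsplit A S, inter_comm]
    refine Nat.add_le_add_left ?_ _
    rcases ({a ∈ S \ A | τ ≤ u₁ a} : Finset α).eq_empty_or_nonempty with h | ⟨b, hb⟩
    · simp [h]
    · refine (card_filter_le _ _).trans ?_
      rw [card_sdiff_comm (hS.trans hA.symm)]
      refine card_le_card fun a ha => mem_filter.2 ⟨ha, ?_⟩
      simp only [mem_filter, mem_sdiff] at hb ha
      have e1 := hoA a ha.1 b hb.1.2
      have e2 := ho b hb.1.1 a ha.2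
      rcases e1 with e1 | e1
      · linarith
      · exact hb.2.trans e1.2
  have hlev' : ∀ τ, #{a ∈ Aᶜ | τ ≤ u₁ a} ≤ #{a ∈ Sᶜ | τ ≤ u₁ a} := by
    intro τ
    have hsplit : ∀ X : Finset α, #{a ∈ X | τ ≤ u₁ a} + #{a ∈ Xᶜ | τ ≤ u₁ a} =
        #{a : α | τ ≤ u₁ a} := fun X => by
      rw [← card_union_of_disjoint]
      · congr 1; ext x; simp only [mem_filter, mem_union, mem_compl, mem_univ]; tauto
      · refine disjoint_left.2 fun x => ?_
        simp only [mem_filter, mem_compl]; tauto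
    have := hsplit A
    have := hsplit S
    have := hlev τ
    omega
  have hk : ∀ r ∈ Ico 1 k, ∀ n, 0 < n → r * n - 1 < n * k ∧ r * n < n * k := by
    intro r hr n hn
    rw [mem_Ico] at hr
    have e1 : r * n + n ≤ n * k := by nlinarith
    omega
  refine (sum_le_sum fun r hr => ?_).trans (hP.trans (sum_le_sum fun r hr => ?_))
  · rcases n₂.eq_zero_or_pos with h0 | h0
    · rw [orderStat_eq_zero (by simp [hcompl A hA, h0])]
      exact orderStat_nonneg hu _ _
    · have := (hk r hr n₂ h0).2
      exact orderStat_le_of_card_le (by rwa [hcompl A hA]) (by rwa [hcompl S hS])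
        fun τ hτ => hτ.trans_le (hlev' τ)
  · have := (hk r hr n₁ h₁).1
    exact orderStat_le_of_card_le (by rwa [hS]) (by rwa [hA]) fun τ hτ => hτ.trans_le (hlev τ)

/-- A set that is optimal for one multiplier is optimal for a critical one that is not smaller, or
else for all larger ones; then it has the goods that are worst for the second type. -/
theorem IsWeightOptimal.exists_critical {u₁ u₂ : α → ℝ} {lam : ℝ} (hlam : 0 < lam) {S : Finset α}
    (h : IsWeightOptimal u₁ u₂ lam S) :
    (∃ mu ≥ lam, IsCritical u₁ u₂ mu ∧ IsWeightOptimal u₁ u₂ mu S) ∨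
      ((∀ mu ≥ lam, IsWeightOptimal u₁ u₂ mu S) ∧ ∀ a ∈ S, ∀ b ∉ S, u₂ a ≤ u₂ b) := by
  have hup : ∀ mu ≥ lam, ∀ a ∈ S, ∀ b ∉ S, u₂ a ≤ u₂ b →
      u₁ b - mu * u₂ b ≤ u₁ a - mu * u₂ a := fun mu hmu a ha b hb hab => by
    have := h a ha b hb
    nlinarith
  rcases (({p ∈ S ×ˢ Sᶜ | u₂ p.2 < u₂ p.1} : Finset (α × α))).eq_empty_or_nonempty with he | hne
  · right
    have : ∀ a ∈ S, ∀ b ∉ S, u₂ a ≤ u₂ b := fun a ha b hb => by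
      by_contra hlt
      have : (a, b) ∈ ({p ∈ S ×ˢ Sᶜ | u₂ p.2 < u₂ p.1} : Finset (α × α)) := by
        simpa [ha, hb] using hlt
      simp [he] at this
    exact ⟨fun mu hmu a ha b hb => hup mu hmu a ha b hb (this a ha b hb), this⟩
  · left
    obtain ⟨⟨a, b⟩, hab, hmin⟩ := exists_min_image _
      (fun p => (u₁ p.1 - u₁ p.2) / (u₂ p.1 - u₂ p.2)) hne
    simp only [mem_filter, mem_product, mem_compl] at hab hmin
    obtain ⟨⟨ha, hb⟩, hlt⟩ := hab
    have hge : lam ≤ (u₁ a - u₁ b) / (u₂ a - u₂ b) := by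
      rw [le_div_iff₀ (by linarith)]
      linarith [h a ha b hb]
    refine ⟨_, hge, .inr ⟨a, b, ?_, hlt, rfl⟩, fun x hx y hy => ?_⟩
    · have := h a ha b hb
      nlinarith
    · rcases le_or_gt (u₂ x) (u₂ y) with hxy | hxy
      · exact hup _ hge x hx y hy hxy
      · have := hmin (x, y) ⟨⟨hx, hy⟩, hxy⟩
        rw [le_div_iff₀ (by simpa using hxy)] at this
        linarith

open Filter Topology in
/-- If ties are broken in favour of the second group, optimality persists for slightly larger
multipliers. -/
theorem exists_gt_isWeightOptimal {u₁ u₂ : α → ℝ} {lam : ℝ} (hlam : 0 < lam) {B : Finset α}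
    (hB : ∀ a ∈ B, ∀ b ∉ B, u₁ b - lam * u₂ b < u₁ a - lam * u₂ a ∨
      (u₁ b - lam * u₂ b = u₁ a - lam * u₂ a ∧ u₁ a ≤ u₁ b)) :
    ∃ mu > lam, IsWeightOptimal u₁ u₂ mu B := by
  have : ∀ᶠ mu in 𝓝[>] lam, ∀ a ∈ B, ∀ b ∈ Bᶜ, u₁ b - mu * u₂ b ≤ u₁ a - mu * u₂ a := by
    rw [eventually_all_finset]
    intro a ha
    rw [eventually_all_finset]
    intro b hb
    rcases hB a ha b (mem_compl.1 hb) with h | ⟨h, h'⟩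
    · refine eventually_nhdsWithin_of_eventually_nhds ?_
      have hcont : Continuous fun mu : ℝ => (u₁ a - mu * u₂ a) - (u₁ b - mu * u₂ b) := by fun_prop
      have := hcont.continuousAt.eventually (lt_mem_nhds (show (0 : ℝ) < _ from sub_pos.2 h))
      filter_upwards [this] with mu hmu
      linarith
    · filter_upwards [self_mem_nhdsWithin] with mu hmu
      have : lam < mu := hmu
      have h3 : u₂ a ≤ u₂ b := by
        by_contra hlt
        nlinarith
      nlinarith
  obtain ⟨mu, h1, h2⟩ := (this.and self_mem_nhdsWithin).exists
  exact ⟨mu, h2, fun a ha b hb => h1 a ha b (mem_compl.2 hb)⟩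

open Filter Topology in
/-- A set that is best for the first group, ties being broken in favour of the second one, is
optimal for a small multiplier. -/
theorem exists_small_isWeightOptimal {u₁ u₂ : α → ℝ} {B : Finset α}
    (hB : ∀ a ∈ B, ∀ b ∉ B, u₁ b < u₁ a ∨ (u₁ b = u₁ a ∧ u₂ a ≤ u₂ b)) :
    ∃ mu > 0, mu ≤ 1 ∧ IsWeightOptimal u₁ u₂ mu B := by
  have : ∀ᶠ mu in 𝓝[>] (0 : ℝ), ∀ a ∈ B, ∀ b ∈ Bᶜ, u₁ b - mu * u₂ b ≤ u₁ a - mu * u₂ a := by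
    rw [eventually_all_finset]
    intro a ha
    rw [eventually_all_finset]
    intro b hb
    rcases hB a ha b (mem_compl.1 hb) with h | ⟨h, h'⟩
    · refine eventually_nhdsWithin_of_eventually_nhds ?_
      have hcont : Continuous fun mu : ℝ => (u₁ a - mu * u₂ a) - (u₁ b - mu * u₂ b) := by fun_prop
      have := (hcont.tendsto 0).eventually (lt_mem_nhds (show (0 : ℝ) < _ by simpa using h))
      filter_upwards [this] with mu hmu
      linarith
    · filter_upwards [self_mem_nhdsWithin] with mu hmu
      have : 0 < mu := hmu
      nlinarith
  have h1 : ∀ᶠ mu in 𝓝[>] (0 : ℝ), mu ≤ 1 :=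
    eventually_nhdsWithin_of_eventually_nhds (ge_mem_nhds one_pos)
  obtain ⟨mu, ⟨h1, h2⟩, h3⟩ := ((this.and h1).and self_mem_nhdsWithin).exists
  exact ⟨mu, h3, h2, fun a ha b hb => h1 a ha b (mem_compl.2 hb)⟩

/-- The `N` first goods for a linear preorder given by `f`. -/
def topSet {κ : Type*} [LinearOrder κ] (f : α → κ) (N : ℕ) : Finset α :=
  {a | rank f univ a < N}

theorem card_topSet {κ : Type*} [LinearOrder κ] (f : α → κ) {N : ℕ} (hN : N ≤ Fintype.card α) :
    #(topSet f N) = N :=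
  (exists_top (f := f) (S := univ) (by simpa using hN)).1

theorem le_of_mem_topSet {κ : Type*} [LinearOrder κ] {f : α → κ} {N : ℕ}
    (hN : N ≤ Fintype.card α) {a b : α} (ha : a ∈ topSet f N) (hb : b ∉ topSet f N) :
    f b ≤ f a :=
  (exists_top (f := f) (S := univ) (by simpa using hN)).2 a (mem_univ _) b (mem_univ _)
    (by simpa [topSet] using ha) (by simpa [topSet] using hb)

/-- The `N` goods for the first group that maximize the weighted value, ties being broken by `g`. -/
noncomputable def tieBreak (u₁ u₂ : α → ℝ) (lam : ℝ) (g : α → ℝ) (N : ℕ) : Finset α :=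
  topSet (fun a => toLex (u₁ a - lam * u₂ a, g a)) N

theorem tieBreak_spec {u₁ u₂ g : α → ℝ} {lam : ℝ} {N : ℕ} (hN : N ≤ Fintype.card α) :
    ∀ a ∈ tieBreak u₁ u₂ lam g N, ∀ b ∉ tieBreak u₁ u₂ lam g N,
      u₁ b - lam * u₂ b < u₁ a - lam * u₂ a ∨
        (u₁ b - lam * u₂ b = u₁ a - lam * u₂ a ∧ g b ≤ g a) := fun a ha b hb => by
  simpa [Prod.Lex.toLex_le_toLex] using le_of_mem_topSet hN ha hb

/-- Some set between the two extreme optimal sets of a critical multiplier leaves neither group with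
envy. The multiplier is the largest critical one for which the first group does not envy if ties are
broken in its favour. If no set on the way were suitable, the first group would not envy at its end
either but the second one would; this last set is optimal for slightly larger multipliers too, hence
for a larger critical one. -/
theorem exists_noGroupEnvy {u₁ u₂ : α → ℝ} (hu₁ : ∀ a, 0 ≤ u₁ a) (hu₂ : ∀ a, 0 ≤ u₂ a)
    {k n₁ n₂ : ℕ} (h₁ : 0 < n₁) (h₂ : 0 < n₂ ∨ u₂ = 0) (hα : Fintype.card α = (n₁ + n₂) * k) :
    ∃ lam, IsCritical u₁ u₂ lam ∧ ∃ d,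
      d ≤ #(tieBreak u₁ u₂ lam u₁ (n₁ * k) \ tieBreak u₁ u₂ lam (-u₁) (n₁ * k)) ∧
      let S := walk (tieBreak u₁ u₂ lam u₁ (n₁ * k)) (tieBreak u₁ u₂ lam (-u₁) (n₁ * k)) d
      NoGroupEnvy u₁ k n₁ S n₂ Sᶜ ∧ NoGroupEnvy u₂ k n₂ Sᶜ n₁ S := by
  by_contra! hno
  have hN : n₁ * k ≤ Fintype.card α := by rw [hα, add_mul]; omega
  have hcompl : ∀ X : Finset α, #X = n₁ * k → #Xᶜ = n₂ * k := fun X hX =>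
    card_compl_of_card hX hα
  have opt : ∀ lam g, IsWeightOptimal u₁ u₂ lam (tieBreak u₁ u₂ lam g (n₁ * k)) :=
    fun lam g a ha b hb => by
      rcases tieBreak_spec hN a ha b hb with h | h
      · exact h.le
      · exact h.1.le
  have card : ∀ lam g, #(tieBreak u₁ u₂ lam g (n₁ * k)) = n₁ * k := fun _ _ => card_topSet _ hN
  -- if the first group does not envy and the second one does, go up to a critical multiplier
  have up : ∀ lam, 0 < lam → ∀ S : Finset α, #S = n₁ * k → IsWeightOptimal u₁ u₂ lam S →
      NoGroupEnvy u₁ k n₁ S n₂ Sᶜ → ¬ NoGroupEnvy u₂ k n₂ Sᶜ n₁ S →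
      ∃ mu ≥ lam, IsCritical u₁ u₂ mu ∧
        NoGroupEnvy u₁ k n₁ (tieBreak u₁ u₂ mu u₁ (n₁ * k)) n₂
          (tieBreak u₁ u₂ mu u₁ (n₁ * k))ᶜ := by
    intro lam hlam S hS hopt hP hP2
    rcases hopt.exists_critical hlam with ⟨mu, hmu, hc, ho⟩ | ⟨-, hall⟩
    · exact ⟨mu, hmu, hc, hP.of_tie_breaking h₁ hu₁ hS (card _ _) hα ho (tieBreak_spec hN)⟩
    · refine absurd ?_ hP2
      rcases h₂ with h₂ | h₂
      · exact .of_forall_le hu₂ h₂ (hcompl S hS) hS fun a ha b hb =>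
          hall b hb a (mem_compl.1 ha)
      · simp [NoGroupEnvy, orderStat, h₂]
  -- hence above every critical multiplier without envy of the first group there is another one
  have next : ∀ lam, IsCritical u₁ u₂ lam →
      NoGroupEnvy u₁ k n₁ (tieBreak u₁ u₂ lam u₁ (n₁ * k)) n₂
        (tieBreak u₁ u₂ lam u₁ (n₁ * k))ᶜ →
      ∃ mu > lam, IsCritical u₁ u₂ mu ∧
        NoGroupEnvy u₁ k n₁ (tieBreak u₁ u₂ mu u₁ (n₁ * k)) n₂
          (tieBreak u₁ u₂ mu u₁ (n₁ * k))ᶜ := by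
    intro lam hc hP
    rcases exists_walk_or hc.pos h₁ (card lam u₁) (card lam (-u₁)) hα (opt _ _) (opt _ _) hP with
      ⟨d, hd, h1, h2⟩ | ⟨h1, h2⟩
    · exact (hno lam hc d hd ⟨h1, h2⟩).elim
    · obtain ⟨mu, hmu, ho⟩ := exists_gt_isWeightOptimal hc.pos
        (B := tieBreak u₁ u₂ lam (-u₁) (n₁ * k))
        fun a ha b hb => by simpa using tieBreak_spec hN a ha b hb
      obtain ⟨nu, hnu, r⟩ := up mu (hc.pos.trans hmu) _ (card _ _) ho h1 h2
      exact ⟨nu, hmu.trans_le hnu, r⟩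
  -- the goods most valuable to the first group are optimal for small multipliers
  have hstart : ∃ lam, IsCritical u₁ u₂ lam ∧
      NoGroupEnvy u₁ k n₁ (tieBreak u₁ u₂ lam u₁ (n₁ * k)) n₂
        (tieBreak u₁ u₂ lam u₁ (n₁ * k))ᶜ := by
    set B := topSet (fun a => toLex (u₁ a, -u₂ a)) (n₁ * k) with hBdef
    have hB : ∀ a ∈ B, ∀ b ∉ B, u₁ b < u₁ a ∨ (u₁ b = u₁ a ∧ u₂ a ≤ u₂ b) := fun a ha b hb => by
      simpa [Prod.Lex.toLex_le_toLex] using le_of_mem_topSet hN ha hb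
    have hcard : #B = n₁ * k := card_topSet _ hN
    obtain ⟨mu, h0, hle, ho⟩ := exists_small_isWeightOptimal hB
    have hP : NoGroupEnvy u₁ k n₁ B n₂ Bᶜ :=
      .of_forall_le hu₁ h₁ hcard (hcompl B hcard) fun a ha b hb => by
        rcases hB a ha b (mem_compl.1 hb) with h | h
        · exact h.le
        · exact h.1.le
    rcases ho.exists_critical h0 with ⟨nu, -, hc, ho'⟩ | ⟨hall, -⟩
    · exact ⟨nu, hc, hP.of_tie_breaking h₁ hu₁ hcard (card _ _) hα ho' (tieBreak_spec hN)⟩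
    · exact ⟨1, .inl rfl, hP.of_tie_breaking h₁ hu₁ hcard (card _ _) hα (hall 1 hle)
        (tieBreak_spec hN)⟩
  obtain ⟨lam, ⟨hc, hP⟩, hmax⟩ := Set.exists_max_image
    {lam | IsCritical u₁ u₂ lam ∧ NoGroupEnvy u₁ k n₁ (tieBreak u₁ u₂ lam u₁ (n₁ * k)) n₂
      (tieBreak u₁ u₂ lam u₁ (n₁ * k))ᶜ} id
    ((finite_isCritical u₁ u₂).subset fun _ h => h.1) hstart
  obtain ⟨mu, hmu, hc', hP'⟩ := next lam hc hP
  exact absurd (hmax mu ⟨hc', hP'⟩) (not_le.2 hmu)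

end Selection

/-! ### Edge colourings by Kempe chains -/

section Kempe

variable {α C : Type*}

/-- A colouring of the goods in `D` by allowed colours such that two goods that share a block
of one of the two systems of blocks have different colours. The goods are the edges of a bipartite
graph whose vertices are the blocks of both systems. -/
def IsProperOn (blk : Bool → α → ℕ) (Al : α → C → Prop) (D : Finset α) (col : α → C) : Prop :=
  (∀ j ∈ D, Al j (col j)) ∧
    ∀ s, ∀ j ∈ D, ∀ j' ∈ D, j ≠ j' → blk s j = blk s j' → col j ≠ col j'

/-- The state of the recolouring along a Kempe chain. The good `cur` has just received its
colour `c sd`; only in its block of the system `sd` may it conflict with other goods, and there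
the colour `c (!sd)` is not used otherwise. `V` contains the goods recoloured so far. The chain
never returns: by `closed`, a good of one colour of the chain that shares the relevant block with a
good of `V` of the other colour is in `V` too, and by `fresh` the good in conflict is not in `V`. -/
structure KempeState [DecidableEq α] (blk : Bool → α → ℕ) (Al : α → C → Prop) (D : Finset α)
    (c : Bool → C) (col : α → C) (cur : α) (sd : Bool) (V : Finset α) : Prop where
  cur_mem : cur ∈ V
  subset : V ⊆ D
  allowed : ∀ j ∈ D, Al j (col j)
  allowed_cur : ∀ s, Al cur (c s)
  col_cur : col cur = c sd
  conflict : ∀ s, ∀ j ∈ D, ∀ j' ∈ D, j ≠ j' → blk s j = blk s j' → col j = col j' →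
    s = sd ∧ (j = cur ∨ j' = cur)
  free : ∀ j ∈ D, j ≠ cur → blk sd j = blk sd cur → col j ≠ c (!sd)
  closed : ∀ s, ∀ j ∈ V, col j = c s → ∀ j' ∈ D, blk s j' = blk s j → col j' = c (!s) → j' ∈ V
  fresh : ∀ j ∈ V, j ≠ cur → blk sd j = blk sd cur → col j ≠ c sd

variable [DecidableEq α] {blk : Bool → α → ℕ} {Al : α → C → Prop} {D : Finset α} {c : Bool → C}
  {col : α → C} {cur : α} {sd : Bool} {V : Finset α}

theorem KempeState.isProperOn (h : KempeState blk Al D c col cur sd V)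
    (hn : ¬ ∃ f ∈ D, f ≠ cur ∧ blk sd f = blk sd cur ∧ col f = col cur) :
    IsProperOn blk Al D col := by
  refine ⟨h.allowed, fun s j hj j' hj' hne hb hc => ?_⟩
  obtain ⟨rfl, rfl | rfl⟩ := h.conflict s j hj j' hj' hne hb hc
  · exact hn ⟨j', hj', hne.symm, hb.symm, hc.symm⟩
  · exact hn ⟨j, hj, hne, hb, hc⟩

/-- The conflicting good is unique. -/
theorem KempeState.conflict_unique (h : KempeState blk Al D c col cur sd V) {f f' : α}
    (hf : f ∈ D ∧ f ≠ cur ∧ blk sd f = blk sd cur ∧ col f = col cur)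
    (hf' : f' ∈ D ∧ f' ≠ cur ∧ blk sd f' = blk sd cur ∧ col f' = col cur) : f = f' := by
  by_contra hne
  rcases (h.conflict sd f hf.1 f' hf'.1 hne (hf.2.2.1.trans hf'.2.2.1.symm)
    (hf.2.2.2.trans hf'.2.2.2.symm)).2 with e | e
  · exact hf.2.1 e
  · exact hf'.2.1 e

/-- One step of the recolouring: the good in conflict receives the other colour. It has not been
recoloured before, which bounds the length of the chain. -/
theorem KempeState.step [DecidableEq C] (h : KempeState blk Al D c col cur sd V)
    (hAl : ∀ s j j', blk s j = blk s j' → ∀ x, Al j x ↔ Al j' x) {f : α}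
    (hf : f ∈ D ∧ f ≠ cur ∧ blk sd f = blk sd cur ∧ col f = col cur) :
    f ∉ V ∧ KempeState blk Al D c (Function.update col f (c (!sd))) f (!sd) (insert f V) := by
  obtain ⟨hfD, hfc, hfb, hfcol⟩ := hf
  have hcf : col f = c sd := hfcol.trans h.col_cur
  have hfV : f ∉ V := fun hV => h.fresh f hV hfc hfb hcf
  have hne : c sd ≠ c (!sd) := fun e => h.free f hfD hfc hfb (hcf.trans e)
  have hcurD := h.subset h.cur_mem
  have hU : ∀ j, j ≠ f → Function.update col f (c (!sd)) j = col j := fun j hj =>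
    Function.update_of_ne hj _ _
  have hUf : Function.update col f (c (!sd)) f = c (!sd) := Function.update_self _ _ _
  have hAlf : ∀ s, Al f (c s) := fun s => (hAl sd f cur hfb _).2 (h.allowed_cur s)
  -- in its other block the recoloured good is the only one that had the old colour
  have hother : ∀ j ∈ D, j ≠ f → blk (!sd) j = blk (!sd) f → col j ≠ c sd := by
    intro j hj hjf hb he
    have := (h.conflict _ j hj f hfD hjf hb (he.trans hcf.symm)).1
    simp at this
  refine ⟨hfV, mem_insert_self _ _, ?_, ?_, hAlf, hUf, ?_, ?_, ?_, ?_⟩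
  · intro j hj
    rcases mem_insert.1 hj with rfl | hj
    · exact hfD
    · exact h.subset hj
  · intro j hj
    by_cases hjf : j = f
    · subst hjf; rw [hUf]; exact hAlf _
    · rw [hU j hjf]; exact h.allowed j hj
  · intro s j hj j' hj' hjj hb hc
    by_cases hjf : j = f
    · subst hjf
      refine ⟨?_, .inl rfl⟩
      rw [hUf, hU j' hjj.symm] at hc
      by_contra hs
      have hs : s = sd := by cases s <;> cases sd <;> simp_all
      subst hs
      by_cases hj'c : j' = cur
      · subst hj'c; exact hne (h.col_cur.symm.trans hc.symm)
      · exact h.free j' hj' hj'c (hb.symm.trans hfb) hc.symm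
    · by_cases hjf' : j' = f
      · subst hjf'
        refine ⟨?_, .inr rfl⟩
        rw [hUf, hU j hjf] at hc
        by_contra hs
        have hs : s = sd := by cases s <;> cases sd <;> simp_all
        subst hs
        by_cases hjc : j = cur
        · subst hjc; exact hne (h.col_cur.symm.trans hc)
        · exact h.free j hj hjc (hb.trans hfb) hc
      · rw [hU j hjf, hU j' hjf'] at hc
        obtain ⟨rfl, rfl | rfl⟩ := h.conflict s j hj j' hj' hjj hb hc
        · exact absurd (h.conflict_unique ⟨hj', hjj.symm, hb.symm, hc.symm⟩
            ⟨hfD, hfc, hfb, hfcol⟩) hjf'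
        · exact absurd (h.conflict_unique ⟨hj, hjj, hb, hc⟩ ⟨hfD, hfc, hfb, hfcol⟩) hjf
  · intro j hj hjf hb
    rw [hU j hjf, Bool.not_not]
    exact hother j hj hjf hb
  · intro s j hj hcj j' hj' hb hcj'
    by_cases hj'f : j' = f
    · exact mem_insert.2 (.inl hj'f)
    rw [hU j' hj'f] at hcj'
    refine mem_insert.2 (.inr ?_)
    by_cases hjf : j = f
    · subst hjf
      rw [hUf] at hcj
      have hs : s = !sd := by
        by_contra hs
        have hs : s = sd := by cases s <;> cases sd <;> simp_all
        subst hs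
        exact hne hcj.symm
      subst hs
      rw [Bool.not_not] at hcj'
      exact absurd hcj' (hother j' hj' hj'f hb)
    · rw [hU j hjf] at hcj
      exact h.closed s j ((mem_insert.1 hj).resolve_left hjf) hcj j' hj' hb hcj'
  · intro j hj hjf hb he
    rw [hU j hjf] at he
    refine hfV (h.closed (!sd) j ((mem_insert.1 hj).resolve_left hjf) he f hfD hb.symm ?_)
    rw [Bool.not_not]; exact hcf

/-- The start of the recolouring: a new good receives a colour that is free in one of its blocks. -/
theorem IsProperOn.kempeState [DecidableEq C] (h : IsProperOn blk Al D col) {e : α} (he : e ∉ D)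
    (hc : ∀ s, Al e (c s) ∧ ∀ j ∈ D, blk (!s) j = blk (!s) e → col j ≠ c s) (sd : Bool) :
    KempeState blk Al (insert e D) c (Function.update col e (c sd)) e sd {e} := by
  have hU : ∀ j, j ≠ e → Function.update col e (c sd) j = col j := fun j hj =>
    Function.update_of_ne hj _ _
  have hUe : Function.update col e (c sd) e = c sd := Function.update_self _ _ _
  have hD : ∀ j ∈ insert e D, j ≠ e → j ∈ D := fun j hj hje => (mem_insert.1 hj).resolve_left hje
  have hfree : ∀ j ∈ insert e D, j ≠ e → blk sd j = blk sd e → col j ≠ c (!sd) := by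
    intro j hj hje hb
    have := (hc (!sd)).2 j (hD j hj hje)
    rw [Bool.not_not] at this
    exact this hb
  refine ⟨mem_singleton_self _, by simp, ?_, fun s => (hc s).1, hUe, ?_, ?_, ?_, ?_⟩
  · intro j hj
    by_cases hje : j = e
    · subst hje; rw [hUe]; exact (hc sd).1
    · rw [hU j hje]; exact h.1 j (hD j hj hje)
  · intro s j hj j' hj' hjj hb hcc
    by_cases hje : j = e
    · subst hje
      refine ⟨?_, .inl rfl⟩
      rw [hUe, hU j' hjj.symm] at hcc
      by_contra hs
      have hs : s = !sd := by cases s <;> cases sd <;> simp_all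
      subst hs
      exact (hc sd).2 j' (hD j' hj' hjj.symm) hb.symm hcc.symm
    · by_cases hje' : j' = e
      · subst hje'
        refine ⟨?_, .inr rfl⟩
        rw [hUe, hU j hje] at hcc
        by_contra hs
        have hs : s = !sd := by cases s <;> cases sd <;> simp_all
        subst hs
        exact (hc sd).2 j (hD j hj hje) hb hcc
      · rw [hU j hje, hU j' hje'] at hcc
        exact absurd hcc (h.2 s j (hD j hj hje) j' (hD j' hj' hje') hjj hb)
  · intro j hj hje hb
    rw [hU j hje]
    exact hfree j hj hje hb
  · intro s j hj hcj j' hj' hb hcj'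
    rw [mem_singleton] at hj ⊢
    subst hj
    by_contra hje
    rw [hU j' hje] at hcj'
    have := (hc (!s)).2 j' (hD j' hj' hje)
    rw [Bool.not_not] at this
    exact this hb hcj'
  · intro j hj hje
    exact absurd (mem_singleton.1 hj) hje

theorem KempeState.exists_isProperOn [DecidableEq C]
    (hAl : ∀ s j j', blk s j = blk s j' → ∀ x, Al j x ↔ Al j' x) (N : ℕ) :
    ∀ {col : α → C} {cur : α} {sd : Bool} {V : Finset α}, #D - #V ≤ N →
      KempeState blk Al D c col cur sd V → ∃ col', IsProperOn blk Al D col' := by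
  induction N with
  | zero =>
    intro col cur sd V hN h
    refine ⟨col, h.isProperOn fun ⟨f, hf⟩ => (h.step hAl hf).1 ?_⟩
    rw [eq_of_subset_of_card_le h.subset (by omega)]
    exact hf.1
  | succ N ih =>
    intro col cur sd V hN h
    by_cases hf : ∃ f ∈ D, f ≠ cur ∧ blk sd f = blk sd cur ∧ col f = col cur
    · obtain ⟨f, hf⟩ := hf
      obtain ⟨hfV, h'⟩ := h.step hAl hf
      exact ih (by rw [card_insert_of_notMem hfV]; omega) h'
    · exact ⟨col, h.isProperOn hf⟩

/-- If no block has more goods than there are allowed colours, then some colour is free in the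
block of a good that is not yet coloured. -/
theorem exists_free_colour [Fintype α] [Fintype C] [DecidableEq C] {s : Bool} {e : α} (he : e ∉ D)
    (hcard : ∀ I : Finset C, (∀ x, x ∈ I ↔ Al e x) → #{j | blk s j = blk s e} ≤ #I)
    (col : α → C) : ∃ x, Al e x ∧ ∀ j ∈ D, blk s j = blk s e → col j ≠ x := by
  classical
  by_contra! hno
  have h1 := hcard {x | Al e x} (by simp)
  have h2 : ({x | Al e x} : Finset C) ⊆ ({j ∈ D | blk s j = blk s e} : Finset α).image col := by
    intro x hx
    obtain ⟨j, hj, hb, hcj⟩ := hno x (by simpa using hx)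
    exact mem_image.2 ⟨j, by simp [hj, hb], hcj⟩
  have h3 : ({j ∈ D | blk s j = blk s e} : Finset α) ⊂ ({j | blk s j = blk s e} : Finset α) := by
    refine ⟨fun j => by simp, fun hs => he ?_⟩
    have := hs (show e ∈ _ by simp)
    simp at this
    exact this
  have h4 := card_lt_card h3
  have h5 := (card_le_card h2).trans card_image_le
  omega

/-- König's edge colouring theorem in the form needed here. -/
theorem exists_isProperOn [Fintype α] [Fintype C] [DecidableEq C] [Nonempty C]
    (hAl : ∀ s j j', blk s j = blk s j' → ∀ x, Al j x ↔ Al j' x)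
    (hcard : ∀ s e, ∀ I : Finset C, (∀ x, x ∈ I ↔ Al e x) → #{j | blk s j = blk s e} ≤ #I)
    (D : Finset α) : ∃ col, IsProperOn blk Al D col := by
  induction D using Finset.induction_on with
  | empty => exact ⟨fun _ => Classical.arbitrary C, by simp [IsProperOn]⟩
  | insert e D he ih =>
    obtain ⟨col, hcol⟩ := ih
    choose c hc using fun s : Bool => exists_free_colour he (hcard (!s) e) col
    exact (hcol.kempeState he hc true).exists_isProperOn hAl _ le_rfl

end Kempe

/-! ### Division of the goods inside the groups -/

section Transversal

variable {α : Type*} [LinearOrder α]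

/-- A bundle `A` of goods of `S` that has exactly one good of each of the `k` blocks of `n₁` goods
into which `S` is cut when sorted by decreasing `f`. -/
structure IsTransversal (f : α → ℝ) (S : Finset α) (n₁ k : ℕ) (A : Finset α) : Prop where
  subset : A ⊆ S
  exists_block : ∀ b < k, ∃ j ∈ A, rank f S j / n₁ = b
  block_inj : ∀ j ∈ A, ∀ j' ∈ A, rank f S j / n₁ = rank f S j' / n₁ → j = j'

variable {f : α → ℝ} {S A : Finset α} {n₁ k : ℕ}

theorem IsTransversal.block_lt (h : IsTransversal f S n₁ k A) (hS : #S = n₁ * k) {j : α}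
    (hj : j ∈ A) : rank f S j / n₁ < k := by
  have := rank_lt_card (f := f) (h.subset hj)
  rw [hS] at this
  exact Nat.div_lt_of_lt_mul this

theorem IsTransversal.card_eq (h : IsTransversal f S n₁ k A) (hS : #S = n₁ * k) : #A = k := by
  rw [← card_image_of_injOn (f := fun j => rank f S j / n₁) (s := A)
    (fun j hj j' hj' e => h.block_inj j hj j' hj' e), ← card_range k]
  congr 1
  ext b
  simp only [mem_image, mem_range]
  exact ⟨fun ⟨j, hj, e⟩ => e ▸ h.block_lt hS hj, fun hb => h.exists_block b hb⟩

theorem IsTransversal.sum_le_value (h : IsTransversal f S n₁ k A) (hf : ∀ a, 0 ≤ f a)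
    (h₁ : 0 < n₁) (hS : #S = n₁ * k) :
    ∑ b ∈ Ico 1 k, orderStat f S (b * n₁ - 1) ≤ ∑ j ∈ A, f j := by
  rcases k.eq_zero_or_pos with rfl | hk
  · simpa using sum_nonneg fun j _ => hf j
  obtain ⟨j₀, -⟩ := h.exists_block 0 hk
  have hex : ∀ b, ∃ j, b ∈ Ico 1 k → j ∈ A ∧ rank f S j / n₁ = b - 1 := fun b => by
    by_cases hb : b ∈ Ico 1 k
    · obtain ⟨j, hj⟩ := h.exists_block (b - 1) (by rw [mem_Ico] at hb; omega)
      exact ⟨j, fun _ => hj⟩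
    · exact ⟨j₀, fun h => absurd h hb⟩
  choose g hg using hex
  calc ∑ b ∈ Ico 1 k, orderStat f S (b * n₁ - 1) ≤ ∑ b ∈ Ico 1 k, f (g b) := by
        refine sum_le_sum fun b hb => ?_
        obtain ⟨hA, hr⟩ := hg b hb
        rw [mem_Ico] at hb
        rw [← orderStat_rank (f := f) (h.subset hA)]
        have e1 : b * n₁ + n₁ ≤ n₁ * k := by nlinarith
        refine orderStat_antitone (by rw [hS]; omega) ?_
        have := Nat.lt_mul_of_div_lt (show rank f S (g b) / n₁ < b by omega) h₁
        rw [Nat.mul_comm] at this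
        have e2 : n₁ * b = b * n₁ := Nat.mul_comm _ _
        omega
    _ = ∑ j ∈ (Ico 1 k).image g, f j := by
        rw [sum_image]
        intro b hb b' hb' e
        have h1 := (hg b hb).2
        have h2 := (hg b' hb').2
        rw [e, h2] at h1
        rw [mem_coe, mem_Ico] at hb hb'
        omega
    _ ≤ ∑ j ∈ A, f j := sum_le_sum_of_subset_of_nonneg
        (fun j hj => by obtain ⟨b, hb, rfl⟩ := mem_image.1 hj; exact (hg b hb).1)
        fun _ _ _ => hf _

theorem IsTransversal.exists_sum_sdiff_le (h : IsTransversal f S n₁ k A) (hf : ∀ a, 0 ≤ f a)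
    (hk : 0 < k) (hS : #S = n₁ * k) :
    ∃ j ∈ A, ∑ j' ∈ A \ {j}, f j' ≤ ∑ b ∈ Ico 1 k, orderStat f S (b * n₁) := by
  obtain ⟨j, hj, hr⟩ := h.exists_block 0 hk
  refine ⟨j, hj, ?_⟩
  calc ∑ j' ∈ A \ {j}, f j' ≤ ∑ j' ∈ A \ {j}, orderStat f S (rank f S j' / n₁ * n₁) := by
        refine sum_le_sum fun j' hj' => ?_
        have hA := (mem_sdiff.1 hj').1
        rw [← orderStat_rank (f := f) (h.subset hA)]
        exact orderStat_antitone (rank_lt_card (h.subset hA)) (Nat.div_mul_le_self _ _)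
    _ = ∑ b ∈ (A \ {j}).image (fun j' => rank f S j' / n₁), orderStat f S (b * n₁) := by
        rw [sum_image]
        intro a ha b hb e
        exact h.block_inj a (mem_sdiff.1 ha).1 b (mem_sdiff.1 hb).1 e
    _ ≤ _ := by
        refine sum_le_sum_of_subset_of_nonneg (fun b hb => ?_) fun _ _ _ => orderStat_nonneg hf _ _
        obtain ⟨j', hj', rfl⟩ := mem_image.1 hb
        rw [mem_sdiff, mem_singleton] at hj'
        refine mem_Ico.2 ⟨?_, h.block_lt hS hj'.1⟩
        by_contra h0
        rw [not_le, Nat.lt_one_iff] at h0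
        exact hj'.2 (h.block_inj _ hj'.1 _ hj (h0.trans hr.symm))

/-- For bundles of two groups, or of the same group twice, absence of envy of the groups gives
EF1. -/
theorem IsTransversal.ef1 {T B : Finset α} {n₂ : ℕ} (hA : IsTransversal f S n₁ k A)
    (hB : IsTransversal f T n₂ k B) (hf : ∀ a, 0 ≤ f a) (hk : 0 < k) (h₁ : 0 < n₁)
    (hS : #S = n₁ * k) (hT : #T = n₂ * k) (h : NoGroupEnvy f k n₁ S n₂ T) :
    ∃ j ∈ B, ∑ j' ∈ B \ {j}, f j' ≤ ∑ j' ∈ A, f j' := by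
  obtain ⟨j, hj, hle⟩ := hB.exists_sum_sdiff_le hf hk hT
  exact ⟨j, hj, hle.trans (h.trans (hA.sum_le_value hf h₁ hS))⟩

theorem noGroupEnvy_self (f : α → ℝ) {n₁ k : ℕ} (h₁ : 0 < n₁) (hS : #S = n₁ * k) :
    NoGroupEnvy f k n₁ S n₁ S := by
  refine sum_le_sum fun b hb => ?_
  rw [mem_Ico] at hb
  have e1 : b * n₁ + n₁ ≤ n₁ * k := by nlinarith
  exact orderStat_antitone (by omega) (by omega)

/-- A colouring of `S` by `n₁` agents that is proper for the blocks of `n₁` goods gives every one of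
these agents a transversal. -/
theorem isTransversal_of_colouring {ι : Type*} [DecidableEq ι] {I : Finset ι} (hI : #I = n₁)
    (h₁ : 0 < n₁) (hS : #S = n₁ * k) {col : α → ι} (hcol : ∀ j ∈ S, col j ∈ I)
    (hproper : ∀ j ∈ S, ∀ j' ∈ S, j ≠ j' → rank f S j / n₁ = rank f S j' / n₁ → col j ≠ col j')
    {i : ι} (hi : i ∈ I) (hA : ∀ j, j ∈ A ↔ j ∈ S ∧ col j = i) : IsTransversal f S n₁ k A := by
  refine ⟨fun j hj => ((hA j).1 hj).1, fun b hb => ?_, fun j hj j' hj' e => ?_⟩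
  · set B : Finset α := {j ∈ S | rank f S j ∈ Ico (b * n₁) ((b + 1) * n₁)} with hBdef
    have hmem : ∀ j, j ∈ B ↔ j ∈ S ∧ rank f S j / n₁ = b := fun j => by
      rw [hBdef, mem_filter, mem_Ico, Nat.div_eq_iff h₁]
      have : (b + 1) * n₁ = b * n₁ + n₁ := by ring
      refine and_congr_right fun _ => ?_
      omega
    have hB : #B = n₁ := by
      rw [card_filter_rank, Nat.card_Ico]
      · have : (b + 1) * n₁ = b * n₁ + n₁ := by ring
        omega
      · intro r hr
        rw [mem_Ico] at hr
        rw [mem_range, hS]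
        nlinarith
    have himg : B.image col = I := by
      apply eq_of_subset_of_card_le
      · intro x hx
        obtain ⟨j, hj, rfl⟩ := mem_image.1 hx
        exact hcol j ((hmem j).1 hj).1
      · rw [card_image_of_injOn, hB, hI]
        intro j hj j' hj' e
        by_contra hne
        have h1 := (hmem j).1 hj
        have h2 := (hmem j').1 hj'
        exact hproper j h1.1 j' h2.1 hne (h1.2.trans h2.2.symm) e
    obtain ⟨j, hj, hc⟩ := mem_image.1 (himg.symm ▸ hi)
    have := (hmem j).1 hj
    exact ⟨j, (hA j).2 ⟨this.1, hc⟩, this.2⟩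
  · by_contra hne
    have h1 := (hA j).1 hj
    have h2 := (hA j').1 hj'
    exact hproper j h1.1 j' h2.1 hne e (h1.2.trans h2.2.symm)

/-- The block of a good: the goods of `S`, sorted by decreasing `f`, are cut into the blocks
`0, …, k - 1` of `n₁` goods each, the other goods into the blocks `k, k + 1, …` of `n₂` goods
each. -/
noncomputable def block [Fintype α] (f : α → ℝ) (S : Finset α) (n₁ n₂ k : ℕ) (j : α) : ℕ :=
  if j ∈ S then rank f S j / n₁ else k + rank f Sᶜ j / n₂

theorem block_lt_iff [Fintype α] (hS : #S = n₁ * k) {n₂ : ℕ} (j : α) :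
    block f S n₁ n₂ k j < k ↔ j ∈ S := by
  unfold block
  split_ifs with h
  · have := rank_lt_card (f := f) h
    rw [hS] at this
    simpa [h] using Nat.div_lt_of_lt_mul this
  · simp [h]

theorem mem_iff_of_block_eq [Fintype α] (hS : #S = n₁ * k) {n₂ : ℕ} {j j' : α}
    (h : block f S n₁ n₂ k j = block f S n₁ n₂ k j') : j ∈ S ↔ j' ∈ S := by
  rw [← block_lt_iff hS (f := f) (n₂ := n₂), h, block_lt_iff hS]

theorem card_filter_rank_div_le (f : α → ℝ) (S : Finset α) (n₁ b : ℕ) (h₁ : 0 < n₁) :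
    #{j ∈ S | rank f S j / n₁ = b} ≤ n₁ := by
  rw [← card_image_of_injOn (f := rank f S)
    ((rank_injOn f S).mono fun a ha => (mem_filter.1 ha).1)]
  calc _ ≤ #(Ico (b * n₁) ((b + 1) * n₁)) := card_le_card fun r hr => by
        obtain ⟨j, hj, rfl⟩ := mem_image.1 hr
        have := (mem_filter.1 hj).2
        rw [Nat.div_eq_iff h₁] at this
        rw [mem_Ico, show (b + 1) * n₁ = b * n₁ + n₁ by ring]
        omega
    _ = n₁ := by rw [Nat.card_Ico, show (b + 1) * n₁ = b * n₁ + n₁ by ring]; omega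

theorem card_block_le [Fintype α] (hS : #S = n₁ * k) {n₂ : ℕ} (hT : #Sᶜ = n₂ * k) (e : α) :
    #{j | block f S n₁ n₂ k j = block f S n₁ n₂ k e} ≤ if e ∈ S then n₁ else n₂ := by
  split_ifs with he
  · have h₁ : 0 < n₁ := Nat.pos_of_ne_zero fun h => by
      rw [h, zero_mul, card_eq_zero] at hS
      simp [hS] at he
    refine (card_le_card fun j hj => ?_).trans
      (card_filter_rank_div_le f S n₁ (rank f S e / n₁) h₁)
    have hb := (mem_filter.1 hj).2
    have hj := (mem_iff_of_block_eq hS hb).2 he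
    simp only [block, hj, he, if_true] at hb
    exact mem_filter.2 ⟨hj, hb⟩
  · have h₂ : 0 < n₂ := Nat.pos_of_ne_zero fun h => by
      rw [h, zero_mul, card_eq_zero] at hT
      have := mem_compl.2 he
      simp [hT] at this
    refine (card_le_card fun j hj => ?_).trans
      (card_filter_rank_div_le f Sᶜ n₂ (rank f Sᶜ e / n₂) h₂)
    have hb := (mem_filter.1 hj).2
    have hj : j ∉ S := fun h => he ((mem_iff_of_block_eq hS hb).1 h)
    simp only [block, hj, he, if_false, Nat.add_left_cancel_iff] at hb
    exact mem_filter.2 ⟨mem_compl.2 hj, hb⟩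

end Transversal

section Fairness

variable {n m : ℕ}

theorem isBalancedFractional_toMatrix {A : Fin n → Finset (Fin m)} (hA : IsBalanced A) :
    IsBalancedFractional (toMatrix A) := by
  refine ⟨fun i j => ?_, fun i => ?_, fun j => ?_⟩
  · unfold toMatrix; split_ifs <;> simp
  · simp [toMatrix, hA.2 i]
  · obtain ⟨i, hi⟩ := hA.1.2 j
    rw [sum_eq_single i]
    · simp [toMatrix, hi]
    · intro i' _ hne
      have := disjoint_left.1 (hA.1.1 i i' hne.symm) hi
      simp [toMatrix, this]
    · simp

/-- A threshold between the weights inside and outside of an optimal set, a dual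
solution. -/
theorem exists_threshold {α : Type*} [Fintype α] [DecidableEq α] (w : α → ℝ) (S : Finset α)
    (h : ∀ a ∈ S, ∀ b ∉ S, w b ≤ w a) : ∃ c, (∀ a ∈ S, c ≤ w a) ∧ ∀ b ∉ S, w b ≤ c := by
  rcases Sᶜ.eq_empty_or_nonempty with he | hne
  · rcases S.eq_empty_or_nonempty with hS | hS
    · refine ⟨0, by simp [hS], fun b hb => ?_⟩
      have := mem_compl.2 hb
      simp [he] at this
    · obtain ⟨a, ha, hmin⟩ := exists_min_image S w hS
      exact ⟨w a, hmin, fun b hb => h a ha b hb⟩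
  · obtain ⟨b, hb, hmax⟩ := exists_max_image Sᶜ w hne
    exact ⟨w b, fun a ha => h a ha b (mem_compl.1 hb), fun b' hb' => hmax b' (mem_compl.2 hb')⟩

/-- Fractional Pareto optimality by duality: the allocation maximizes the sum of the agents' values
with weight `1` for the first type and weight `lam` for the second one. -/
theorem isFPO_of_isWeightOptimal {v : Fin n → Fin m → ℝ} {u₁ u₂ : Fin m → ℝ}
    {tp : Fin n → Prop} [DecidablePred tp] (hv : ∀ i, v i = if tp i then u₁ else u₂)
    {A : Fin n → Finset (Fin m)} (hA : IsBalanced A) {S : Finset (Fin m)}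
    (hAS : ∀ i, ∀ j ∈ A i, tp i ↔ j ∈ S) {lam : ℝ} (hlam : 0 < lam)
    (hopt : IsWeightOptimal u₁ u₂ lam S) : IsFPO v A := by
  intro x hx ⟨hge, i₀, hgt⟩
  set y : (Fin n → Fin m → ℝ) → Fin m → ℝ := fun z j => ∑ i with tp i, z i j with hy
  set c : Fin n → ℝ := fun i => if tp i then 1 else lam with hc
  have hcpos : ∀ i, 0 < c i := fun i => by simp only [hc]; split_ifs <;> simp [hlam]
  have hsum : ∀ z, IsBalancedFractional z → ∑ i, c i * ∑ j, v i j * z i j =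
      ∑ j, lam * u₂ j + ∑ j, (u₁ j - lam * u₂ j) * y z j := by
    intro z hz
    rw [← sum_add_distrib]
    simp_rw [mul_sum]
    rw [sum_comm]
    refine sum_congr rfl fun j _ => ?_
    calc ∑ i, c i * (v i j * z i j)
        = ∑ i, (lam * u₂ j * z i j + (u₁ j - lam * u₂ j) * if tp i then z i j else 0) := by
          refine sum_congr rfl fun i _ => ?_
          simp only [hc, hv i]
          split_ifs <;> ring
      _ = lam * u₂ j * ∑ i, z i j + (u₁ j - lam * u₂ j) * y z j := by
          rw [sum_add_distrib, ← mul_sum, ← mul_sum, ← sum_filter]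
      _ = _ := by rw [hz.2.2 j, mul_one]
  have htot : ∀ z, IsBalancedFractional z → ∑ j, y z j = #{i | tp i} * ((m / n : ℕ) : ℝ) := by
    intro z hz
    simp only [hy]
    rw [sum_comm, sum_congr rfl fun i _ => hz.2.1 i, sum_const, nsmul_eq_mul]
  -- domination would increase the weighted sum of values
  have hlt : ∑ i, c i * ∑ j, v i j * toMatrix A i j < ∑ i, c i * ∑ j, v i j * x i j :=
    sum_lt_sum (fun i _ => mul_le_mul_of_nonneg_left (hge i) (hcpos i).le)
      ⟨i₀, mem_univ _, mul_lt_mul_of_pos_left hgt (hcpos i₀)⟩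
  have hAf := isBalancedFractional_toMatrix hA
  rw [hsum _ hAf, hsum _ hx] at hlt
  obtain ⟨τ, hτ1, hτ2⟩ := exists_threshold (fun j => u₁ j - lam * u₂ j) S hopt
  have hyA : ∀ j, y (toMatrix A) j = if j ∈ S then 1 else 0 := by
    intro j
    obtain ⟨i, hi⟩ := hA.1.2 j
    have hzero : ∀ i', i' ≠ i → toMatrix A i' j = 0 := fun i' hne => by
      have := disjoint_left.1 (hA.1.1 i i' hne.symm) hi
      simp [toMatrix, this]
    have hone : toMatrix A i j = 1 := by simp [toMatrix, hi]
    simp only [hy, ← hAS i j hi]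
    rw [sum_filter, sum_eq_single i (fun i' _ hne => by simp [hzero i' hne]) (by simp), hone]
  have hy01 : ∀ j, 0 ≤ y x j ∧ y x j ≤ 1 := fun j =>
    ⟨sum_nonneg fun i _ => hx.1 i j, by
      rw [← hx.2.2 j]
      exact sum_le_sum_of_subset_of_nonneg (filter_subset _ _) fun i _ _ => hx.1 i j⟩
  -- but no way to fill the shares of the first type beats filling them with `S`
  have hle : ∑ j, (u₁ j - lam * u₂ j - τ) * (y x j - y (toMatrix A) j) ≤ 0 := by
    refine sum_nonpos fun j _ => ?_
    rw [hyA]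
    split_ifs with hj
    · have := hτ1 j hj
      have := (hy01 j).2
      nlinarith
    · have := hτ2 j hj
      have := (hy01 j).1
      nlinarith
  have hexp : ∑ j, (u₁ j - lam * u₂ j - τ) * (y x j - y (toMatrix A) j) =
      ∑ j, (u₁ j - lam * u₂ j) * y x j - ∑ j, (u₁ j - lam * u₂ j) * y (toMatrix A) j -
        τ * (∑ j, y x j - ∑ j, y (toMatrix A) j) := by
    rw [mul_sub, mul_sum, mul_sum, ← sum_sub_distrib, ← sum_sub_distrib, ← sum_sub_distrib]
    exact sum_congr rfl fun j _ => by ring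
  rw [hexp, htot _ hx, htot _ hAf] at hle
  linarith

/-- The two systems of blocks, for the valuations `u₁` and `u₂` of the two types. -/
noncomputable def blocks (u₁ u₂ : Fin m → ℝ) (S : Finset (Fin m)) (n₁ n₂ k : ℕ)
    (s : Bool) : Fin m → ℕ :=
  block (if s then u₂ else u₁) S n₁ n₂ k

/-- The allocation in which every good goes to the agent that is its colour. -/
def ofColouring (col : Fin m → Fin n) (i : Fin n) : Finset (Fin m) := {j | col j = i}

/-- An optimal set of goods without envy of either group, divided by a colouring that is proper
for the blocks of both valuations, is a balanced allocation with both properties. -/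
theorem fair_of_colouring (hn : 0 < n) (hm : 0 < m) (hnm : n ∣ m) {v : Fin n → Fin m → ℝ}
    (hv0 : ∀ i j, 0 ≤ v i j) {u₁ u₂ : Fin m → ℝ} {tp : Fin n → Prop} [DecidablePred tp]
    (hv : ∀ i, v i = if tp i then u₁ else u₂) {n₁ n₂ k : ℕ} (hn₁ : n₁ = #{i | tp i})
    (hn₂ : n₂ = #{i | ¬ tp i}) (hk : k = m / n)
    {S : Finset (Fin m)} (hS : #S = n₁ * k) {lam : ℝ} (hlam : 0 < lam)
    (hopt : IsWeightOptimal u₁ u₂ lam S) (hP₁ : NoGroupEnvy u₁ k n₁ S n₂ Sᶜ)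
    (hP₂ : NoGroupEnvy u₂ k n₂ Sᶜ n₁ S) {col : Fin m → Fin n}
    (hcol : IsProperOn (blocks u₁ u₂ S n₁ n₂ k) (fun j i => j ∈ S ↔ tp i) univ col) :
    IsBalanced (ofColouring col) ∧ IsEF1 v (ofColouring col) ∧ IsFPO v (ofColouring col) := by
  have hkpos : 0 < k := hk ▸ Nat.div_pos (Nat.le_of_dvd hm hnm) hn
  have hnn : n₁ + n₂ = n := by
    rw [hn₁, hn₂]
    exact (card_filter_add_card_filter_not _).trans (by simp)
  have hT : #Sᶜ = n₂ * k := card_compl_of_card hS (by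
    rw [Fintype.card_fin, hnn, hk, Nat.mul_div_cancel' hnm])
  have hgrp : ∀ j, j ∈ S ↔ tp (col j) := fun j => hcol.1 j (mem_univ j)
  have hprop : ∀ s, ∀ j j', j ≠ j' →
      blocks u₁ u₂ S n₁ n₂ k s j = blocks u₁ u₂ S n₁ n₂ k s j' → col j ≠ col j' :=
    fun s j j' => hcol.2 s j (mem_univ j) j' (mem_univ j')
  -- every agent of the first type has a transversal of `S`, for both valuations
  have tr₁ : ∀ s : Bool, ∀ i, tp i →
      IsTransversal (if s then u₂ else u₁) S n₁ k (ofColouring col i) := by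
    intro s i hi
    refine isTransversal_of_colouring (I := {i | tp i}) hn₁.symm
      (hn₁ ▸ card_pos.2 ⟨i, by simpa using hi⟩) hS (col := col)
      (fun j hj => by simpa using (hgrp j).1 hj) (fun j hj j' hj' hne e => hprop s j j' hne ?_)
      (i := i) (by simpa using hi) fun j => ?_
    · simp only [blocks, block, hj, hj', if_true, e]
    · simp only [ofColouring, mem_filter, mem_univ, true_and, hgrp]
      exact ⟨fun e => ⟨e ▸ hi, e⟩, fun e => e.2⟩
  have tr₂ : ∀ s : Bool, ∀ i, ¬ tp i →
      IsTransversal (if s then u₂ else u₁) Sᶜ n₂ k (ofColouring col i) := by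
    intro s i hi
    refine isTransversal_of_colouring (I := {i | ¬ tp i}) hn₂.symm
      (hn₂ ▸ card_pos.2 ⟨i, by simpa using hi⟩) hT (col := col)
      (fun j hj => by simpa using fun h => mem_compl.1 hj ((hgrp j).2 h))
      (fun j hj j' hj' hne e => hprop s j j' hne ?_) (i := i) (by simpa using hi) fun j => ?_
    · rw [mem_compl] at hj hj'
      simp only [blocks, block, hj, hj', if_false, e]
    · simp only [ofColouring, mem_filter, mem_univ, true_and, hgrp, mem_compl]
      exact ⟨fun e => ⟨e ▸ hi, e⟩, fun e => e.2⟩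
  have hbal : IsBalanced (ofColouring col) := by
    refine ⟨⟨fun i i' hne => disjoint_left.2 fun j hj hj' => hne ?_, fun j => ⟨col j, ?_⟩⟩,
      fun i => ?_⟩
    · simp only [ofColouring, mem_filter, mem_univ, true_and] at hj hj'
      exact hj.symm.trans hj'
    · simp [ofColouring]
    · rw [← hk]
      by_cases hi : tp i
      · exact (tr₁ true i hi).card_eq hS
      · exact (tr₂ true i hi).card_eq hT
  refine ⟨hbal, fun i i' => .inr ?_, isFPO_of_isWeightOptimal (S := S) hv hbal ?_ hlam hopt⟩
  · have hvi := hv i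
    have h0 := hv0 i
    unfold value
    by_cases hi : tp i
    · have hpos : 0 < n₁ := hn₁ ▸ card_pos.2 ⟨i, by simpa using hi⟩
      rw [if_pos hi] at hvi
      rw [hvi] at h0 ⊢
      by_cases hi' : tp i'
      · exact (tr₁ false i hi).ef1 (tr₁ false i' hi') h0 hkpos hpos hS hS
          (noGroupEnvy_self _ hpos hS)
      · exact (tr₁ false i hi).ef1 (tr₂ false i' hi') h0 hkpos hpos hS hT hP₁
    · have hpos : 0 < n₂ := hn₂ ▸ card_pos.2 ⟨i, by simpa using hi⟩
      rw [if_neg hi] at hvi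
      rw [hvi] at h0 ⊢
      by_cases hi' : tp i'
      · exact (tr₂ true i hi).ef1 (tr₁ true i' hi') h0 hkpos hpos hT hS hP₂
      · exact (tr₂ true i hi).ef1 (tr₂ true i' hi') h0 hkpos hpos hT hT
          (noGroupEnvy_self _ hpos hT)
  · intro i j hj
    simp only [ofColouring, mem_filter, mem_univ, true_and] at hj
    rw [hgrp, hj]

theorem blocks_allowed {u₁ u₂ : Fin m → ℝ} {S : Finset (Fin m)} {n₁ n₂ k : ℕ} (hS : #S = n₁ * k)
    (tp : Fin n → Prop) (s : Bool) (j j' : Fin m)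
    (h : blocks u₁ u₂ S n₁ n₂ k s j = blocks u₁ u₂ S n₁ n₂ k s j') (i : Fin n) :
    (j ∈ S ↔ tp i) ↔ (j' ∈ S ↔ tp i) := by
  rw [mem_iff_of_block_eq hS h]

theorem blocks_card_le {u₁ u₂ : Fin m → ℝ} {tp : Fin n → Prop} [DecidablePred tp] {n₁ n₂ k : ℕ}
    (hn₁ : n₁ = #{i | tp i}) (hn₂ : n₂ = #{i | ¬ tp i}) {S : Finset (Fin m)} (hS : #S = n₁ * k)
    (hT : #Sᶜ = n₂ * k) (s : Bool) (e : Fin m) (I : Finset (Fin n))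
    (hI : ∀ i, i ∈ I ↔ (e ∈ S ↔ tp i)) :
    #{j | blocks u₁ u₂ S n₁ n₂ k s j = blocks u₁ u₂ S n₁ n₂ k s e} ≤ #I := by
  refine (card_block_le hS hT e).trans (le_of_eq ?_)
  split_ifs with he
  · rw [hn₁]; congr 1; ext i; simp [hI, he]
  · rw [hn₂]; congr 1; ext i; simp [hI, he]

theorem AtMostTwoTypes.eq_of_ne {R : Type*} {v : Fin n → Fin m → R} (h : AtMostTwoTypes v)
    {i₀ i₁ i : Fin n} (h₁ : v i₁ ≠ v i₀) (h₂ : v i ≠ v i₀) : v i = v i₁ := by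
  obtain ⟨u₁, u₂, h⟩ := h
  rcases h i₀ with a | a <;> rcases h i₁ with b | b <;> rcases h i with c | c <;> simp_all

open Classical in
/-- The valuation of the second type: that of some agent who disagrees with agent `i₀`, and zero if
there is none. -/
noncomputable def secondValuation (v : Fin n → Fin m → ℝ) (i₀ : Fin n) : Fin m → ℝ :=
  if h : ∃ i, v i ≠ v i₀ then v h.choose else 0

theorem secondValuation_eq {v : Fin n → Fin m → ℝ} (h : AtMostTwoTypes v) {i₀ i : Fin n}
    (hi : v i ≠ v i₀) : secondValuation v i₀ = v i := by
  have hex : ∃ i, v i ≠ v i₀ := ⟨i, hi⟩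
  rw [secondValuation, dif_pos hex]
  exact h.eq_of_ne hi hex.choose_spec

theorem secondValuation_eq_zero {v : Fin n → Fin m → ℝ} {i₀ : Fin n}
    (h : ∀ i, v i = v i₀) : secondValuation v i₀ = 0 := by
  rw [secondValuation, dif_neg (by simpa using h)]

theorem secondValuation_nonneg {v : Fin n → Fin m → ℝ} (hv : ∀ i j, 0 ≤ v i j) (i₀ : Fin n)
    (j : Fin m) : 0 ≤ secondValuation v i₀ j := by
  unfold secondValuation
  split_ifs with h
  · exact hv _ _
  · exact le_rfl

open Classical in
/-- The data on which the division of the goods is based: the numbers of agents of both types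
and the candidate sets of goods for the first type. -/
theorem twoTypes_data (hnm : n ∣ m) {v : Fin n → Fin m → ℝ}
    (hv0 : ∀ i j, 0 ≤ v i j) (i₀ : Fin n) {n₁ n₂ k : ℕ} (hn₁ : n₁ = #{i | v i = v i₀})
    (hn₂ : n₂ = #{i | ¬ v i = v i₀}) (hk : k = m / n) :
    0 < n₁ ∧ (n₁ + n₂) * k = m ∧ ∃ lam, IsCritical (v i₀) (secondValuation v i₀) lam ∧
      ∃ d ≤ #(tieBreak (v i₀) (secondValuation v i₀) lam (v i₀) (n₁ * k) \
          tieBreak (v i₀) (secondValuation v i₀) lam (-v i₀) (n₁ * k)),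
        let S := walk (tieBreak (v i₀) (secondValuation v i₀) lam (v i₀) (n₁ * k))
          (tieBreak (v i₀) (secondValuation v i₀) lam (-v i₀) (n₁ * k)) d
        NoGroupEnvy (v i₀) k n₁ S n₂ Sᶜ ∧ NoGroupEnvy (secondValuation v i₀) k n₂ Sᶜ n₁ S := by
  have hpos : 0 < n₁ := hn₁ ▸ card_pos.2 ⟨i₀, by simp⟩
  have hnn : (n₁ + n₂) * k = m := by
    have : n₁ + n₂ = n := by
      rw [hn₁, hn₂]
      exact (card_filter_add_card_filter_not _).trans (by simp)
    rw [this, hk, Nat.mul_div_cancel' hnm]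
  refine ⟨hpos, hnn, exists_noGroupEnvy (hv0 i₀) (secondValuation_nonneg hv0 i₀) hpos ?_
    (by rw [Fintype.card_fin, hnn])⟩
  by_cases h : ∀ i, v i = v i₀
  · exact .inr (secondValuation_eq_zero h)
  · push Not at h
    obtain ⟨i, hi⟩ := h
    exact .inl (hn₂ ▸ card_pos.2 ⟨i, by simpa using hi⟩)

theorem walk_tieBreak {α : Type*} [LinearOrder α] [Fintype α] {u₁ u₂ g g' : α → ℝ} {lam : ℝ}
    {N : ℕ} (hN : N ≤ Fintype.card α) {d : ℕ}
    (hd : d ≤ #(tieBreak u₁ u₂ lam g N \ tieBreak u₁ u₂ lam g' N)) :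
    #(walk (tieBreak u₁ u₂ lam g N) (tieBreak u₁ u₂ lam g' N) d) = N ∧
      IsWeightOptimal u₁ u₂ lam (walk (tieBreak u₁ u₂ lam g N) (tieBreak u₁ u₂ lam g' N) d) :=
  walk_spec (card_topSet _ hN) (card_topSet _ hN)
    (fun a ha b hb => (tieBreak_spec hN a ha b hb).elim le_of_lt fun h => h.1.le)
    (fun a ha b hb => (tieBreak_spec hN a ha b hb).elim le_of_lt fun h => h.1.le) hd

/-- The existence part, for real values. -/
theorem exists_balanced_ef1_fpo (hn : 0 < n) (hm : 0 < m) (hnm : n ∣ m) (v : Fin n → Fin m → ℝ)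
    (hv0 : ∀ i j, 0 ≤ v i j) (htypes : AtMostTwoTypes v) :
    ∃ A : Fin n → Finset (Fin m), IsBalanced A ∧ IsEF1 v A ∧ IsFPO v A := by
  classical
  obtain ⟨hpos, hnk, lam, hc, d, hd, hP₁, hP₂⟩ := twoTypes_data hnm hv0 ⟨0, hn⟩ rfl rfl rfl
  obtain ⟨hS, hopt⟩ := walk_tieBreak (by
    rw [Fintype.card_fin]
    exact (Nat.mul_le_mul_right _ (Nat.le_add_right _ _)).trans hnk.le) hd
  have hT := card_compl_of_card hS (by rw [Fintype.card_fin, hnk])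
  have : Nonempty (Fin n) := ⟨⟨0, hn⟩⟩
  obtain ⟨col, hcol⟩ := exists_isProperOn (C := Fin n)
    (fun s j j' h i => blocks_allowed hS (fun i => v i = v ⟨0, hn⟩) s j j' h i)
    (fun s e I hI => blocks_card_le rfl rfl hS hT s e I hI) univ
  refine ⟨_, fair_of_colouring hn hm hnm hv0 (fun i => ?_) rfl rfl rfl hS hc.pos hopt hP₁ hP₂
    hcol⟩
  split_ifs with h
  · exact h
  · exact (secondValuation_eq htypes h).symm

end Fairness

/-! ### Terms and their evaluation in polynomial time -/

section Terms

/-- Terms with bounded sums and products, the language in which the algorithm is written. The index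
of a sum or product `big` runs over `0, …, m - 1`, where `m` is the content of cell `1` of
array `0`. A variable is given by the number of sums and products that enclose its binder, and the
body of a sum or product is a function of that number. -/
inductive Term : Type
  | const (z : ℤ) : Term
  | var (x : ℕ) : Term
  | read (a : ℕ) (e : Term) : Term
  | add (e₁ e₂ : Term) : Term
  | sub (e₁ e₂ : Term) : Term
  | mul (e₁ e₂ : Term) : Term
  | div (e₁ e₂ : Term) : Term
  | big (isProd : Bool) (body : ℕ → Term) : Term

/-- The range of the index of sums, products and loops. -/
def Mem.width (s : Mem) : ℕ := (s 0 1).toNat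

/-- The value of a term under `d` binders whose indices have the values `ρ 0, …, ρ (d - 1)`. The
arrays `4` and `5` are reserved for the evaluation of terms and are read as zero; so are variables
that are not bound. -/
def Term.eval (s : Mem) : Term → (ℕ → ℤ) → ℕ → ℤ
  | .const z, _, _ => z
  | .var x, ρ, d => if x < d then ρ x else 0
  | .read a e, ρ, d => if a = 4 ∨ a = 5 then 0 else s a (e.eval s ρ d).toNat
  | .add e₁ e₂, ρ, d => e₁.eval s ρ d + e₂.eval s ρ d
  | .sub e₁ e₂, ρ, d => e₁.eval s ρ d - e₂.eval s ρ d
  | .mul e₁ e₂, ρ, d => e₁.eval s ρ d * e₂.eval s ρ d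
  | .div e₁ e₂, ρ, d => e₁.eval s ρ d / e₂.eval s ρ d
  | .big false body, ρ, d =>
      ∑ x ∈ range s.width, (body d).eval s (Function.update ρ d x) (d + 1)
  | .big true body, ρ, d =>
      ∏ x ∈ range s.width, (body d).eval s (Function.update ρ d x) (d + 1)

/-- Cell `t` of the array of intermediate results. -/
def tmp (t : ℕ) : Expr := .read 4 (.const t)

/-- Sequential composition of a term's program at position `t`, of that of another one at position
`t + 1`, and of an operation that combines the results. -/
def Program.binary (op : Expr → Expr → Expr) (c₁ c₂ : Program) (t : ℕ) : Program :=
  .seq c₁ (.seq c₂ (.write 4 (.const t) (op (tmp t) (tmp (t + 1)))))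

/-- The program that evaluates a term under `d` binders and leaves the value in cell `t` of
array `4`. It uses only the cells from `t` on of array `4`, and the cells from `d` on of array `5`,
which hold the indices of the sums and products. -/
def Term.compile : Term → ℕ → ℕ → Program
  | .const z, t, _ => .write 4 (.const t) (.const z)
  | .var x, t, d => .write 4 (.const t) (if x < d then .read 5 (.const x) else .const 0)
  | .read a e, t, d => .seq (e.compile t d)
      (.write 4 (.const t) (if a = 4 ∨ a = 5 then .const 0 else .read a (tmp t)))
  | .add e₁ e₂, t, d => .binary .add (e₁.compile t d) (e₂.compile (t + 1) d) t
  | .sub e₁ e₂, t, d => .binary .sub (e₁.compile t d) (e₂.compile (t + 1) d) t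
  | .mul e₁ e₂, t, d => .binary .mul (e₁.compile t d) (e₂.compile (t + 1) d) t
  | .div e₁ e₂, t, d => .binary .div (e₁.compile t d) (e₂.compile (t + 1) d) t
  | .big isProd body, t, d =>
      .seq (.write 4 (.const t) (.const (if isProd then 1 else 0)))
        (.seq (.write 5 (.const d) (.const 0))
          (.loop (.sub (.read 0 (.const 1)) (.read 5 (.const d)))
            (.seq ((body d).compile (t + 1) (d + 1))
              (.seq (.write 4 (.const t)
                  (if isProd then .mul (tmp t) (tmp (t + 1)) else .add (tmp t) (tmp (t + 1))))
                (.write 5 (.const d) (.add (.read 5 (.const d)) (.const 1)))))))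

theorem Mem.set_same (s : Mem) (a l : ℕ) (z : ℤ) : s.set a l z a l = z := by simp [Mem.set]

theorem Mem.set_array_ne (s : Mem) {a b : ℕ} (h : b ≠ a) (l : ℕ) (z : ℤ) : s.set a l z b = s b := by
  simp [Mem.set, h]

theorem Mem.set_cell_ne (s : Mem) (a : ℕ) {l l' : ℕ} (h : l' ≠ l) (z : ℤ) :
    s.set a l z a l' = s a l' := by
  simp [Mem.set, h]

theorem Mem.set_apply (s : Mem) (a l : ℕ) (z : ℤ) (b l' : ℕ) :
    s.set a l z b l' = if b = a ∧ l' = l then z else s b l' := by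
  by_cases h : b = a
  · subst h
    by_cases h' : l' = l
    · subst h'; simp [Mem.set]
    · simp [Mem.set, h']
  · simp [Mem.set, h]

theorem bits_le_of_abs_le {z : ℤ} {b : ℕ} (h : |z| ≤ 2 ^ b) : bits z ≤ b + 2 := by
  have : z.natAbs < 2 ^ (b + 1) := by
    zify
    calc |z| ≤ 2 ^ b := h
      _ < 2 ^ (b + 1) := pow_lt_pow_right₀ (by norm_num) (Nat.lt_succ_self b)
  have := Nat.size_le.2 this
  unfold bits
  omega

theorem two_pow_abs (z : ℤ) : |z| ≤ 2 ^ z.natAbs := by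
  rw [← Int.natCast_natAbs]
  exact_mod_cast Nat.lt_two_pow_self.le

theorem pow_le_pow_of_le {a b : ℕ} (h : a ≤ b) : (2 : ℤ) ^ a ≤ 2 ^ b :=
  pow_le_pow_right₀ (by norm_num) h

/-- Two memories that agree on all arrays but the reserved ones. -/
def Mem.Agree (s s' : Mem) : Prop := ∀ a, a ≠ 4 → a ≠ 5 → s a = s' a

theorem Mem.Agree.width {s s' : Mem} (h : s.Agree s') : s.width = s'.width := by
  unfold Mem.width
  rw [h 0 (by norm_num) (by norm_num)]

theorem Mem.Agree.trans {s s' s'' : Mem} (h : s.Agree s') (h' : s'.Agree s'') : s.Agree s'' :=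
  fun a h4 h5 => (h a h4 h5).trans (h' a h4 h5)

theorem Mem.agree_set (s : Mem) {a : ℕ} (h : a = 4 ∨ a = 5) (l : ℕ) (z : ℤ) :
    s.Agree (s.set a l z) := fun b h4 h5 => by
  rw [Mem.set_array_ne]
  rintro rfl
  exact h.elim h4 h5

theorem Term.eval_congr {s s' : Mem} (hs : s.Agree s') (e : Term) :
    ∀ {ρ ρ' : ℕ → ℤ} {d : ℕ}, (∀ x < d, ρ x = ρ' x) → e.eval s ρ d = e.eval s' ρ' d := by
  induction e with
  | const z => intros; rfl
  | var x =>
    intro ρ ρ' d h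
    simp only [Term.eval]
    split_ifs with hx
    · exact h x hx
    · rfl
  | read a e ih =>
    intro ρ ρ' d h
    simp only [Term.eval, ih h]
    split_ifs with ha
    · rfl
    · rw [hs a (fun h => ha (.inl h)) (fun h => ha (.inr h))]
  | add e₁ e₂ h₁ h₂ => intro ρ ρ' d h; simp only [Term.eval, h₁ h, h₂ h]
  | sub e₁ e₂ h₁ h₂ => intro ρ ρ' d h; simp only [Term.eval, h₁ h, h₂ h]
  | mul e₁ e₂ h₁ h₂ => intro ρ ρ' d h; simp only [Term.eval, h₁ h, h₂ h]
  | div e₁ e₂ h₁ h₂ => intro ρ ρ' d h; simp only [Term.eval, h₁ h, h₂ h]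
  | big p body ih =>
    intro ρ ρ' d h
    have : ∀ y : ℕ, (body d).eval s (Function.update ρ d y) (d + 1) =
        (body d).eval s' (Function.update ρ' d y) (d + 1) := fun y => ih d fun x hx => by
      by_cases hxd : x = d
      · subst hxd; simp
      · simp [hxd, h x (by omega)]
    cases p <;> simp only [Term.eval, hs.width, this]

/-- All cells but those of the reserved arrays have at most about `L` bits, the indices have at most
`L` bits, and loops take at most `L` rounds. -/
structure Mem.Within (s : Mem) (L d : ℕ) : Prop where
  cell : ∀ a l, a ≠ 4 → a ≠ 5 → |s a l| ≤ 2 ^ L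
  index : ∀ x < d, |s 5 x| ≤ 2 ^ L
  width_le : s.width ≤ L

theorem Mem.Within.of_agree {s s' : Mem} {L d : ℕ} (h : s.Within L d) (hs : s.Agree s')
    (h5 : ∀ x < d, s' 5 x = s 5 x) : s'.Within L d where
  cell a l ha hb := by rw [← hs a ha hb]; exact h.cell a l ha hb
  index x hx := by rw [h5 x hx]; exact h.index x hx
  width_le := hs.width ▸ h.width_le

/-- The compiled program of a term runs correctly, in time polynomial in `L`, and the value has
polynomially many bits. -/
def Term.CompilesTo (e : Term) (t d : ℕ) (q : Polynomial ℕ) : Prop :=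
  ∀ (L : ℕ) (s : Mem), s.Within L d → ∃ s' T, Run (e.compile t d) s s' T ∧ T ≤ q.eval L ∧
    s' 4 t = e.eval s (s 5) d ∧ |s' 4 t| ≤ 2 ^ (q.eval L) ∧ s.Agree s' ∧
    (∀ x < t, s' 4 x = s 4 x) ∧ ∀ x < d, s' 5 x = s 5 x

theorem Term.compilesTo_binary {e₁ e₂ : Term} {t d : ℕ} {q₁ q₂ r : Polynomial ℕ}
    (h₁ : e₁.CompilesTo t d q₁) (h₂ : e₂.CompilesTo (t + 1) d q₂) {e : Term}
    {op : Expr → Expr → Expr} {f : ℤ → ℤ → ℤ}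
    (hcomp : e.compile t d = .binary op (e₁.compile t d) (e₂.compile (t + 1) d) t)
    (heval : ∀ s ρ, e.eval s ρ d = f (e₁.eval s ρ d) (e₂.eval s ρ d))
    (hop : ∀ s a b, (op a b).eval s = f (a.eval s) (b.eval s) ∧
      (op a b).cost s = a.cost s + b.cost s + bits ((op a b).eval s))
    (hf : ∀ L x y, |x| ≤ 2 ^ q₁.eval L → |y| ≤ 2 ^ q₂.eval L → |f x y| ≤ 2 ^ r.eval L) :
    ∃ q, e.CompilesTo t d q := by
  refine ⟨q₁ + q₁ + q₂ + q₂ + r + .C (bits t + bits t + bits (t + 1 : ℕ) + 20), fun L s hs => ?_⟩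
  obtain ⟨s₁, T₁, run₁, hT₁, v₁, b₁, a₁, f₁, g₁⟩ := h₁ L s hs
  obtain ⟨s₂, T₂, run₂, hT₂, v₂, b₂, a₂, f₂, g₂⟩ := h₂ L s₁ (hs.of_agree a₁ g₁)
  rw [← e₂.eval_congr a₁ (fun x hx => (g₁ x hx).symm)] at v₂
  have v₁' : s₂ 4 t = e₁.eval s (s 5) d := (f₂ t (Nat.lt_succ_self t)).trans v₁
  rw [← f₂ t (Nat.lt_succ_self t)] at b₁
  have he : (op (tmp t) (tmp (t + 1))).eval s₂ = e.eval s (s 5) d := by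
    rw [(hop _ _ _).1, heval, ← v₁', ← v₂]
    simp [tmp, Expr.eval]
  have hb : |e.eval s (s 5) d| ≤ 2 ^ r.eval L := by
    rw [heval, ← v₁', ← v₂]
    exact hf L _ _ b₁ b₂
  simp only [Polynomial.eval_add, Polynomial.eval_C]
  have run := Run.seq run₁ (Run.seq run₂ (Run.write 4 (.const t) (op (tmp t) (tmp (t + 1))) s₂))
  change Run (.binary op (e₁.compile t d) (e₂.compile (t + 1) d) t) _ _ _ at run
  rw [← hcomp] at run
  refine ⟨_, _, run, ?_, ?_, ?_,
    (a₁.trans a₂).trans (Mem.agree_set _ (.inl rfl) _ _), fun x hx => ?_, fun x hx => ?_⟩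
  · rw [(hop _ _ _).2, he]
    have c1 := bits_le_of_abs_le b₁
    have c2 := bits_le_of_abs_le b₂
    have c3 := bits_le_of_abs_le hb
    simp only [tmp, Expr.cost, Expr.eval, Int.toNat_natCast]
    omega
  · simp only [Expr.eval, Int.toNat_natCast, Mem.set_same, he]
  · simp only [Expr.eval, Int.toNat_natCast, Mem.set_same, he]
    exact hb.trans (pow_le_pow_of_le (by omega))
  · simp only [Expr.eval, Int.toNat_natCast]
    rw [Mem.set_cell_ne _ _ (by omega), f₂ x (by omega), f₁ x hx]
  · rw [Mem.set_array_ne _ (by norm_num), g₂ x hx, g₁ x hx]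

/-- A loop with an invariant that fixes the number of rounds to `M`. -/
theorem run_loop {e : Expr} {c : Program} (Inv : ℕ → Mem → Prop) {M K₁ K₂ : ℕ}
    (htest : ∀ r ≤ M, ∀ s, Inv r s → (0 < e.eval s ↔ r < M) ∧ e.cost s ≤ K₁)
    (hbody : ∀ r < M, ∀ s, Inv r s → ∃ s' T, Run c s s' T ∧ T ≤ K₂ ∧ Inv (r + 1) s')
    {s : Mem} (h : Inv 0 s) :
    ∃ s' T, Run (.loop e c) s s' T ∧ T ≤ (M + 1) * (K₁ + K₂ + 1) ∧ Inv M s' := by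
  have key : ∀ N r, r + N = M → ∀ s, Inv r s →
      ∃ s' T, Run (.loop e c) s s' T ∧ T ≤ (N + 1) * (K₁ + K₂ + 1) ∧ Inv M s' := by
    intro N
    induction N with
    | zero =>
      intro r hr s hs
      obtain ⟨h1, h2⟩ := htest r (by omega) s hs
      refine ⟨s, _, .loop_done ?_, by omega, by rwa [← hr]⟩
      rw [← not_lt, h1]
      omega
    | succ N ih =>
      intro r hr s hs
      obtain ⟨h1, h2⟩ := htest r (by omega) s hs
      obtain ⟨s₁, T₁, run₁, hT₁, hI₁⟩ := hbody r (by omega) s hs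
      obtain ⟨s₂, T₂, run₂, hT₂, hI₂⟩ := ih (r + 1) (by omega) s₁ hI₁
      refine ⟨s₂, _, .loop_step (h1.2 (by omega)) run₁ run₂, ?_, hI₂⟩
      rw [add_mul (N + 1) 1]
      omega
  exact key M 0 (by omega) s h

theorem abs_mul_le_two_pow {x y : ℤ} {a b : ℕ} (hx : |x| ≤ 2 ^ a) (hy : |y| ≤ 2 ^ b) :
    |x * y| ≤ 2 ^ (a + b) := by
  rw [abs_mul, pow_add]
  exact mul_le_mul hx hy (abs_nonneg _) (by positivity)

theorem two_pow_add_le {a b : ℕ} : (2 : ℤ) ^ a + 2 ^ b ≤ 2 ^ (a + b + 1) := by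
  have h1 := pow_le_pow_of_le (show a ≤ a + b by omega)
  have h2 := pow_le_pow_of_le (show b ≤ a + b by omega)
  rw [pow_succ]
  linarith

theorem natCast_le_two_pow {r L : ℕ} (h : r ≤ L) : |(r : ℤ)| ≤ 2 ^ L := by
  rw [Nat.abs_cast]
  exact_mod_cast h.trans Nat.lt_two_pow_self.le

/-- The value of a partial sum or product. -/
def bigVal (p : Bool) (F : ℕ → ℤ) (r : ℕ) : ℤ :=
  if p then ∏ x ∈ range r, F x else ∑ x ∈ range r, F x

theorem abs_bigVal_le (p : Bool) {F : ℕ → ℤ} {r b : ℕ} (h : ∀ x < r, |F x| ≤ 2 ^ b) :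
    |bigVal p F r| ≤ 2 ^ ((b + 1) * r) := by
  induction r with
  | zero => cases p <;> simp [bigVal]
  | succ r ih =>
    have h1 := ih fun x hx => h x (by omega)
    have h2 := h r (by omega)
    cases p
    · simp only [bigVal, Bool.false_eq_true, if_false, sum_range_succ] at h1 ⊢
      calc _ ≤ (2 : ℤ) ^ ((b + 1) * r) + 2 ^ b := (abs_add_le _ _).trans (add_le_add h1 h2)
        _ ≤ 2 ^ ((b + 1) * r + b + 1) := two_pow_add_le
        _ = _ := by ring_nf
    · simp only [bigVal, if_true, prod_range_succ] at h1 ⊢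
      exact (abs_mul_le_two_pow h1 h2).trans (pow_le_pow_of_le (by rw [mul_add]; omega))

theorem Term.compilesTo_big (p : Bool) (body : ℕ → Term) (t d : ℕ) {q : Polynomial ℕ}
    (h : (body d).CompilesTo (t + 1) (d + 1) q) : ∃ q', (Term.big p body).CompilesTo t d q' := by
  refine ⟨(.X + 1) * (.C (bits 1 + bits d) + .X + .X + .X + .C 7 + (q + q + (q + 1) * .X +
    (q + 1) * .X + .X + .X + .C (bits t + bits t + bits (t + 1 : ℕ) + bits d + bits d + bits 1 +
    30)) +
      1) + (q + 1) * .X + .C (bits t + bits d + bits 0 + bits 0 + bits 1 + 20), fun L s hs => ?_⟩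
  set F : ℕ → ℤ := fun x => (body d).eval s (Function.update (s 5) d x) (d + 1) with hF
  let Inv : ℕ → Mem → Prop := fun r s' => s.Agree s' ∧ s' 4 t = bigVal p F r ∧ s' 5 d = r ∧
    (∀ x < r, |F x| ≤ 2 ^ q.eval L) ∧ (∀ x < t, s' 4 x = s 4 x) ∧ ∀ x < d, s' 5 x = s 5 x
  have hML := hs.width_le
  have hacc : ∀ r ≤ L, (∀ x < r, |F x| ≤ 2 ^ q.eval L) →
      |bigVal p F r| ≤ 2 ^ ((q.eval L + 1) * L) := fun r hr hb =>
    (abs_bigVal_le p hb).trans (pow_le_pow_of_le (Nat.mul_le_mul_left _ hr))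
  have htest : ∀ r ≤ s.width, ∀ s', Inv r s' →
      (0 < (Expr.sub (.read 0 (.const 1)) (.read 5 (.const d))).eval s' ↔ r < s.width) ∧
      (Expr.sub (.read 0 (.const 1)) (.read 5 (.const d))).cost s' ≤
        bits 1 + bits d + L + L + L + 7 := by
    rintro r hr s' ⟨ha, hv, hd, hb, hf, hg⟩
    have e0 : s' 0 1 = s 0 1 := by rw [ha 0 (by norm_num) (by norm_num)]
    have hM : s.width = (s 0 1).toNat := rfl
    simp only [Expr.eval, Expr.cost, Int.toNat_natCast, Int.toNat_one, hd, e0]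
    constructor
    · omega
    · have c1 := hs.cell 0 1 (by norm_num) (by norm_num)
      have c2 : |(r : ℤ)| ≤ 2 ^ L := natCast_le_two_pow (hr.trans hML)
      have c3 : |s 0 1 - r| ≤ 2 ^ (L + 1) := by
        refine (abs_sub _ _).trans ?_
        rw [pow_succ]
        linarith
      have := bits_le_of_abs_le c1
      have := bits_le_of_abs_le c2
      have := bits_le_of_abs_le c3
      omega
  have hbody : ∀ r < s.width, ∀ s', Inv r s' → ∃ s'' T,
      Run (.seq ((body d).compile (t + 1) (d + 1)) (.seq (.write 4 (.const t)
          (if p then .mul (tmp t) (tmp (t + 1)) else .add (tmp t) (tmp (t + 1))))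
          (.write 5 (.const d) (.add (.read 5 (.const d)) (.const 1))))) s' s'' T ∧
        T ≤ q.eval L + q.eval L + (q.eval L + 1) * L + (q.eval L + 1) * L + L + L +
          (bits t + bits t + bits (t + 1 : ℕ) + bits d + bits d + bits 1 + 30) ∧
        Inv (r + 1) s'' := by
    rintro r hr s' ⟨ha, hv, hd, hb, hf, hg⟩
    have hw : s'.Within L (d + 1) :=
      { cell := fun a l h4 h5 => by rw [← ha a h4 h5]; exact hs.cell a l h4 h5
        index := fun x hx => by
          by_cases hxd : x = d
          · rw [hxd, hd]; exact natCast_le_two_pow (by omega)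
          · rw [hg x (by omega)]; exact hs.index x (by omega)
        width_le := ha.width ▸ hs.width_le }
    obtain ⟨s₁, T₁, run₁, hT₁, v₁, b₁, a₁, f₁, g₁⟩ := h L s' hw
    have hv1 : s₁ 4 (t + 1) = F r := by
      rw [v₁]
      refine ((body d).eval_congr ha fun x hx => ?_).symm
      by_cases hxd : x = d
      · subst hxd; simp [hd]
      · simp [hxd, hg x (by omega)]
    rw [hv1] at b₁
    have hb' : ∀ x < r + 1, |F x| ≤ 2 ^ q.eval L := fun x hx => by
      by_cases hxr : x = r
      · rw [hxr]; exact b₁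
      · exact hb x (by omega)
    have hv2 : s₁ 4 t = bigVal p F r := (f₁ t (by omega)).trans hv
    set op : Expr := if p then .mul (tmp t) (tmp (t + 1)) else .add (tmp t) (tmp (t + 1)) with hop
    have hope : op.eval s₁ = bigVal p F (r + 1) := by
      cases p
      · simp [hop, tmp, Expr.eval, bigVal, sum_range_succ] at hv2 ⊢
        rw [← hv1, ← hv2]
      · simp [hop, tmp, Expr.eval, bigVal, prod_range_succ] at hv2 ⊢
        rw [← hv1, ← hv2]
    have hopc : op.cost s₁ = bits t + bits (s₁ 4 t) + (bits (t + 1 : ℕ) + bits (s₁ 4 (t + 1))) +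
        bits (op.eval s₁) := by
      cases p <;> simp only [hop, tmp, Expr.cost, Expr.eval, if_true, Bool.false_eq_true, if_false,
        Int.toNat_natCast]
    refine ⟨_, _, .seq run₁ (.seq (.write 4 _ op _) (.write 5 _ _ _)), ?_, ?_, ?_, ?_, hb', ?_, ?_⟩
    · have e5 : s₁ 5 d = r := (g₁ d (by omega)).trans hd
      have c1 := bits_le_of_abs_le (hacc r (by omega) hb)
      have c2 := bits_le_of_abs_le (hacc (r + 1) (by omega) hb')
      have c3 := bits_le_of_abs_le b₁
      have c4 := bits_le_of_abs_le (natCast_le_two_pow (show r ≤ L by omega))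
      have c5 := bits_le_of_abs_le (natCast_le_two_pow (show r + 1 ≤ L by omega))
      rw [hopc, hope, hv1, hv2]
      simp only [Expr.cost, Expr.eval, Int.toNat_natCast]
      rw [Mem.set_array_ne _ (by norm_num), e5,
        show (r : ℤ) + 1 = ((r + 1 : ℕ) : ℤ) by push_cast; rfl]
      omega
    · exact ((ha.trans a₁).trans (Mem.agree_set _ (.inl rfl) _ _)).trans
        (Mem.agree_set _ (.inr rfl) _ _)
    · simp only [Expr.eval, Int.toNat_natCast]
      rw [Mem.set_array_ne _ (by norm_num), Mem.set_same, hope]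
    · simp only [Expr.eval, Int.toNat_natCast]
      rw [Mem.set_same, Mem.set_array_ne _ (by norm_num), g₁ d (by omega), hd]
      push_cast; rfl
    · intro x hx
      simp only [Expr.eval, Int.toNat_natCast]
      rw [Mem.set_array_ne _ (by norm_num), Mem.set_cell_ne _ _ (by omega), f₁ x (by omega),
        hf x hx]
    · intro x hx
      simp only [Expr.eval, Int.toNat_natCast]
      rw [Mem.set_cell_ne _ _ (by omega), Mem.set_array_ne _ (by norm_num), g₁ x (by omega),
        hg x hx]
  set s₀ : Mem := (s.set 4 t (if p then 1 else 0)).set 5 d 0 with hs₀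
  have hInv : Inv 0 s₀ := by
    refine ⟨(Mem.agree_set _ (.inl rfl) _ _).trans (Mem.agree_set _ (.inr rfl) _ _), ?_, ?_,
      by simp, ?_, ?_⟩
    · rw [hs₀, Mem.set_array_ne _ (by norm_num), Mem.set_same]
      cases p <;> simp [bigVal]
    · rw [hs₀, Mem.set_same]; rfl
    · intro x hx
      rw [hs₀, Mem.set_array_ne _ (by norm_num), Mem.set_cell_ne _ _ (by omega)]
    · intro x hx
      rw [hs₀, Mem.set_cell_ne _ _ (by omega), Mem.set_array_ne _ (by norm_num)]
  obtain ⟨s', T, run, hT, ha, hv, hd, hb, hf, hg⟩ := run_loop Inv htest hbody hInv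
  have run1 := Run.write 4 (.const t) (.const (if p then 1 else 0)) s
  have run2 := Run.write 5 (.const d) (.const 0) (s.set 4 t (if p then 1 else 0))
  simp only [Expr.eval, Int.toNat_natCast] at run1 run2
  refine ⟨s', _, .seq run1 (.seq run2 run), ?_, ?_, ?_, ha, hf, hg⟩
  · simp only [Polynomial.eval_add, Polynomial.eval_mul, Polynomial.eval_C, Polynomial.eval_X,
      Polynomial.eval_one, Expr.cost]
    have hc : bits (if p then 1 else 0) ≤ bits 0 + bits 1 := by split_ifs <;> omega
    have := hT.trans (Nat.mul_le_mul_right _ (Nat.add_le_add_right hML 1))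
    omega
  · rw [hv]
    cases p <;> simp [bigVal, Term.eval, hF]
  · rw [hv]
    refine (hacc _ hML hb).trans (pow_le_pow_of_le ?_)
    simp only [Polynomial.eval_add, Polynomial.eval_mul, Polynomial.eval_C, Polynomial.eval_X,
      Polynomial.eval_one]
    omega

theorem Term.exists_compilesTo (e : Term) : ∀ t d, ∃ q, e.CompilesTo t d q := by
  induction e with
  | const z =>
    intro t d
    refine ⟨.C (bits t + bits z + z.natAbs + 1), fun L s hs =>
      ⟨_, _, .write _ _ _ _, ?_, ?_, ?_, Mem.agree_set _ (.inl rfl) _ _, fun x hx => ?_,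
        fun x hx => ?_⟩⟩
    · simp only [Expr.cost, Polynomial.eval_C]; omega
    · simp only [Expr.eval, Int.toNat_natCast, Mem.set_same, Term.eval]
    · simp only [Expr.eval, Int.toNat_natCast, Mem.set_same, Polynomial.eval_C]
      exact (two_pow_abs z).trans (pow_le_pow_of_le (by omega))
    · simp only [Expr.eval, Int.toNat_natCast]
      rw [Mem.set_cell_ne _ _ (by omega)]
    · rw [Mem.set_array_ne _ (by norm_num)]
  | var x =>
    intro t d
    refine ⟨.X + .C (bits t + bits x + bits 0 + 3), fun L s hs =>
      ⟨_, _, .write _ _ _ _, ?_, ?_, ?_, Mem.agree_set _ (.inl rfl) _ _, fun x hx => ?_,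
        fun x hx => ?_⟩⟩
    · simp only [Expr.cost, Polynomial.eval_C, Polynomial.eval_add, Polynomial.eval_X]
      split_ifs with hx
      · have := bits_le_of_abs_le (hs.index x hx)
        simp only [Expr.cost, Expr.eval, Int.toNat_natCast]
        omega
      · simp only [Expr.cost]; omega
    · simp only [Expr.eval, Int.toNat_natCast, Mem.set_same, Term.eval]
      split_ifs <;> simp [Expr.eval]
    · simp only [Expr.eval, Int.toNat_natCast, Mem.set_same]
      simp only [Polynomial.eval_C, Polynomial.eval_add, Polynomial.eval_X]
      split_ifs with hx
      · simp only [Expr.eval, Int.toNat_natCast]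
        exact (hs.index x hx).trans (pow_le_pow_of_le (by omega))
      · simp only [Expr.eval, abs_zero]; positivity
    · simp only [Expr.eval, Int.toNat_natCast]
      rw [Mem.set_cell_ne _ _ (by omega)]
    · rw [Mem.set_array_ne _ (by norm_num)]
  | read a e ih =>
    intro t d
    obtain ⟨q, hq⟩ := ih t d
    refine ⟨q + q + .X + .C (bits t + bits t + bits 0 + 20), fun L s hs => ?_⟩
    obtain ⟨s₁, T₁, run₁, hT₁, v₁, b₁, a₁, f₁, g₁⟩ := hq L s hs
    have hcell : ¬(a = 4 ∨ a = 5) → ∀ l, |s₁ a l| ≤ 2 ^ L := fun ha l => by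
      rw [← a₁ a (fun h => ha (.inl h)) (fun h => ha (.inr h))]
      exact hs.cell a l (fun h => ha (.inl h)) (fun h => ha (.inr h))
    refine ⟨_, _, .seq run₁ (.write _ _ _ _), ?_, ?_, ?_,
      a₁.trans (Mem.agree_set _ (.inl rfl) _ _), fun x hx => ?_, fun x hx => ?_⟩
    · simp only [Expr.cost, Polynomial.eval_C, Polynomial.eval_add, Polynomial.eval_X]
      split_ifs with ha
      · simp only [Expr.cost]; omega
      · have := bits_le_of_abs_le (hcell ha (s₁ 4 t).toNat)
        have := bits_le_of_abs_le b₁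
        simp only [Expr.cost, Expr.eval, tmp, Int.toNat_natCast]
        omega
    · simp only [Expr.eval, Int.toNat_natCast, Mem.set_same, Term.eval]
      split_ifs with ha
      · rfl
      · rw [a₁ a (fun h => ha (.inl h)) (fun h => ha (.inr h)), ← v₁]
        simp only [Expr.eval, tmp, Int.toNat_natCast]
    · simp only [Expr.eval, Int.toNat_natCast, Mem.set_same]
      simp only [Polynomial.eval_C, Polynomial.eval_add, Polynomial.eval_X]
      split_ifs with ha
      · simp only [Expr.eval, abs_zero]; positivity
      · exact (hcell ha _).trans (pow_le_pow_of_le (by omega))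
    · simp only [Expr.eval, Int.toNat_natCast]
      rw [Mem.set_cell_ne _ _ (by omega), f₁ x hx]
    · rw [Mem.set_array_ne _ (by norm_num), g₁ x hx]
  | add e₁ e₂ h₁ h₂ =>
    intro t d
    obtain ⟨q₁, hq₁⟩ := h₁ t d
    obtain ⟨q₂, hq₂⟩ := h₂ (t + 1) d
    exact compilesTo_binary (r := q₁ + q₂ + 1) (f := (· + ·)) hq₁ hq₂ rfl (fun _ _ => rfl)
      (fun _ _ _ => ⟨rfl, rfl⟩) fun L x y hx hy => by
        simp only [Polynomial.eval_add, Polynomial.eval_one]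
        exact (abs_add_le _ _).trans ((add_le_add hx hy).trans two_pow_add_le)
  | sub e₁ e₂ h₁ h₂ =>
    intro t d
    obtain ⟨q₁, hq₁⟩ := h₁ t d
    obtain ⟨q₂, hq₂⟩ := h₂ (t + 1) d
    exact compilesTo_binary (r := q₁ + q₂ + 1) (f := (· - ·)) hq₁ hq₂ rfl (fun _ _ => rfl)
      (fun _ _ _ => ⟨rfl, rfl⟩) fun L x y hx hy => by
        simp only [Polynomial.eval_add, Polynomial.eval_one]
        exact (abs_sub _ _).trans ((add_le_add hx hy).trans two_pow_add_le)
  | mul e₁ e₂ h₁ h₂ =>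
    intro t d
    obtain ⟨q₁, hq₁⟩ := h₁ t d
    obtain ⟨q₂, hq₂⟩ := h₂ (t + 1) d
    exact compilesTo_binary (r := q₁ + q₂) (f := (· * ·)) hq₁ hq₂ rfl (fun _ _ => rfl)
      (fun _ _ _ => ⟨rfl, rfl⟩) fun L x y hx hy => by
        simp only [Polynomial.eval_add]
        exact abs_mul_le_two_pow hx hy
  | div e₁ e₂ h₁ h₂ =>
    intro t d
    obtain ⟨q₁, hq₁⟩ := h₁ t d
    obtain ⟨q₂, hq₂⟩ := h₂ (t + 1) d
    exact compilesTo_binary (r := q₁) (f := (· / ·)) hq₁ hq₂ rfl (fun _ _ => rfl)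
      (fun _ _ _ => ⟨rfl, rfl⟩) fun L x y hx hy => (Int.abs_ediv_le_abs _ _).trans hx
  | big p body ih =>
    intro t d
    obtain ⟨q, hq⟩ := ih d (t + 1) (d + 1)
    exact compilesTo_big p body t d hq

end Terms

/-! ### Total correctness in polynomial time -/

section Hoare

/-- Total correctness with polynomial time, for a family of instances `i` of size `sz i`: from any
memory that satisfies `P i`, the program reaches one that satisfies `Q i`, in time polynomial in
`sz i`. The assertions speak of a memory `σ` that need not agree with the actual one on the arrays
reserved for the evaluation of terms; its cells are bounded by `2 ^ sz i` throughout. -/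
def Triple {ι : Type*} (sz : ι → ℕ) (P : ι → Mem → Prop) (c : Program)
    (Q : ι → Mem → Prop) : Prop :=
  ∃ p : Polynomial ℕ, ∀ i σ s, P i σ → σ.Within (sz i) 0 → σ.Agree s →
    ∃ s' t σ', Run c s s' t ∧ t ≤ p.eval (sz i) ∧ σ'.Agree s' ∧ σ'.Within (sz i) 0 ∧ Q i σ'

variable {ι : Type*} {sz : ι → ℕ} {P Q R : ι → Mem → Prop} {c c₁ c₂ : Program}

theorem Triple.skip : Triple sz P .skip P :=
  ⟨1, fun i σ s hP hw ha => ⟨s, 1, σ, .skip s, by simp, ha, hw, hP⟩⟩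

theorem Triple.seq (h₁ : Triple sz P c₁ Q) (h₂ : Triple sz Q c₂ R) :
    Triple sz P (.seq c₁ c₂) R := by
  obtain ⟨p₁, h₁⟩ := h₁
  obtain ⟨p₂, h₂⟩ := h₂
  refine ⟨p₁ + p₂ + 1, fun i σ s hP hw ha => ?_⟩
  obtain ⟨s₁, t₁, σ₁, run₁, ht₁, ha₁, hw₁, hQ⟩ := h₁ i σ s hP hw ha
  obtain ⟨s₂, t₂, σ₂, run₂, ht₂, ha₂, hw₂, hR⟩ := h₂ i σ₁ s₁ hQ hw₁ ha₁
  refine ⟨s₂, _, σ₂, .seq run₁ run₂, ?_, ha₂, hw₂, hR⟩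
  simp only [Polynomial.eval_add, Polynomial.eval_one]
  omega

theorem Triple.conseq {P' Q' : ι → Mem → Prop} (h : Triple sz P c Q)
    (hP : ∀ i σ, P' i σ → P i σ) (hQ : ∀ i σ, Q i σ → Q' i σ) : Triple sz P' c Q' := by
  obtain ⟨p, h⟩ := h
  refine ⟨p, fun i σ s hP' hw ha => ?_⟩
  obtain ⟨s', t, σ', r1, r2, r3, r4, r5⟩ := h i σ s (hP i σ hP') hw ha
  exact ⟨s', t, σ', r1, r2, r3, r4, hQ _ _ r5⟩

/-- Facts about the instance alone are preserved. -/
theorem Triple.pure (φ : ι → Prop) (h : Triple sz P c Q) :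
    Triple sz (fun i σ => φ i ∧ P i σ) c (fun i σ => φ i ∧ Q i σ) := by
  obtain ⟨p, h⟩ := h
  refine ⟨p, fun i σ s hP hw ha => ?_⟩
  obtain ⟨s', t, σ', r1, r2, r3, r4, r5⟩ := h i σ s hP.2 hw ha
  exact ⟨s', t, σ', r1, r2, r3, r4, hP.1, r5⟩

/-- The value of a term outside all binders. -/
def Term.ev (e : Term) (s : Mem) : ℤ := e.eval s (fun _ => 0) 0

theorem Term.exists_run (e : Term) (t : ℕ) : ∃ q : Polynomial ℕ, ∀ (L : ℕ) (σ s : Mem),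
    σ.Within L 0 → σ.Agree s → ∃ s' T, Run (e.compile t 0) s s' T ∧ T ≤ q.eval L ∧
      s' 4 t = e.ev σ ∧ |s' 4 t| ≤ 2 ^ (q.eval L) ∧ σ.Agree s' ∧ ∀ x < t, s' 4 x = s 4 x := by
  obtain ⟨q, hq⟩ := e.exists_compilesTo t 0
  refine ⟨q, fun L σ s hw ha => ?_⟩
  obtain ⟨s', T, r1, r2, r3, r4, r5, r6, -⟩ := hq L s (hw.of_agree ha (by simp))
  refine ⟨s', T, r1, r2, ?_, r4, ha.trans r5, r6⟩
  rw [r3]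
  exact (e.eval_congr ha (by simp)).symm

/-- The assignment `a[i] := e` for terms `i` and `e`. -/
def Program.assign (a : ℕ) (i e : Term) : Program :=
  .seq (i.compile 0 0) (.seq (e.compile 1 0) (.write a (tmp 0) (tmp 1)))

/-- The weakest precondition of an assignment. Array `0` may not be written, as loops depend on
it. -/
theorem Triple.assign (sz : ι → ℕ) (Q : ι → Mem → Prop) {a : ℕ} (ix e : Term)
    (ha : a ≠ 0 ∧ a ≠ 4 ∧ a ≠ 5) :
    Triple sz (fun i σ => |e.ev σ| ≤ 2 ^ sz i ∧ Q i (σ.set a (ix.ev σ).toNat (e.ev σ)))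
      (.assign a ix e) Q := by
  obtain ⟨q₁, h₁⟩ := ix.exists_run 0
  obtain ⟨q₂, h₂⟩ := e.exists_run 1
  refine ⟨q₁ + q₁ + q₂ + q₂ + .C (bits 0 + bits 1 + 10), fun i σ s hP hw hag => ?_⟩
  obtain ⟨s₁, T₁, run₁, hT₁, v₁, b₁, a₁, -⟩ := h₁ (sz i) σ s hw hag
  obtain ⟨s₂, T₂, run₂, hT₂, v₂, b₂, a₂, f₂⟩ := h₂ (sz i) σ s₁ hw a₁
  obtain ⟨hb, hQ⟩ := hP
  have v₁' := (f₂ 0 one_pos).trans v₁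
  have hrun : Run (.write a (tmp 0) (tmp 1)) s₂ (s₂.set a (ix.ev σ).toNat (e.ev σ))
      ((tmp 0).cost s₂ + (tmp 1).cost s₂ + 1) := by
    have := Run.write a (tmp 0) (tmp 1) s₂
    simp only [tmp, Expr.eval, Int.toNat_natCast, v₁', v₂] at this ⊢
    exact this
  refine ⟨_, _, σ.set a (ix.ev σ).toNat (e.ev σ), .seq run₁ (.seq run₂ hrun), ?_, ?_, ?_, hQ⟩
  · have c1 := bits_le_of_abs_le b₁
    have c2 := bits_le_of_abs_le b₂
    rw [← f₂ 0 one_pos] at c1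
    simp only [tmp, Expr.cost, Expr.eval, Polynomial.eval_add, Polynomial.eval_C,
      Nat.cast_zero, Nat.cast_one, Int.toNat_zero, Int.toNat_one]
    omega
  · intro b h4 h5
    funext l
    rw [Mem.set_apply, Mem.set_apply, a₂ b h4 h5]
  · refine ⟨fun b l h4 h5 => ?_, by simp, ?_⟩
    · rw [Mem.set_apply]
      split_ifs
      · exact hb
      · exact hw.cell b l h4 h5
    · have : (σ.set a (ix.ev σ).toNat (e.ev σ)).width = σ.width := by
        unfold Mem.width
        rw [Mem.set_array_ne _ ha.1.symm]
      rw [this]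
      exact hw.width_le

/-- The program "if `e > 0` then `c₁` else `c₂`" for a term `e`. -/
def Program.ite (e : Term) (c₁ c₂ : Program) : Program :=
  .seq (e.compile 0 0) (.branch (tmp 0) c₁ c₂)

theorem Triple.ite {e : Term} (h₁ : Triple sz (fun i σ => P i σ ∧ 0 < e.ev σ) c₁ Q)
    (h₂ : Triple sz (fun i σ => P i σ ∧ e.ev σ ≤ 0) c₂ Q) : Triple sz P (.ite e c₁ c₂) Q := by
  obtain ⟨q, hq⟩ := e.exists_run 0
  obtain ⟨p₁, h₁⟩ := h₁
  obtain ⟨p₂, h₂⟩ := h₂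
  refine ⟨q + q + p₁ + p₂ + .C (bits 0 + 10), fun i σ s hP hw hag => ?_⟩
  obtain ⟨s₁, T₁, run₁, hT₁, v₁, b₁, a₁, -⟩ := hq (sz i) σ s hw hag
  have hv : (tmp 0).eval s₁ = e.ev σ := by
    simp only [tmp, Expr.eval, Int.toNat_natCast, v₁]
  have hc : (tmp 0).cost s₁ ≤ bits 0 + (q.eval (sz i) + 2) := by
    have c1 := bits_le_of_abs_le b₁
    simp only [tmp, Expr.cost, Expr.eval, Nat.cast_zero, Int.toNat_zero]
    omega
  rcases lt_or_ge 0 (e.ev σ) with hpos | hneg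
  · obtain ⟨s₂, T₂, σ₂, run₂, hT₂, r1, r2, r3⟩ := h₁ i σ s₁ ⟨hP, hpos⟩ hw a₁
    refine ⟨_, _, σ₂, .seq run₁ (.branch_pos (hv ▸ hpos) run₂), ?_, r1, r2, r3⟩
    simp only [Polynomial.eval_add, Polynomial.eval_C]
    omega
  · obtain ⟨s₂, T₂, σ₂, run₂, hT₂, r1, r2, r3⟩ := h₂ i σ s₁ ⟨hP, hneg⟩ hw a₁
    refine ⟨_, _, σ₂, .seq run₁ (.branch_nonpos (hv ▸ hneg) run₂), ?_, r1, r2, r3⟩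
    simp only [Polynomial.eval_add, Polynomial.eval_C]
    omega

/-- The loop "while `a[x] < m` do `c`", for the counter in cell `x` of array `6`. -/
def Program.countLoop (x : ℕ) (c : Program) : Program :=
  .loop (.sub (.read 0 (.const 1)) (.read 6 (.const x))) c

/-- A loop that counts up to the number `W i` of goods. In round `r` the body is run for the pair
`(i, r)`, so that its running time is bounded uniformly in `r`. -/
theorem Triple.countLoop {x : ℕ} {W : ι → ℕ} (Inv : ι → ℕ → Mem → Prop)
    (hW : ∀ i r σ, Inv i r σ → σ.width = W i ∧ σ 6 x = r)
    (hbody : Triple (ι := ι × ℕ) (fun p => sz p.1) (fun p σ => p.2 < W p.1 ∧ Inv p.1 p.2 σ) c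
      (fun p σ => Inv p.1 (p.2 + 1) σ)) :
    Triple sz (fun i σ => Inv i 0 σ) (.countLoop x c) (fun i σ => Inv i (W i) σ) := by
  obtain ⟨p, hp⟩ := hbody
  refine ⟨(.X + 1) * (.C (bits 1 + bits x + 10) + .X + .X + .X + p + 1), fun i σ s hI hw hag => ?_⟩
  have hWi := (hW i 0 σ hI).1
  have hWL : W i ≤ sz i := hWi ▸ hw.width_le
  let J : ℕ → Mem → Prop := fun r s => ∃ σ : Mem, σ.Agree s ∧ σ.Within (sz i) 0 ∧ Inv i r σ
  obtain ⟨s', T, run, hT, σ', ha', hw', hI'⟩ := run_loop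
    (e := .sub (.read 0 (.const 1)) (.read 6 (.const x))) (c := c) J (M := W i)
    (K₁ := bits 1 + bits x + 10 + sz i + sz i + sz i) (K₂ := p.eval (sz i))
    (by
      rintro r hr s ⟨σ, ha, hw, hI⟩
      obtain ⟨h1, h2⟩ := hW i r σ hI
      have e0 : s 0 1 = σ 0 1 := by rw [ha 0 (by norm_num) (by norm_num)]
      have e6 : s 6 x = r := by rw [← ha 6 (by norm_num) (by norm_num), h2]
      have hM : σ.width = (σ 0 1).toNat := rfl
      simp only [Expr.eval, Expr.cost, Int.toNat_natCast, Int.toNat_one, e0, e6]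
      constructor
      · omega
      · have c1 := hw.cell 0 1 (by norm_num) (by norm_num)
        have c2 : |(r : ℤ)| ≤ 2 ^ sz i := natCast_le_two_pow (hr.trans hWL)
        have c3 : |σ 0 1 - r| ≤ 2 ^ (sz i + 1) := by
          refine (abs_sub _ _).trans ?_
          rw [pow_succ]
          linarith
        have := bits_le_of_abs_le c1
        have := bits_le_of_abs_le c2
        have := bits_le_of_abs_le c3
        omega)
    (by
      rintro r hr s ⟨σ, ha, hw, hI⟩
      obtain ⟨s', T, σ', r1, r2, r3, r4, r5⟩ := hp (i, r) σ s ⟨hr, hI⟩ hw ha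
      exact ⟨s', T, r1, r2, σ', r3, r4, r5⟩)
    (s := s) ⟨σ, hag, hw, hI⟩
  refine ⟨s', T, σ', run, hT.trans ?_, ha', hw', hI'⟩
  simp only [Polynomial.eval_add, Polynomial.eval_mul, Polynomial.eval_C, Polynomial.eval_X,
    Polynomial.eval_one]
  exact Nat.mul_le_mul (by omega) (by omega)

end Hoare

section Denotation

/-- The values of the variables that are bound at some place of a term, and their number. -/
structure Env where
  /-- The value of each variable. -/
  val : ℕ → ℤ
  /-- The number of bound variables. -/
  depth : ℕ

/-- `E'` arises from `E` by binding further variables. -/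
def Env.Extends (E E' : Env) : Prop := E.depth ≤ E'.depth ∧ ∀ x < E.depth, E'.val x = E.val x

theorem Env.Extends.refl (E : Env) : E.Extends E := ⟨le_rfl, fun _ _ => rfl⟩

theorem Env.Extends.trans {E E' E'' : Env} (h : E.Extends E') (h' : E'.Extends E'') :
    E.Extends E'' :=
  ⟨h.1.trans h'.1, fun x hx => (h'.2 x (by have := h.1; omega)).trans (h.2 x hx)⟩

/-- The environment in which one more variable is bound, with value `z`. -/
def Env.bind (E : Env) (z : ℤ) : Env := ⟨Function.update E.val E.depth z, E.depth + 1⟩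

theorem Env.extends_bind (E : Env) (z : ℤ) : E.Extends (E.bind z) :=
  ⟨Nat.le_succ _, fun x hx => by simp [Env.bind, hx.ne]⟩

/-- The term `x` has the value `z` in `E` and in all extensions of `E`. -/
def Den (σ : Mem) (E : Env) (x : Term) (z : ℤ) : Prop :=
  ∀ E', E.Extends E' → x.eval σ E'.val E'.depth = z

/-- `F` maps terms whose values are indices `v < N` to terms with value `G v`. -/
def DenFun (σ : Mem) (E : Env) {N : ℕ} (F : Term → Term) (G : Fin N → ℤ) : Prop :=
  ∀ E', E.Extends E' → ∀ x (v : Fin N), Den σ E' x ((v : ℕ) : ℤ) → Den σ E' (F x) (G v)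

/-- The truth value of a proposition as an integer. -/
noncomputable def ind (P : Prop) : ℤ := by classical exact if P then 1 else 0

theorem ind_of {P : Prop} (h : P) : ind P = 1 := by simp [ind, h]

theorem ind_of_not {P : Prop} (h : ¬ P) : ind P = 0 := by simp [ind, h]

theorem ind_congr {P Q : Prop} (h : P ↔ Q) : ind P = ind Q := by rw [propext h]

theorem ind_pos_iff {P : Prop} : 0 < ind P ↔ P := by
  by_cases h : P <;> simp [ind, h]

theorem ind_nonneg (P : Prop) : 0 ≤ ind P := by
  by_cases h : P <;> simp [ind, h]

variable {σ : Mem} {E E' : Env} {x y : Term} {a b : ℤ} {p q : Prop} {N : ℕ}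

theorem Den.mono (h : Den σ E x a) (hE : E.Extends E') : Den σ E' x a :=
  fun E'' h' => h E'' (hE.trans h')

theorem DenFun.mono {F : Term → Term} {G : Fin N → ℤ} (h : DenFun σ E F G) (hE : E.Extends E') :
    DenFun σ E' F G :=
  fun E'' h' => h E'' (hE.trans h')

theorem Den.congr (h : Den σ E x a) (hab : a = b) : Den σ E x b := hab ▸ h

/-- The environment without bound variables. -/
def Env.nil : Env := ⟨fun _ => 0, 0⟩

theorem Den.ev (h : Den σ .nil x a) : x.ev σ = a := h _ (.refl _)

theorem Den.const (z : ℤ) : Den σ E (.const z) z := fun _ _ => rfl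

theorem Den.var_bind (E : Env) (z : ℤ) : Den σ (E.bind z) (.var E.depth) z := fun E' h => by
  have h1 := h.1
  have h2 := h.2 E.depth (Nat.lt_succ_self _)
  simp only [Env.bind] at h1 h2
  simp only [Term.eval, show E.depth < E'.depth by omega, if_true, h2, Function.update_self]

theorem Den.read (arr : ℕ) (harr : arr ≠ 4 ∧ arr ≠ 5) (h : Den σ E x a) :
    Den σ E (.read arr x) (σ arr a.toNat) := fun E' hE => by
  simp [Term.eval, h E' hE, harr]

theorem Den.add (h : Den σ E x a) (h' : Den σ E y b) : Den σ E (.add x y) (a + b) :=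
  fun E' hE => by simp only [Term.eval, h E' hE, h' E' hE]

theorem Den.sub (h : Den σ E x a) (h' : Den σ E y b) : Den σ E (.sub x y) (a - b) :=
  fun E' hE => by simp only [Term.eval, h E' hE, h' E' hE]

theorem Den.mul (h : Den σ E x a) (h' : Den σ E y b) : Den σ E (.mul x y) (a * b) :=
  fun E' hE => by simp only [Term.eval, h E' hE, h' E' hE]

theorem Den.div (h : Den σ E x a) (h' : Den σ E y b) : Den σ E (.div x y) (a / b) :=
  fun E' hE => by simp only [Term.eval, h E' hE, h' E' hE]

/-- The comparison `x < y`, by the identity `-(z / (z * z + 1)) = 1` for `z < 0` and `= 0` for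
`z ≥ 0`. -/
def Term.lt (x y : Term) : Term :=
  .sub (.const 0) (.div (.sub x y) (.add (.mul (.sub x y) (.sub x y)) (.const 1)))

theorem Den.lt (h : Den σ E x a) (h' : Den σ E y b) : Den σ E (x.lt y) (ind (a < b)) := by
  refine ((Den.const 0).sub ((h.sub h').div (((h.sub h').mul (h.sub h')).add (.const 1)))).congr ?_
  set z := a - b with hz
  have hpos : 0 < z * z + 1 := by nlinarith [mul_self_nonneg z]
  by_cases hab : a < b
  · rw [ind_of hab]
    have h1 : z / (z * z + 1) < 0 := Int.ediv_neg_of_neg_of_pos (by omega) hpos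
    have h2 : -1 ≤ z / (z * z + 1) := by
      rw [Int.le_ediv_iff_mul_le hpos]
      nlinarith
    omega
  · rw [ind_of_not hab, Int.ediv_eq_zero_of_lt (by omega) (by nlinarith)]
    rfl

/-- Negation of a truth value. -/
def Term.not (x : Term) : Term := .sub (.const 1) x

theorem Den.not (h : Den σ E x (ind p)) : Den σ E x.not (ind (¬ p)) :=
  ((Den.const 1).sub h).congr (by by_cases hp : p <;> simp [ind, hp])

theorem Den.and (h : Den σ E x (ind p)) (h' : Den σ E y (ind q)) :
    Den σ E (x.mul y) (ind (p ∧ q)) :=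
  (h.mul h').congr (by by_cases hp : p <;> by_cases hq : q <;> simp [ind, hp, hq])

/-- Disjunction of truth values. -/
def Term.or (x y : Term) : Term := (x.not.mul y.not).not

theorem Den.or (h : Den σ E x (ind p)) (h' : Den σ E y (ind q)) :
    Den σ E (x.or y) (ind (p ∨ q)) :=
  (h.not.and h'.not).not.congr (ind_congr (by tauto))

/-- The comparison `x ≤ y`. -/
def Term.le (x y : Term) : Term := (y.lt x).not

theorem Den.le (h : Den σ E x a) (h' : Den σ E y b) : Den σ E (x.le y) (ind (a ≤ b)) :=
  (h'.lt h).not.congr (ind_congr not_lt)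

/-- The comparison `x = y`. -/
def Term.eq (x y : Term) : Term := (x.le y).mul (y.le x)

theorem Den.eq (h : Den σ E x a) (h' : Den σ E y b) : Den σ E (x.eq y) (ind (a = b)) :=
  ((h.le h').and (h'.le h)).congr (ind_congr le_antisymm_iff.symm)

theorem Den.iff (h : Den σ E x (ind p)) (h' : Den σ E y (ind q)) :
    Den σ E (x.eq y) (ind (p ↔ q)) :=
  (h.eq h').congr (ind_congr (by by_cases hp : p <;> by_cases hq : q <;> simp [ind, hp, hq]))

/-- The sum of `F v` over the indices `v < N`; the bound `N` must not exceed the width. -/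
def Term.sum (N : Term) (F : Term → Term) : Term :=
  .big false fun v => ((Term.var v).lt N).mul (F (.var v))

theorem Den.sum {Nt : Term} {F : Term → Term} {G : Fin N → ℤ} (hN : Den σ E Nt (N : ℤ))
    (hw : N ≤ σ.width) (hF : DenFun σ E F G) : Den σ E (.sum Nt F) (∑ v, G v) := by
  intro E' hE
  have key : ∀ v : ℕ, (((Term.var E'.depth).lt Nt).mul (F (.var E'.depth))).eval σ
      (Function.update E'.val E'.depth v) (E'.depth + 1) =
      if h : v < N then G ⟨v, h⟩ else 0 := by
    intro v
    have hE2 := hE.trans (E'.extends_bind v)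
    have hlt := ((Den.var_bind (σ := σ) E' v).lt (hN.mono hE2)) _ (.refl _)
    simp only [Env.bind] at hlt
    simp only [Term.eval, hlt]
    split_ifs with h
    · have := hF _ hE2 _ ⟨v, h⟩ (Den.var_bind E' v) _ (.refl _)
      simp only [Env.bind] at this
      rw [this, ind_of (by exact_mod_cast h), one_mul]
    · rw [ind_of_not (by exact_mod_cast h), zero_mul]
  simp only [Term.sum, Term.eval] at key ⊢
  rw [sum_congr rfl fun v _ => key v, Finset.sum_fin_eq_sum_range]
  refine (sum_subset (range_mono hw) fun v _ hv => ?_).symm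
  rw [dif_neg (by simpa using hv)]

/-- The product of `F v` over all indices `v` below the width. -/
def Term.prod (F : Term → Term) : Term := .big true fun v => F (.var v)

theorem Den.prod {F : Term → Term} {G : Fin N → ℤ} (hw : σ.width = N) (hF : DenFun σ E F G) :
    Den σ E (.prod F) (∏ v, G v) := by
  intro E' hE
  simp only [Term.prod, Term.eval, hw]
  rw [Finset.prod_fin_eq_prod_range]
  refine prod_congr rfl fun v hv => ?_
  have h := mem_range.1 hv
  rw [dif_pos h]
  exact hF _ (hE.trans (E'.extends_bind v)) _ ⟨v, h⟩ (Den.var_bind E' v) _ (.refl _)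

/-- The existence of an index `v < N` with `F v`. -/
def Term.ex (N : Term) (F : Term → Term) : Term := (Term.const 0).lt (.sum N F)

theorem Den.ex {Nt : Term} {F : Term → Term} {P : Fin N → Prop} (hN : Den σ E Nt (N : ℤ))
    (hw : N ≤ σ.width) (hF : DenFun σ E F fun v => ind (P v)) :
    Den σ E (.ex Nt F) (ind (∃ v, P v)) := by
  refine ((Den.const 0).lt (Den.sum hN hw hF)).congr (ind_congr ?_)
  rw [Finset.sum_pos_iff_of_nonneg fun v _ => ind_nonneg _]
  simp [ind_pos_iff]

/-- The first index `v < N` with `F v`, and `0` if there is none. -/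
def Term.first (N : Term) (F : Term → Term) : Term :=
  .sum N fun v => v.mul ((F v).mul (Term.ex N fun w => (w.lt v).mul (F w)).not)

/-- The first index with a property, and `0` if there is none. -/
noncomputable def firstIndex (P : Fin N → Prop) : ℤ :=
  ∑ v : Fin N, (v : ℕ) * ind (P v ∧ ¬ ∃ w, w < v ∧ P w)

theorem firstIndex_spec {P : Fin N → Prop} (h : ∃ v, P v) :
    ∃ v, P v ∧ firstIndex P = ((v : ℕ) : ℤ) := by
  classical
  obtain ⟨v, hv, hmin⟩ := exists_min_image ({v | P v} : Finset (Fin N)) id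
    (by obtain ⟨v, hv⟩ := h; exact ⟨v, by simpa using hv⟩)
  simp only [mem_filter, mem_univ, true_and, id] at hv hmin
  refine ⟨v, hv, ?_⟩
  rw [firstIndex, sum_eq_single v]
  · rw [ind_of ⟨hv, fun ⟨w, hw, hPw⟩ => absurd (hmin w hPw) (not_le.2 hw)⟩, mul_one]
  · intro w _ hne
    rw [ind_of_not, mul_zero]
    rintro ⟨hw, hno⟩
    exact hno ⟨v, lt_of_le_of_ne (hmin w hw) hne.symm, hv⟩
  · simp

theorem firstIndex_eq_zero {P : Fin N → Prop} (h : ¬ ∃ v, P v) : firstIndex P = 0 :=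
  sum_eq_zero fun v _ => by rw [ind_of_not fun hv => h ⟨v, hv.1⟩, mul_zero]

theorem Den.first {Nt : Term} {F : Term → Term} {P : Fin N → Prop} (hN : Den σ E Nt (N : ℤ))
    (hw : N ≤ σ.width) (hF : DenFun σ E F fun v => ind (P v)) :
    Den σ E (.first Nt F) (firstIndex P) :=
  Den.sum hN hw fun E' hE x v hx => hx.mul ((hF E' hE x v hx).and (Den.not (Den.ex (hN.mono hE) hw
    fun E'' hE' y w hy => ((hy.lt (hx.mono hE')).congr (ind_congr (by simp))).and
      (hF E'' (hE.trans hE') y w hy))))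

end Denotation

/-! ### Terms for ranks, candidates and the test for envy -/

section SelectionTerms

/-- `F` maps terms whose values are indices to a term for the truth value of a relation. -/
def DenRel (σ : Mem) (E : Env) {N : ℕ} (F : Term → Term → Term) (R : Fin N → Fin N → Prop) : Prop :=
  ∀ E', E.Extends E' → ∀ x y (v w : Fin N), Den σ E' x ((v : ℕ) : ℤ) → Den σ E' y ((w : ℕ) : ℤ) →
    Den σ E' (F x y) (ind (R v w))

theorem DenFun.lt {σ : Mem} {E : Env} {N : ℕ} {F : Term → Term} {G : Fin N → ℤ}
    (h : DenFun σ E F G) : DenRel σ E (fun x y => (F x).lt (F y)) fun v w => G v < G w :=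
  fun E' hE x y v w hx hy => (h E' hE x v hx).lt (h E' hE y w hy)

theorem DenRel.congr {σ : Mem} {E : Env} {N : ℕ} {F : Term → Term → Term}
    {R R' : Fin N → Fin N → Prop} (h : DenRel σ E F R) (hR : ∀ v w, R v w ↔ R' v w) :
    DenRel σ E F R' :=
  fun E' hE x y v w hx hy => (h E' hE x y v w hx hy).congr (ind_congr (hR v w))

/-- The number `m` of goods. -/
def Term.goods : Term := .read 0 (.const 1)

/-- The rank of a good among the goods with property `mem`, for the order given by `lt`. -/
def Term.rank (lt : Term → Term → Term) (mem : Term → Term) (x : Term) : Term :=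
  .sum .goods fun y => (mem y).mul ((lt x y).or ((lt y x).not.mul (y.lt x)))

/-- Lexicographic comparison by `f`, ties being broken by the order `g`. -/
def Term.lexLt (f : Term → Term) (g : Term → Term → Term) (x y : Term) : Term :=
  ((f x).lt (f y)).or (((f y).lt (f x)).not.mul (g x y))

/-- Membership in the set of the first `N` goods for the order `lt`. -/
def Term.top (lt : Term → Term → Term) (N : Term) (x : Term) : Term :=
  (Term.rank lt (fun _ => .const 1) x).lt N

/-- Membership in `walk A B d`. -/
def Term.walk (A B : Term → Term) (d x : Term) : Term :=
  ((A x).mul (B x)).or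
    (((A x).mul ((B x).not.mul
      (d.le (Term.rank (fun _ _ => .const 0) (fun y => (A y).mul (B y).not) x)))).or
    ((A x).not.mul ((B x).mul
      ((Term.rank (fun _ _ => .const 0) (fun y => (B y).mul (A y).not) x).lt d))))

/-- The value of `val` at position `r` among the goods with property `mem`. -/
def Term.orderStat (val : Term → Term) (mem : Term → Term) (r : Term) : Term :=
  .sum .goods fun j =>
    ((mem j).mul ((Term.rank (fun x y => (val x).lt (val y)) mem j).eq r)).mul (val j)

/-- The test of `NoGroupEnvy`. -/
def Term.noGroupEnvy (val : Term → Term) (k n₁ : Term) (S : Term → Term) (n₂ : Term)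
    (T : Term → Term) : Term :=
  (Term.sum k fun b => ((Term.const 1).le b).mul (.orderStat val T (b.mul n₂))).le
    (Term.sum k fun b => ((Term.const 1).le b).mul
      (.orderStat val S ((b.mul n₁).sub ((Term.const 0).lt (b.mul n₁)))))

variable {σ : Mem} {E : Env} {m : ℕ}

theorem den_goods (E : Env) (hm : σ 0 1 = m) : Den σ E .goods m :=
  ((Den.const 1).read 0 (by norm_num)).congr hm

theorem width_eq (hm : σ 0 1 = m) : σ.width = m := by simp [Mem.width, hm]

theorem sum_ind_eq_card {N : ℕ} (P : Fin N → Prop) [DecidablePred P] :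
    ∑ v, ind (P v) = (#{v | P v} : ℤ) := by
  rw [card_filter]
  push_cast
  refine sum_congr rfl fun v _ => ?_
  by_cases h : P v <;> simp [ind, h]

theorem DenFun.rank {κ : Type*} [LinearOrder κ] {f : Fin m → κ} {S : Finset (Fin m)}
    {lt : Term → Term → Term} {mem : Term → Term} (hm : σ 0 1 = m)
    (hlt : DenRel σ E lt fun a b => f a < f b) (hmem : DenFun σ E mem fun j => ind (j ∈ S)) :
    DenFun σ E (Term.rank lt mem) fun a => (FairDivision.rank f S a : ℤ) := by
  intro E' hE x a hx
  refine (Den.sum (den_goods E' hm) (width_eq hm).ge fun E'' hE' y b hy =>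
    (hmem E'' (hE.trans hE') y b hy).and ((hlt E'' (hE.trans hE') x y a b (hx.mono hE') hy).or
      ((hlt E'' (hE.trans hE') y x b a hy (hx.mono hE')).not.and (hy.lt (hx.mono hE'))))).congr ?_
  rw [sum_ind_eq_card]
  change _ = ((#{b ∈ S | f a < f b ∨ (f a = f b ∧ b < a)} : ℕ) : ℤ)
  congr 2
  ext b
  simp only [mem_filter, mem_univ, true_and, Nat.cast_lt, Fin.val_fin_lt]
  refine and_congr_right fun _ => ?_
  constructor
  · rintro (h | ⟨h, h'⟩)
    · exact .inl h
    · rcases (not_lt.1 h).lt_or_eq with h | h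
      · exact .inl h
      · exact .inr ⟨h, h'⟩
  · rintro (h | ⟨h, h'⟩)
    · exact .inl h
    · exact .inr ⟨h.not_gt, h'⟩

theorem DenRel.lexLt {f g : Fin m → ℝ} {F : Term → Term} {G : Term → Term → Term}
    (hF : DenRel σ E (fun x y => (F x).lt (F y)) fun a b => f a < f b)
    (hG : DenRel σ E G fun a b => g a < g b) :
    DenRel σ E (Term.lexLt F G) fun a b => toLex (f a, g a) < toLex (f b, g b) :=
  fun E' hE x y v w hx hy => ((hF E' hE x y v w hx hy).or
    ((hF E' hE y x w v hy hx).not.and (hG E' hE x y v w hx hy))).congr (ind_congr (by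
      beta_reduce
      rw [Prod.Lex.toLex_lt_toLex]
      constructor
      · rintro (h | ⟨h, h'⟩)
        · exact .inl h
        · rcases (not_lt.1 h).lt_or_eq with h | h
          · exact .inl h
          · exact .inr ⟨h, h'⟩
      · rintro (h | ⟨h, h'⟩)
        · exact .inl h
        · exact .inr ⟨h.not_gt, h'⟩))

theorem DenFun.top {κ : Type*} [LinearOrder κ] {f : Fin m → κ} {lt : Term → Term → Term}
    {Nt : Term} {N : ℕ} (hm : σ 0 1 = m) (hlt : DenRel σ E lt fun a b => f a < f b)
    (hN : Den σ E Nt N) : DenFun σ E (Term.top lt Nt) fun j => ind (j ∈ topSet f N) := by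
  intro E' hE x a hx
  have h1 : DenFun σ E (fun _ => Term.const 1) fun j : Fin m => ind (j ∈ (univ : Finset (Fin m))) :=
    fun _ _ _ _ _ => (Den.const 1).congr (ind_of (mem_univ _)).symm
  exact ((DenFun.rank hm hlt h1 E' hE x a hx).lt (hN.mono hE)).congr
    (ind_congr (by simp [topSet]))

theorem DenFun.walk {A B : Term → Term} {S T : Finset (Fin m)} {dt : Term} {d : ℕ} (hm : σ 0 1 = m)
    (hA : DenFun σ E A fun j => ind (j ∈ S)) (hB : DenFun σ E B fun j => ind (j ∈ T))
    (hd : Den σ E dt d) : DenFun σ E (Term.walk A B dt) fun j => ind (j ∈ walk S T d) := by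
  intro E' hE x j hx
  have hsub : ∀ {A B : Term → Term} {S T : Finset (Fin m)},
      DenFun σ E A (fun j => ind (j ∈ S)) → DenFun σ E B (fun j => ind (j ∈ T)) →
      Den σ E' (Term.rank (fun _ _ => .const 0) (fun y => (A y).mul (B y).not) x)
        (FairDivision.rank (fun _ => ()) (S \ T) j : ℤ) := fun hA hB =>
    DenFun.rank (f := fun _ => ()) hm
      (fun _ _ _ _ _ _ _ _ => (Den.const 0).congr (ind_of_not (lt_irrefl _)).symm)
      (fun E'' hE' y i hy => ((hA E'' hE' y i hy).and (hB E'' hE' y i hy).not).congr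
        (ind_congr mem_sdiff.symm)) E' hE x j hx
  have h1 := hA E' hE x j hx
  have h2 := hB E' hE x j hx
  have hd' := hd.mono hE
  exact ((h1.and h2).or ((h1.and (h2.not.and (hd'.le (hsub hA hB)))).or
    (h1.not.and (h2.and ((hsub hB hA).lt hd'))))).congr (ind_congr (by simp [FairDivision.walk]))

/-- Integer terms that represent real values up to a positive common factor `D`. -/
def DenScaled (σ : Mem) (D : ℤ) (F : Term → Term) (u : Fin m → ℝ) : Prop :=
  ∃ G : Fin m → ℤ, (∀ j, (G j : ℝ) = D * u j) ∧ ∀ E, DenFun σ E F G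

theorem DenScaled.lt {D : ℤ} {F : Term → Term} {u : Fin m → ℝ} (h : DenScaled σ D F u)
    (hD : 0 < D) (E : Env) : DenRel σ E (fun x y => (F x).lt (F y)) fun a b => u a < u b := by
  obtain ⟨G, hG, hF⟩ := h
  refine (hF E).lt.congr fun a b => ?_
  have hD' : (0 : ℝ) < D := by exact_mod_cast hD
  rw [← Int.cast_lt (R := ℝ), hG, hG, mul_lt_mul_iff_right₀ hD']

theorem DenScaled.orderStat {D : ℤ} {F : Term → Term} {u : Fin m → ℝ} (h : DenScaled σ D F u)
    (hD : 0 < D) (hm : σ 0 1 = m) {mem : Term → Term} {S : Finset (Fin m)}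
    (hS : DenFun σ E mem fun j => ind (j ∈ S)) : ∃ O : ℕ → ℤ,
      (∀ r, (O r : ℝ) = D * FairDivision.orderStat u S r) ∧
      ∀ E', E.Extends E' → ∀ rt (r : ℕ), Den σ E' rt r → Den σ E' (.orderStat F mem rt) (O r) := by
  have hlt := h.lt hD
  obtain ⟨G, hG, hF⟩ := h
  refine ⟨fun r => ∑ j, ind (j ∈ S ∧ (FairDivision.rank u S j : ℤ) = r) * G j, fun r => ?_,
    fun E' hE rt r hr => Den.sum (den_goods E' hm) (width_eq hm).ge fun E'' hE' x j hx =>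
      ((hS E'' (hE.trans hE') x j hx).and ((DenFun.rank hm (hlt E'') (hS.mono (hE.trans hE'))
        E'' (.refl _) x j hx).eq (hr.mono hE'))).mul (hF E'' E'' (.refl _) x j hx)⟩
  push_cast
  rw [FairDivision.orderStat, show ({a ∈ S | FairDivision.rank u S a = r} : Finset (Fin m)) =
    ({a | a ∈ S ∧ FairDivision.rank u S a = r} : Finset (Fin m)) by ext; simp, sum_filter, mul_sum]
  refine sum_congr rfl fun j _ => ?_
  rw [hG]
  by_cases hj : j ∈ S ∧ FairDivision.rank u S j = r
  · rw [if_pos hj, ind_of (by exact_mod_cast hj)]; push_cast; ring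
  · rw [if_neg hj, ind_of_not (by exact_mod_cast hj)]; simp

theorem sum_fin_ind_one_le (k : ℕ) (O : ℕ → ℝ) :
    ∑ b : Fin k, (ind (1 ≤ ((b : ℕ) : ℤ)) : ℝ) * O b = ∑ b ∈ Ico 1 k, O b := by
  rw [Fin.sum_univ_eq_sum_range (fun b : ℕ => (ind (1 ≤ (b : ℤ)) : ℝ) * O b) k, range_eq_Ico]
  rw [← sum_subset (Ico_subset_Ico_left (Nat.zero_le 1)) fun b _ hb => ?_]
  · refine sum_congr rfl fun b hb => ?_
    rw [ind_of (by exact_mod_cast (mem_Ico.1 hb).1)]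
    simp
  · rename_i h
    rw [mem_Ico] at h hb
    rw [ind_of_not (by omega)]
    simp

theorem DenScaled.noGroupEnvy {D : ℤ} {F : Term → Term} {u : Fin m → ℝ} (h : DenScaled σ D F u)
    (hD : 0 < D) (hm : σ 0 1 = m) {kt at₁ at₂ : Term} {k n₁ n₂ : ℕ} (hkm : k ≤ m)
    (hk : Den σ E kt k) (h₁ : Den σ E at₁ n₁) (h₂ : Den σ E at₂ n₂)
    {s t : Term → Term} {S T : Finset (Fin m)} (hS : DenFun σ E s fun j => ind (j ∈ S))
    (hT : DenFun σ E t fun j => ind (j ∈ T)) :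
    Den σ E (.noGroupEnvy F kt at₁ s at₂ t) (ind (NoGroupEnvy u k n₁ S n₂ T)) := by
  obtain ⟨O, hO, hOd⟩ := h.orderStat hD hm hS
  obtain ⟨O', hO', hOd'⟩ := h.orderStat hD hm hT
  have hw : k ≤ σ.width := by rwa [width_eq hm]
  have d1 := Den.sum hk hw (G := fun b : Fin k => ind (1 ≤ ((b : ℕ) : ℤ)) * O' (b * n₂))
    (F := fun b => ((Term.const 1).le b).mul (.orderStat F t (b.mul at₂)))
    fun E' hE x b hx => ((Den.const 1).le hx).mul (hOd' E' hE _ _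
      ((hx.mul (h₂.mono hE)).congr (by push_cast; rfl)))
  have d2 := Den.sum hk hw (G := fun b : Fin k => ind (1 ≤ ((b : ℕ) : ℤ)) * O (b * n₁ - 1))
    (F := fun b => ((Term.const 1).le b).mul
      (.orderStat F s ((b.mul at₁).sub ((Term.const 0).lt (b.mul at₁)))))
    fun E' hE x b hx => ((Den.const 1).le hx).mul (hOd E' hE _ _ (by
      have hp := hx.mul (h₁.mono hE)
      refine (hp.sub ((Den.const 0).lt hp)).congr ?_
      rw [← Nat.cast_mul]
      rcases ((b : ℕ) * n₁).eq_zero_or_pos with h0 | h0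
      · rw [h0, ind_of_not (by simp)]; rfl
      · rw [ind_of (by exact_mod_cast h0)]; push_cast [Nat.cast_sub h0]; rfl))
  refine (d1.le d2).congr (ind_congr ?_)
  have hD' : (0 : ℝ) < D := by exact_mod_cast hD
  rw [← Int.cast_le (R := ℝ), NoGroupEnvy]
  push_cast
  rw [sum_fin_ind_one_le k fun b => (O' (b * n₂) : ℝ),
    sum_fin_ind_one_le k fun b => (O (b * n₁ - 1) : ℝ)]
  simp only [hO, hO', ← mul_sum]
  exact mul_le_mul_iff_right₀ hD'

end SelectionTerms

/-! ### Terms for the input and the search -/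

section InputTerms

/-- The number `n` of agents. -/
def Term.agents : Term := .read 0 (.const 0)

/-- The numerator of the value of good `j` for agent `i`. -/
def Term.num (i j : Term) : Term := .read 1 ((i.mul .goods).add j)

/-- The denominator of the value of good `j` for agent `i`. -/
def Term.den (i j : Term) : Term := .read 2 ((i.mul .goods).add j)

/-- Agent `i` does not have the valuation of agent `0`. -/
def Term.differs (i : Term) : Term :=
  .ex .goods fun j => (((Term.num i j).eq (.num (.const 0) j)).mul
    ((Term.den i j).eq (.den (.const 0) j))).not

/-- The number of agents of the first type, which is that of agent `0`. -/
def Term.firstCount : Term := .sum .agents fun i => (Term.differs i).not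

/-- The number of agents of the second type. -/
def Term.secondCount : Term := .sum .agents Term.differs

/-- The number of goods for every agent. -/
def Term.quota : Term := .div .goods .agents

/-- There are two types of agents. -/
def Term.someDiffers : Term := .ex .agents Term.differs

/-- The first agent of the second type, and agent `0` if there is none. -/
def Term.other : Term := .first .agents Term.differs

/-- A common multiple of the denominators of both valuations. -/
def Term.scale : Term := .prod fun j => (Term.den (.const 0) j).mul (.den .other j)

/-- The valuation of the first type, scaled to integers. -/
def Term.val₁ (j : Term) : Term := (Term.num (.const 0) j).mul (Term.scale.div (.den (.const 0) j))

/-- The valuation of the second type, scaled to integers; zero if there is only one type. -/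
def Term.val₂ (j : Term) : Term :=
  Term.someDiffers.mul ((Term.num .other j).mul (Term.scale.div (.den .other j)))

/-- The memory still holds the instance in the arrays `0`, `1` and `2`. -/
def HoldsInput {n m : ℕ} (v : Fin n → Fin m → ℚ) (σ : Mem) : Prop :=
  σ 0 = inputMem v 0 ∧ σ 1 = inputMem v 1 ∧ σ 2 = inputMem v 2

variable {n m : ℕ} {v : Fin n → Fin m → ℚ} {σ : Mem} {E : Env}

theorem HoldsInput.goods (h : HoldsInput v σ) : σ 0 1 = m := by
  rw [h.1]; simp [inputMem]

theorem HoldsInput.agents (h : HoldsInput v σ) (E : Env) : Den σ E .agents n :=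
  ((Den.const 0).read 0 (by norm_num)).congr (by rw [h.1]; simp [inputMem])

theorem index_lt (i : Fin n) (j : Fin m) : (i : ℕ) * m + j < n * m := by
  have h1 := i.2
  have h2 := j.2
  nlinarith

theorem divNat_index (i : Fin n) (j : Fin m) :
    Fin.divNat ⟨(i : ℕ) * m + j, index_lt i j⟩ = i := by
  ext
  have := j.2
  simp only [Fin.coe_divNat]
  rw [Nat.add_comm, Nat.add_mul_div_right _ _ (by omega), Nat.div_eq_of_lt j.2, Nat.zero_add]

theorem modNat_index (i : Fin n) (j : Fin m) :
    Fin.modNat ⟨(i : ℕ) * m + j, index_lt i j⟩ = j := by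
  ext
  simp only [Fin.coe_modNat]
  rw [Nat.add_comm, Nat.add_mul_mod_self_right, Nat.mod_eq_of_lt j.2]

theorem HoldsInput.num (h : HoldsInput v σ) {x y : Term} {i : Fin n} {j : Fin m}
    (hx : Den σ E x ((i : ℕ) : ℤ)) (hy : Den σ E y ((j : ℕ) : ℤ)) :
    Den σ E (.num x y) (v i j).num := by
  refine (((hx.mul (den_goods E h.goods)).add hy).read 1 (by norm_num)).congr ?_
  rw [h.2.1, ← Nat.cast_mul, ← Nat.cast_add, Int.toNat_natCast]
  simp [inputMem, index_lt, divNat_index, modNat_index]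

theorem HoldsInput.den (h : HoldsInput v σ) {x y : Term} {i : Fin n} {j : Fin m}
    (hx : Den σ E x ((i : ℕ) : ℤ)) (hy : Den σ E y ((j : ℕ) : ℤ)) :
    Den σ E (.den x y) (v i j).den := by
  refine (((hx.mul (den_goods E h.goods)).add hy).read 2 (by norm_num)).congr ?_
  rw [h.2.2, ← Nat.cast_mul, ← Nat.cast_add, Int.toNat_natCast]
  simp [inputMem, index_lt, divNat_index, modNat_index]

theorem HoldsInput.differs (h : HoldsInput v σ) (hn : 0 < n) (E : Env) :
    DenFun σ E Term.differs fun i => ind (¬ v i = v ⟨0, hn⟩) := by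
  intro E' hE x i hx
  refine (Den.ex (den_goods E' h.goods) (width_eq h.goods).ge fun E'' hE' y j hy =>
    (((h.num (hx.mono hE') hy).eq (h.num (i := ⟨0, hn⟩) (Den.const 0) hy)).and
      ((h.den (hx.mono hE') hy).eq (h.den (i := ⟨0, hn⟩) (Den.const 0) hy))).not).congr
        (ind_congr ?_)
  rw [← not_forall, not_iff_not, funext_iff]
  refine forall_congr' fun j => ⟨fun hj => Rat.ext hj.1 (by exact_mod_cast hj.2), fun hj => ?_⟩
  rw [hj]
  exact ⟨rfl, rfl⟩

theorem cast_num_mul_div {q : ℚ} {D : ℤ} (h : (q.den : ℤ) ∣ D) :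
    ((q.num * (D / q.den) : ℤ) : ℝ) = D * (q : ℝ) := by
  obtain ⟨c, rfl⟩ := h
  have hq : (q.den : ℤ) ≠ 0 := by exact_mod_cast q.den_ne_zero
  have hq' : (q.den : ℝ) ≠ 0 := by exact_mod_cast q.den_ne_zero
  rw [Int.mul_ediv_cancel_left _ hq, Rat.cast_def q]
  push_cast
  field_simp

/-- The memory is such that the terms for the derived data of the instance have their intended
values. -/
structure Evaluates (σ : Mem) (u₁ u₂ : Fin m → ℝ) (n₁ n₂ k : ℕ) (D : ℤ) : Prop where
  goods : σ 0 1 = m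
  quota_le : k ≤ m
  firstCount : ∀ E, Den σ E .firstCount n₁
  secondCount : ∀ E, Den σ E .secondCount n₂
  quota : ∀ E, Den σ E .quota k
  scale_pos : 0 < D
  val₁ : DenScaled σ D Term.val₁ u₁
  val₂ : DenScaled σ D Term.val₂ u₂

open Classical in
/-- The terms for the derived data have their intended values, with the product of the denominators
as common factor of the scaled valuations. -/
theorem HoldsInput.evaluates (hn : 0 < n) (hm : 0 < m) (hnm : n ∣ m)
    (htypes : AtMostTwoTypes fun i j => (v i j : ℝ)) (h : HoldsInput v σ) :
    ∃ D, Evaluates σ (fun j => (v ⟨0, hn⟩ j : ℝ))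
      (secondValuation (fun i j => (v i j : ℝ)) ⟨0, hn⟩)
      #{i | (fun j => (v i j : ℝ)) = fun j => (v ⟨0, hn⟩ j : ℝ)}
      #{i | ¬ (fun j => (v i j : ℝ)) = fun j => (v ⟨0, hn⟩ j : ℝ)} (m / n) D := by
  have hcast : ∀ i, ((fun j => (v i j : ℝ)) = fun j => (v ⟨0, hn⟩ j : ℝ)) ↔ v i = v ⟨0, hn⟩ :=
    fun i => by simp [funext_iff]
  have hnw : n ≤ σ.width := by rw [width_eq h.goods]; exact Nat.le_of_dvd hm hnm
  have hdiff := h.differs hn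
  -- the agent whose valuation is used for the second type
  obtain ⟨i₂, hi₂, hsec⟩ : ∃ i₂ : Fin n, (∀ E, Den σ E .other ((i₂ : ℕ) : ℤ)) ∧
      ∀ j, secondValuation (fun i j => (v i j : ℝ)) ⟨0, hn⟩ j =
        ind (∃ i, ¬ v i = v ⟨0, hn⟩) * (v i₂ j : ℝ) := by
    have hd := fun E => Den.first (h.agents E) hnw (hdiff E)
    by_cases hex : ∃ i, ¬ v i = v ⟨0, hn⟩
    · obtain ⟨i₂, hne, he⟩ := firstIndex_spec hex
      refine ⟨i₂, fun E => he ▸ hd E, fun j => ?_⟩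
      rw [secondValuation_eq htypes (i := i₂) (by rw [Ne, hcast]; exact hne), ind_of hex]
      simp
    · refine ⟨⟨0, hn⟩, fun E => (hd E).congr (firstIndex_eq_zero hex), fun j => ?_⟩
      rw [secondValuation_eq_zero, ind_of_not hex]
      · simp
      · intro i
        rw [hcast]
        by_contra hi
        exact hex ⟨i, hi⟩
  have hscale : ∀ E, Den σ E .scale (∏ j, (((v ⟨0, hn⟩ j).den : ℤ) * (v i₂ j).den)) := fun E =>
    Den.prod (width_eq h.goods) fun E' hE x j hx =>
      (h.den (i := ⟨0, hn⟩) (Den.const 0) hx).mul (h.den (hi₂ E') hx)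
  refine ⟨∏ j, (((v ⟨0, hn⟩ j).den : ℤ) * (v i₂ j).den), h.goods, Nat.div_le_self _ _,
    fun E => ?_, fun E => ?_,
    fun E => ((den_goods E h.goods).div (h.agents E)).congr (by norm_cast), ?_,
    ⟨fun j => (v ⟨0, hn⟩ j).num *
      ((∏ j, (((v ⟨0, hn⟩ j).den : ℤ) * (v i₂ j).den)) / (v ⟨0, hn⟩ j).den), fun j => ?_,
      fun E E' hE x j hx => (h.num (i := ⟨0, hn⟩) (Den.const 0) hx).mul
        ((hscale E').div (h.den (i := ⟨0, hn⟩) (Den.const 0) hx))⟩,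
    ⟨fun j => ind (∃ i, ¬ v i = v ⟨0, hn⟩) * ((v i₂ j).num *
      ((∏ j, (((v ⟨0, hn⟩ j).den : ℤ) * (v i₂ j).den)) / (v i₂ j).den)), fun j => ?_,
      fun E E' hE x j hx => (Den.ex (h.agents E') hnw (hdiff E')).mul ((h.num (hi₂ E') hx).mul
        ((hscale E').div (h.den (hi₂ E') hx)))⟩⟩
  · refine (Den.sum (h.agents E) hnw (fun E' hE x i hx => (hdiff E E' hE x i hx).not)).congr ?_
    rw [sum_ind_eq_card]
    congr 2
    ext i
    simp [hcast]
  · refine (Den.sum (h.agents E) hnw (hdiff E)).congr ?_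
    rw [sum_ind_eq_card]
    congr 2
    ext i
    simp [hcast]
  · exact prod_pos fun j _ => mul_pos (by exact_mod_cast Rat.den_pos _)
      (by exact_mod_cast Rat.den_pos _)
  · exact cast_num_mul_div ((Dvd.intro _ rfl).trans (dvd_prod_of_mem _ (mem_univ j)))
  · rw [Int.cast_mul, cast_num_mul_div ((Dvd.intro_left _ rfl).trans
      (dvd_prod_of_mem (fun j => ((v ⟨0, hn⟩ j).den : ℤ) * (v i₂ j).den) (mem_univ j))), hsec j]
    ring

end InputTerms

section Search

/-- The goods `a` and `b` determine a critical multiplier. -/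
def Term.steep (a b : Term) : Term :=
  ((Term.val₂ b).lt (.val₂ a)).mul ((Term.val₁ b).lt (.val₁ a))

/-- A positive multiple of the weighted difference of the two valuations, for the critical
multiplier given by the goods `a` and `b`, and for the multiplier `1` if they do not give one. -/
def Term.weight (a b x : Term) : Term :=
  ((((Term.steep a b).mul ((Term.val₂ a).sub (.val₂ b))).add (Term.steep a b).not).mul
    (.val₁ x)).sub
  ((((Term.steep a b).mul ((Term.val₁ a).sub (.val₁ b))).add (Term.steep a b).not).mul (.val₂ x))

/-- Membership in the candidate number `d` for the multiplier given by `a` and `b`. -/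
def Term.candidate (a b d x : Term) : Term :=
  .walk (.top (.lexLt (.weight a b) fun x y => (Term.val₁ x).lt (.val₁ y))
      (Term.firstCount.mul .quota))
    (.top (.lexLt (.weight a b) fun x y => (Term.val₁ y).lt (.val₁ x))
      (Term.firstCount.mul .quota)) d x

/-- The test that a set of goods for the first type leaves neither group with envy. -/
def Term.accept (S : Term → Term) : Term :=
  (Term.noGroupEnvy .val₁ .quota .firstCount S .secondCount fun x => (S x).not).mul
    (Term.noGroupEnvy .val₂ .quota .secondCount (fun x => (S x).not) .firstCount S)

variable {m : ℕ} {σ : Mem} {u₁ u₂ : Fin m → ℝ} {n₁ n₂ k : ℕ} {D : ℤ} {E : Env}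

open Classical in
/-- The multiplier given by two goods. -/
noncomputable def multiplier (u₁ u₂ : Fin m → ℝ) (a b : Fin m) : ℝ :=
  if u₂ b < u₂ a ∧ u₁ b < u₁ a then (u₁ a - u₁ b) / (u₂ a - u₂ b) else 1

theorem isCritical_multiplier (u₁ u₂ : Fin m → ℝ) (a b : Fin m) :
    IsCritical u₁ u₂ (multiplier u₁ u₂ a b) := by
  unfold multiplier
  split_ifs with h
  · exact .inr ⟨a, b, h.2, h.1, rfl⟩
  · exact .inl rfl

theorem IsCritical.exists_multiplier {lam : ℝ} (hm : 0 < m) (h : IsCritical u₁ u₂ lam) :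
    ∃ a b, multiplier u₁ u₂ a b = lam := by
  rcases h with rfl | ⟨a, b, h1, h2, rfl⟩
  · exact ⟨⟨0, hm⟩, ⟨0, hm⟩, by simp [multiplier]⟩
  · exact ⟨a, b, by simp [multiplier, h1, h2]⟩

theorem Evaluates.weight (h : Evaluates σ u₁ u₂ n₁ n₂ k D) {x y : Term} {a b : Fin m}
    (ha : Den σ E x ((a : ℕ) : ℤ)) (hb : Den σ E y ((b : ℕ) : ℤ)) :
    DenRel σ E (fun s t => (Term.weight x y s).lt (Term.weight x y t)) fun s t =>
      u₁ s - multiplier u₁ u₂ a b * u₂ s < u₁ t - multiplier u₁ u₂ a b * u₂ t := by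
  have hst : Den σ E (Term.steep x y) (ind (u₂ b < u₂ a ∧ u₁ b < u₁ a)) :=
    (h.val₂.lt h.scale_pos E E (.refl _) y x b a hb ha).and
      (h.val₁.lt h.scale_pos E E (.refl _) y x b a hb ha)
  obtain ⟨G₁, e₁, d₁⟩ := h.val₁
  obtain ⟨G₂, e₂, d₂⟩ := h.val₂
  have hp := (hst.mul ((d₂ E E (.refl _) x a ha).sub (d₂ E E (.refl _) y b hb))).add hst.not
  have hq := (hst.mul ((d₁ E E (.refl _) x a ha).sub (d₁ E E (.refl _) y b hb))).add hst.not
  have hw : DenFun σ E (Term.weight x y) _ := fun E' hE s j hs =>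
    ((hp.mono hE).mul (d₁ E' E' (.refl _) s j hs)).sub
      ((hq.mono hE).mul (d₂ E' E' (.refl _) s j hs))
  refine hw.lt.congr fun s t => ?_
  have hD : (0 : ℝ) < D := by exact_mod_cast h.scale_pos
  rw [← Int.cast_lt (R := ℝ)]
  push_cast
  simp only [e₁, e₂]
  unfold multiplier
  split_ifs with hc
  · rw [ind_of hc, ind_of_not (not_not.2 hc)]
    have hc' : 0 < u₂ a - u₂ b := sub_pos.2 hc.1
    have key : ∀ j, ((1 : ℤ) * (D * u₂ a - D * u₂ b) + (0 : ℤ)) * (D * u₁ j) -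
        ((1 : ℤ) * (D * u₁ a - D * u₁ b) + (0 : ℤ)) * (D * u₂ j) =
        (D * D * (u₂ a - u₂ b)) * (u₁ j - (u₁ a - u₁ b) / (u₂ a - u₂ b) * u₂ j) := fun j => by
      push_cast
      field_simp
      ring
    rw [key, key]
    exact mul_lt_mul_iff_right₀ (by positivity)
  · rw [ind_of_not hc, ind_of hc]
    have key : ∀ j, ((0 : ℤ) * (D * u₂ a - D * u₂ b) + (1 : ℤ)) * (D * u₁ j) -
        ((0 : ℤ) * (D * u₁ a - D * u₁ b) + (1 : ℤ)) * (D * u₂ j) =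
        D * (u₁ j - 1 * u₂ j) := fun j => by push_cast; ring
    rw [key, key]
    exact mul_lt_mul_iff_right₀ hD

/-- The candidate sets for the goods of the first type. -/
noncomputable def candidate (u₁ u₂ : Fin m → ℝ) (N : ℕ) (a b : Fin m) (d : ℕ) : Finset (Fin m) :=
  walk (tieBreak u₁ u₂ (multiplier u₁ u₂ a b) u₁ N)
    (tieBreak u₁ u₂ (multiplier u₁ u₂ a b) (-u₁) N) d

theorem Evaluates.candidate (h : Evaluates σ u₁ u₂ n₁ n₂ k D) {x y z : Term} {a b : Fin m} {d : ℕ}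
    (ha : Den σ E x ((a : ℕ) : ℤ)) (hb : Den σ E y ((b : ℕ) : ℤ)) (hd : Den σ E z (d : ℤ)) :
    DenFun σ E (Term.candidate x y z) fun j =>
      ind (j ∈ FairDivision.candidate u₁ u₂ (n₁ * k) a b d) := by
  have hN : Den σ E (Term.firstCount.mul .quota) ((n₁ * k : ℕ) : ℤ) :=
    ((h.firstCount E).mul (h.quota E)).congr (by push_cast; rfl)
  have h1 := h.val₁.lt h.scale_pos
  have h2 : DenRel σ E (fun x y => (Term.val₁ y).lt (Term.val₁ x)) fun a b =>
      (-u₁) a < (-u₁) b := fun E' hE x y v w hx hy =>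
    (h1 E' E' (.refl _) y x w v hy hx).congr (ind_congr (by simp))
  exact DenFun.walk h.goods (DenFun.top h.goods ((h.weight ha hb).lexLt (h1 E)) hN)
    (DenFun.top h.goods ((h.weight ha hb).lexLt h2) hN) hd

/-- Neither group envies the other if the first one owns `S`. -/
def Acceptable (u₁ u₂ : Fin m → ℝ) (n₁ n₂ k : ℕ) (S : Finset (Fin m)) : Prop :=
  NoGroupEnvy u₁ k n₁ S n₂ Sᶜ ∧ NoGroupEnvy u₂ k n₂ Sᶜ n₁ S

theorem DenFun.compl {F : Term → Term} {S : Finset (Fin m)}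
    (h : DenFun σ E F fun j => ind (j ∈ S)) :
    DenFun σ E (fun x => (F x).not) fun j => ind (j ∈ Sᶜ) :=
  fun E' hE x j hx => (h E' hE x j hx).not.congr (ind_congr mem_compl.symm)

theorem Evaluates.accept (h : Evaluates σ u₁ u₂ n₁ n₂ k D) {F : Term → Term} {S : Finset (Fin m)}
    (hF : DenFun σ E F fun j => ind (j ∈ S)) :
    Den σ E (.accept F) (ind (Acceptable u₁ u₂ n₁ n₂ k S)) :=
  (h.val₁.noGroupEnvy h.scale_pos h.goods h.quota_le (h.quota E) (h.firstCount E)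
    (h.secondCount E) hF hF.compl).and
  (h.val₂.noGroupEnvy h.scale_pos h.goods h.quota_le (h.quota E) (h.secondCount E)
    (h.firstCount E) hF.compl hF)

/-- Cell `x` of array `6`, which holds the variables of the program. -/
def Term.reg (x : ℕ) : Term := .read 6 (.const x)

theorem den_reg (E : Env) {x : ℕ} {z : ℤ} (h : σ 6 x = z) : Den σ E (.reg x) z :=
  ((Den.const _).read 6 (by norm_num)).congr (by simpa using h)

/-- The assignment of the value of a term to cell `x` of array `6`. -/
def Program.setReg (x : ℕ) (e : Term) : Program := .assign 6 (.const x) e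

theorem Triple.setReg {ι : Type*} (sz : ι → ℕ) (Q : ι → Mem → Prop) (x : ℕ) (e : Term) :
    Triple sz (fun i σ => |e.ev σ| ≤ 2 ^ sz i ∧ Q i (σ.set 6 x (e.ev σ))) (.setReg x e) Q :=
  Triple.assign sz Q (.const x) e (by norm_num)

/-- The search for the goods that give the right multiplier, and for the number of exchanges. -/
def Program.search : Program :=
  .seq (.setReg 0 (.first .goods fun a => .ex .goods fun b => .ex .goods fun d =>
      .accept (.candidate a b d)))
    (.seq (.setReg 1 (.first .goods fun b => .ex .goods fun d =>
      .accept (.candidate (.reg 0) b d)))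
    (.setReg 2 (.first .goods fun d => .accept (.candidate (.reg 0) (.reg 1) d))))

theorem Evaluates.den_search (h : Evaluates σ u₁ u₂ n₁ n₂ k D) :
    Den σ E (.first .goods fun a => .ex .goods fun b => .ex .goods fun d =>
      .accept (.candidate a b d)) (firstIndex fun a : Fin m => ∃ b d : Fin m,
        Acceptable u₁ u₂ n₁ n₂ k (FairDivision.candidate u₁ u₂ (n₁ * k) a b d)) := by
  have hw := (width_eq h.goods).ge
  exact Den.first (den_goods _ h.goods) hw fun E₁ _ x a hx =>
    Den.ex (den_goods _ h.goods) hw fun E₂ h₂ y b hy =>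
      Den.ex (den_goods _ h.goods) hw fun E₃ h₃ z d hz =>
        h.accept (h.candidate ((hx.mono h₂).mono h₃) (hy.mono h₃) hz)

theorem Evaluates.den_search_snd (h : Evaluates σ u₁ u₂ n₁ n₂ k D) {x : Term} {a : Fin m}
    (hx : Den σ E x ((a : ℕ) : ℤ)) :
    Den σ E (.first .goods fun b => .ex .goods fun d => .accept (.candidate x b d))
      (firstIndex fun b : Fin m => ∃ d : Fin m,
        Acceptable u₁ u₂ n₁ n₂ k (FairDivision.candidate u₁ u₂ (n₁ * k) a b d)) := by
  have hw := (width_eq h.goods).ge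
  exact Den.first (den_goods _ h.goods) hw fun E₂ h₂ y b hy =>
    Den.ex (den_goods _ h.goods) hw fun E₃ h₃ z d hz =>
      h.accept (h.candidate ((hx.mono h₂).mono h₃) (hy.mono h₃) hz)

theorem Evaluates.den_search_thd (h : Evaluates σ u₁ u₂ n₁ n₂ k D) {x y : Term} {a b : Fin m}
    (hx : Den σ E x ((a : ℕ) : ℤ)) (hy : Den σ E y ((b : ℕ) : ℤ)) :
    Den σ E (.first .goods fun d => .accept (.candidate x y d))
      (firstIndex fun d : Fin m =>
        Acceptable u₁ u₂ n₁ n₂ k (FairDivision.candidate u₁ u₂ (n₁ * k) a b d)) :=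
  Den.first (den_goods _ h.goods) (width_eq h.goods).ge fun _ h₃ _ _ hz =>
    h.accept (h.candidate (hx.mono h₃) (hy.mono h₃) hz)

end Search

/-! ### Instances and correctness of the search -/

section Instances

/-- A rational instance with at most two types of agents. -/
structure Instance where
  /-- The number of agents. -/
  n : ℕ
  /-- The number of goods. -/
  m : ℕ
  /-- The values of the goods. -/
  v : Fin n → Fin m → ℚ
  agents_pos : 0 < n
  goods_pos : 0 < m
  dvd : n ∣ m
  nonneg : ∀ i j, 0 ≤ v i j
  types : AtMostTwoTypes v

namespace Instance

variable (I : Instance)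

/-- The bit length of the instance. -/
def size : ℕ := inputSize I.v

/-- The valuations as real functions. -/
def val (i : Fin I.n) (j : Fin I.m) : ℝ := I.v i j

/-- Agent `0`. -/
def zero : Fin I.n := ⟨0, I.agents_pos⟩

/-- The valuation of the first type. -/
def u₁ : Fin I.m → ℝ := I.val I.zero

/-- The valuation of the second type. -/
noncomputable def u₂ : Fin I.m → ℝ := secondValuation I.val I.zero

/-- Agent `i` is of the first type. -/
def IsFirst (i : Fin I.n) : Prop := I.val i = I.val I.zero

noncomputable instance : DecidablePred I.IsFirst := Classical.decPred _

/-- The number of agents of the first type. -/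
noncomputable def n₁ : ℕ := #{i | I.IsFirst i}

/-- The number of agents of the second type. -/
noncomputable def n₂ : ℕ := #{i | ¬ I.IsFirst i}

/-- The number of goods for every agent. -/
def k : ℕ := I.m / I.n

/-- The candidate sets for the goods of the first type. -/
noncomputable def candidate (a b : Fin I.m) (d : ℕ) : Finset (Fin I.m) :=
  FairDivision.candidate I.u₁ I.u₂ (I.n₁ * I.k) a b d

theorem val_nonneg (i : Fin I.n) (j : Fin I.m) : 0 ≤ I.val i j := by
  unfold val
  exact_mod_cast I.nonneg i j

theorem types_val : AtMostTwoTypes I.val := by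
  obtain ⟨w₁, w₂, h⟩ := I.types
  refine ⟨fun j => w₁ j, fun j => w₂ j, fun i => ?_⟩
  rcases h i with h | h
  · exact .inl (funext fun j => by rw [val, h])
  · exact .inr (funext fun j => by rw [val, h])

theorem val_eq (i : Fin I.n) : I.val i = if I.IsFirst i then I.u₁ else I.u₂ := by
  split_ifs with h
  · exact h
  · exact (secondValuation_eq I.types_val h).symm

theorem agents_le : I.n ≤ I.m := Nat.le_of_dvd I.goods_pos I.dvd

theorem counts : 0 < I.n₁ ∧ (I.n₁ + I.n₂) * I.k = I.m := by
  classical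
  obtain ⟨h1, h2, -⟩ := twoTypes_data I.dvd I.val_nonneg I.zero (n₁ := I.n₁) (n₂ := I.n₂)
    (k := I.k) (by simp only [n₁, IsFirst]; congr) (by simp only [n₂, IsFirst]; congr) rfl
  exact ⟨h1, h2⟩

theorem card_le : I.n₁ * I.k ≤ Fintype.card (Fin I.m) := by
  rw [Fintype.card_fin]
  exact (Nat.mul_le_mul_right _ (Nat.le_add_right _ _)).trans I.counts.2.le

/-- All candidates are optimal, also for a number of exchanges that is too large. -/
theorem candidate_spec (a b : Fin I.m) (d : ℕ) : #(I.candidate a b d) = I.n₁ * I.k ∧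
    IsWeightOptimal I.u₁ I.u₂ (multiplier I.u₁ I.u₂ a b) (I.candidate a b d) := by
  rcases le_total d #(tieBreak I.u₁ I.u₂ (multiplier I.u₁ I.u₂ a b) I.u₁ (I.n₁ * I.k) \
      tieBreak I.u₁ I.u₂ (multiplier I.u₁ I.u₂ a b) (-I.u₁) (I.n₁ * I.k)) with h | h
  · exact walk_tieBreak I.card_le h
  · have hc : #(tieBreak I.u₁ I.u₂ (multiplier I.u₁ I.u₂ a b) I.u₁ (I.n₁ * I.k)) =
        #(tieBreak I.u₁ I.u₂ (multiplier I.u₁ I.u₂ a b) (-I.u₁) (I.n₁ * I.k)) :=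
      (card_topSet _ I.card_le).trans (card_topSet _ I.card_le).symm
    have := walk_tieBreak (u₁ := I.u₁) (u₂ := I.u₂) (lam := multiplier I.u₁ I.u₂ a b)
      (g := I.u₁) (g' := -I.u₁) I.card_le le_rfl
    rw [walk_of_card_le hc le_rfl] at this
    rw [candidate, FairDivision.candidate, walk_of_card_le hc h]
    exact this

theorem card_compl {S : Finset (Fin I.m)} (hS : #S = I.n₁ * I.k) : #Sᶜ = I.n₂ * I.k :=
  card_compl_of_card hS (by rw [Fintype.card_fin, I.counts.2])

/-- Neither group envies the other if the agents of the first type own `S`. -/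
def Acceptable (S : Finset (Fin I.m)) : Prop :=
  FairDivision.Acceptable I.u₁ I.u₂ I.n₁ I.n₂ I.k S

theorem exists_acceptable : ∃ a b d : Fin I.m, I.Acceptable (I.candidate a b d) := by
  classical
  obtain ⟨-, -, lam, hc, d, hd, h⟩ := twoTypes_data I.dvd I.val_nonneg I.zero (n₁ := I.n₁)
    (n₂ := I.n₂) (k := I.k) (by simp only [n₁, IsFirst]; congr)
    (by simp only [n₂, IsFirst]; congr) rfl
  obtain ⟨a, b, rfl⟩ := hc.exists_multiplier I.goods_pos
  set A := tieBreak I.u₁ I.u₂ (multiplier I.u₁ I.u₂ a b) I.u₁ (I.n₁ * I.k)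
  set B := tieBreak I.u₁ I.u₂ (multiplier I.u₁ I.u₂ a b) (-I.u₁) (I.n₁ * I.k)
  -- the sets `A \ B` and `B \ A` are disjoint and of the same size
  have hlt : d < I.m := by
    have h1 : #(A \ B) = #(B \ A) :=
      card_sdiff_comm ((card_topSet _ I.card_le).trans (card_topSet _ I.card_le).symm)
    have h2 := (card_union_of_disjoint (disjoint_sdiff_sdiff (x := A) (y := B))).symm.le.trans
      (card_le_univ _)
    rw [Fintype.card_fin] at h2
    have := I.goods_pos
    change d ≤ #(A \ B) at hd
    omega
  exact ⟨a, b, ⟨d, hlt⟩, h⟩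

variable {I} {σ : Mem}

theorem evaluates (h : HoldsInput I.v σ) : ∃ D, Evaluates σ I.u₁ I.u₂ I.n₁ I.n₂ I.k D := by
  classical
  obtain ⟨D, h⟩ := h.evaluates I.agents_pos I.goods_pos I.dvd I.types_val
  have e₁ : I.n₁ = #{i | (fun j => (I.v i j : ℝ)) = fun j => (I.v ⟨0, I.agents_pos⟩ j : ℝ)} := by
    unfold n₁; congr
  have e₂ : I.n₂ =
      #{i | ¬ (fun j => (I.v i j : ℝ)) = fun j => (I.v ⟨0, I.agents_pos⟩ j : ℝ)} := by
    unfold n₂; congr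
  rw [← e₁, ← e₂] at h
  exact ⟨D, h⟩

variable (I) in
theorem goods_le_size : I.m ≤ I.size := by
  have h1 : ∑ j : Fin I.m, 1 ≤ ∑ j, (bits (I.v I.zero j).num + bits (I.v I.zero j).den) :=
    sum_le_sum fun j _ => by unfold bits; omega
  have h2 : ∑ j, (bits (I.v I.zero j).num + bits (I.v I.zero j).den) ≤
      ∑ i, ∑ j, (bits (I.v i j).num + bits (I.v i j).den) :=
    single_le_sum (f := fun i => ∑ j, (bits (I.v i j).num + bits (I.v i j).den))
      (fun _ _ => Nat.zero_le _) (mem_univ _)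
  simp only [sum_const, card_univ, Fintype.card_fin, smul_eq_mul, mul_one] at h1
  unfold size inputSize
  omega

variable (I) in
theorem abs_le {x : ℕ} (h : x ≤ I.m) : |(x : ℤ)| ≤ 2 ^ I.size :=
  natCast_le_two_pow (h.trans I.goods_le_size)

end Instance

end Instances

section SearchProgram

theorem HoldsInput.set {n m : ℕ} {v : Fin n → Fin m → ℚ} {σ : Mem} (h : HoldsInput v σ) {a : ℕ}
    (ha : 3 ≤ a) (l : ℕ) (z : ℤ) : HoldsInput v (σ.set a l z) := by
  unfold HoldsInput
  rw [Mem.set_array_ne _ (by omega), Mem.set_array_ne _ (by omega), Mem.set_array_ne _ (by omega)]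
  exact h

/-- The set `S` has been chosen for the first type: it is the candidate given by the first three
variables. -/
def Chosen (I : Instance) (S : Finset (Fin I.m)) (σ : Mem) : Prop :=
  HoldsInput I.v σ ∧ ∃ a b d : Fin I.m, σ 6 0 = (a : ℕ) ∧ σ 6 1 = (b : ℕ) ∧ σ 6 2 = (d : ℕ) ∧
    S = I.candidate a b d ∧ I.Acceptable S

theorem triple_search : Triple Instance.size (fun I σ => HoldsInput I.v σ) .search
    (fun I σ => ∃ S, Chosen I S σ) := by
  refine ((Triple.setReg _ _ _ _).seq ((Triple.setReg _ _ _ _).seq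
    (Triple.setReg _ _ _ _))).conseq (fun I σ h => ?_) fun _ _ h => h
  obtain ⟨a, ha, ea⟩ := firstIndex_spec I.exists_acceptable
  obtain ⟨b, hb, eb⟩ := firstIndex_spec ha
  obtain ⟨d, hd, ed⟩ := firstIndex_spec hb
  obtain ⟨D, h0⟩ := Instance.evaluates h
  have e1 := h0.den_search.ev.trans ea
  rw [e1]
  set σ₁ := σ.set 6 0 (a : ℕ) with h₁
  have i1 : HoldsInput I.v σ₁ := h.set (by norm_num) _ _
  have r1 : σ₁ 6 0 = (a : ℕ) := by simp [h₁, Mem.set_apply]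
  obtain ⟨D, h0⟩ := Instance.evaluates i1
  have e2 := (h0.den_search_snd (den_reg _ r1)).ev.trans eb
  rw [e2]
  set σ₂ := σ₁.set 6 1 (b : ℕ) with h₂
  have i2 : HoldsInput I.v σ₂ := i1.set (by norm_num) _ _
  have r2 : σ₂ 6 0 = (a : ℕ) := by simp [h₂, Mem.set_apply, r1]
  have r2' : σ₂ 6 1 = (b : ℕ) := by simp [h₂, Mem.set_apply]
  obtain ⟨D, h0⟩ := Instance.evaluates i2
  have e3 := (h0.den_search_thd (den_reg _ r2) (den_reg _ r2')).ev.trans ed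
  rw [e3]
  exact ⟨I.abs_le a.2.le, I.abs_le b.2.le, I.abs_le d.2.le, _, i2.set (by norm_num) _ _, a, b, d,
    by simp [Mem.set_apply, r2], by simp [Mem.set_apply, r2'], by simp [Mem.set_apply], rfl, hd⟩

end SearchProgram

/-! ### The colouring algorithm -/

section DivisionTerms

/-- Membership in the set of goods chosen for the first type. -/
def Term.selected (x : Term) : Term := .candidate (.reg 0) (.reg 1) (.reg 2) x

/-- The number of the block of a good, in the system `s`. -/
def Term.block (s : Bool) (x : Term) : Term :=
  ((selected x).mul ((Term.rank
      (fun x y => ((if s then Term.val₂ else .val₁) x).lt ((if s then Term.val₂ else .val₁) y))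
      selected x).div .firstCount)).add
    ((selected x).not.mul (Term.quota.add ((Term.rank
      (fun x y => ((if s then Term.val₂ else .val₁) x).lt ((if s then Term.val₂ else .val₁) y))
      (fun y => (selected y).not) x).div .secondCount)))

/-- The first agent of the right type who has no good yet in the block, in the system `s`, of the
good in variable `3`. -/
def Term.freeColour (s : Bool) : Term :=
  .first .agents fun i => ((selected (.reg 3)).eq (differs i).not).mul
    (Term.ex .goods fun j => ((j.lt (.reg 3)).mul ((block s j).eq (block s (.reg 3)))).mul
      ((Term.read 3 j).eq i)).not

/-- The block of a good, in the system given by variable `7`. -/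
def Term.sideBlock (x : Term) : Term :=
  ((Term.reg 7).mul (block true x)).add ((Term.reg 7).not.mul (block false x))

/-- The good `j` conflicts with the good in variable `6`. -/
def Term.conflict (j : Term) : Term :=
  (((Term.reg 3).lt j).not.mul (j.eq (.reg 6)).not).mul
    (((sideBlock j).eq (sideBlock (.reg 6))).mul ((Term.read 3 j).eq (.read 3 (.reg 6))))

/-- The two systems of blocks of an instance. -/
noncomputable def Instance.blocks (I : Instance) (S : Finset (Fin I.m)) (s : Bool) : Fin I.m → ℕ :=
  FairDivision.blocks I.u₁ I.u₂ S I.n₁ I.n₂ I.k s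

/-- The agents who may receive a good. -/
def Instance.Allowed (I : Instance) (S : Finset (Fin I.m)) (j : Fin I.m) (i : Fin I.n) : Prop :=
  j ∈ S ↔ I.IsFirst i

/-- The goods with number less than `r`. -/
def goodsBelow (m r : ℕ) : Finset (Fin m) := {j | (j : ℕ) < r}

theorem mem_goodsBelow {m r : ℕ} {j : Fin m} : j ∈ goodsBelow m r ↔ (j : ℕ) < r := by
  simp [goodsBelow]

theorem insert_goodsBelow {m : ℕ} (e : Fin m) :
    insert e (goodsBelow m e) = goodsBelow m (e + 1) := by
  ext j
  rw [mem_insert, mem_goodsBelow, mem_goodsBelow, Fin.ext_iff]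
  omega

variable {I : Instance} {S : Finset (Fin I.m)} {σ : Mem} {E : Env}

theorem Chosen.goods (h : Chosen I S σ) : σ 0 1 = I.m := h.1.goods

theorem Chosen.card_eq (h : Chosen I S σ) : #S = I.n₁ * I.k := by
  obtain ⟨-, a, b, d, -, -, -, rfl, -⟩ := h
  exact (I.candidate_spec a b d).1

theorem Chosen.set (h : Chosen I S σ) {a l : ℕ} (ha : a = 3 ∨ a = 6 ∧ 3 ≤ l) (z : ℤ) :
    Chosen I S (σ.set a l z) := by
  obtain ⟨h1, a', b, d, h2, h3, h4, h5⟩ := h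
  refine ⟨h1.set (by omega) _ _, a', b, d, ?_, ?_, ?_, h5⟩ <;>
    rw [Mem.set_apply, if_neg (by omega)] <;> assumption

theorem Chosen.selected (h : Chosen I S σ) (E : Env) :
    DenFun σ E Term.selected fun j => ind (j ∈ S) := by
  obtain ⟨h1, a, b, d, h2, h3, h4, rfl, -⟩ := h
  obtain ⟨D, h0⟩ := Instance.evaluates h1
  exact h0.candidate (den_reg _ h2) (den_reg _ h3) (den_reg _ h4)

theorem Chosen.block (h : Chosen I S σ) (s : Bool) (E : Env) :
    DenFun σ E (Term.block s) fun j => (I.blocks S s j : ℤ) := by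
  intro E' hE x j hx
  obtain ⟨D, h0⟩ := Instance.evaluates h.1
  have hsel := h.selected E'
  have hlt : DenRel σ E'
      (fun x y => ((if s then Term.val₂ else .val₁) x).lt ((if s then Term.val₂ else .val₁) y))
      fun a b => (if s then I.u₂ else I.u₁) a < (if s then I.u₂ else I.u₁) b := by
    cases s
    · exact h0.val₁.lt h0.scale_pos E'
    · exact h0.val₂.lt h0.scale_pos E'
  have hj := hsel E' (.refl _) x j hx
  refine ((hj.mul ((DenFun.rank h0.goods hlt hsel E' (.refl _) x j hx).div
    (h0.firstCount E'))).add (hj.not.mul ((h0.quota E').add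
    ((DenFun.rank h0.goods hlt hsel.compl E' (.refl _) x j hx).div
      (h0.secondCount E'))))).congr ?_
  simp only [Instance.blocks, blocks, FairDivision.block]
  by_cases hS : j ∈ S
  · rw [if_pos hS, ind_of hS, ind_of_not (not_not.2 hS)]; push_cast; ring
  · rw [if_neg hS, ind_of_not hS, ind_of hS]; push_cast; ring

/-- There is a free colour, as no block has more goods than there are agents of its type. -/
theorem Chosen.freeColour (h : Chosen I S σ) {e : Fin I.m} (he : σ 6 3 = (e : ℕ))
    {col : Fin I.m → Fin I.n} (hcol : ∀ j ∈ goodsBelow I.m e, σ 3 j = (col j : ℕ)) (s : Bool) :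
    ∃ i : Fin I.n, (Term.freeColour s).ev σ = (i : ℕ) ∧ I.Allowed S e i ∧
      ∀ j ∈ goodsBelow I.m e, I.blocks S s j = I.blocks S s e → col j ≠ i := by
  have hw := (width_eq h.goods).ge
  have hnw : I.n ≤ σ.width := by rw [width_eq h.goods]; exact I.agents_le
  have hden : Den σ .nil (.freeColour s) (firstIndex fun i => I.Allowed S e i ∧
      ∀ j ∈ goodsBelow I.m e, I.blocks S s j = I.blocks S s e → col j ≠ i) := by
    refine Den.first (h.1.agents _) hnw fun E hE x i hx => ?_
    have he' : ∀ E, Den σ E (.reg 3) ((e : ℕ) : ℤ) := fun E => den_reg E he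
    refine (((h.selected E E (.refl _) _ e (he' E)).iff
      (h.1.differs I.agents_pos E E (.refl _) x i hx).not).and (Den.ex (den_goods _ h.goods) hw
        fun E' hE' y j hy => ((hy.lt (he' E')).and ((h.block s E' E' (.refl _) y j hy).eq
          (h.block s E' E' (.refl _) _ e (he' E')))).and
            ((hy.read 3 (by norm_num)).eq (hx.mono hE'))).not).congr (ind_congr ?_)
    refine and_congr ?_ ?_
    · rw [not_not, Instance.Allowed, Instance.IsFirst]
      refine iff_congr Iff.rfl ?_
      rw [funext_iff, funext_iff]
      exact forall_congr' fun j => by simp [Instance.val, Instance.zero]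
    · push Not
      refine forall_congr' fun j => ?_
      rw [mem_goodsBelow, Int.toNat_natCast]
      constructor
      · intro hj h1 h2 h3
        refine hj ⟨by exact_mod_cast h1, by exact_mod_cast h2⟩ ?_
        rw [hcol j (mem_goodsBelow.2 h1), h3]
      · rintro hj ⟨h1, h2⟩ h3
        have h1' : (j : ℕ) < e := by exact_mod_cast h1
        refine hj h1' (by exact_mod_cast h2) ?_
        rw [hcol j (mem_goodsBelow.2 h1')] at h3
        exact Fin.ext (by exact_mod_cast h3)
  obtain ⟨i, hi, hi'⟩ := firstIndex_spec (exists_free_colour (D := goodsBelow I.m e)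
    (blk := I.blocks S) (Al := I.Allowed S) (s := s) (e := e) (by simp [mem_goodsBelow])
    (fun J hJ => blocks_card_le rfl rfl h.card_eq (I.card_compl h.card_eq) s e J hJ) col)
  exact ⟨i, hden.ev.trans hi', hi⟩

end DivisionTerms

section DivisionProgram

/-- The good in variable `3`, which has no colour yet, receives one that is free in one of its
blocks. Variables `4` and `5` are the two colours of the chain, `6` is the current good, `7` the
system in which it may be in conflict, and `9` counts the rounds. -/
def Program.startChain : Program :=
  .seq (.setReg 4 (.freeColour false)) (.seq (.setReg 5 (.freeColour true))
    (.seq (.assign 3 (.reg 3) (.reg 4)) (.seq (.setReg 6 (.reg 3))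
      (.seq (.setReg 7 (.const 1)) (.setReg 9 (.const 0))))))

/-- The good in conflict with the current one, if there is one, receives the other colour and
becomes the current good. -/
def Program.exchange : Program :=
  .ite (.ex .goods .conflict)
    (.seq (.setReg 8 (.first .goods .conflict))
      (.seq (.assign 3 (.reg 8)
          (((Term.reg 7).mul (.reg 5)).add ((Term.reg 7).not.mul (.reg 4))))
        (.seq (.setReg 6 (.reg 8)) (.setReg 7 (Term.reg 7).not))))
    .skip

/-- The colouring of the good in variable `3`, with as many rounds of recolouring as there are
goods. -/
def Program.colourGood : Program :=
  .seq .startChain (.seq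
    (.countLoop 9 (.seq .exchange (.setReg 9 ((Term.reg 9).add (.const 1)))))
    (.setReg 3 ((Term.reg 3).add (.const 1))))

/-- The colouring of all goods. -/
def Program.divide : Program := .seq (.setReg 3 (.const 0)) (.countLoop 3 .colourGood)

/-- The first `r` goods have been coloured properly. -/
def Coloured (I : Instance) (r : ℕ) (σ : Mem) : Prop :=
  σ 6 3 = r ∧ ∃ S col, Chosen I S σ ∧ IsProperOn (I.blocks S) (I.Allowed S) (goodsBelow I.m r) col ∧
    ∀ j ∈ goodsBelow I.m r, σ 3 j = (col j : ℕ)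

/-- The memory represents a state of the recolouring that began with good `e`. -/
structure HoldsChain (I : Instance) (e r : ℕ) (S : Finset (Fin I.m)) (c : Bool → Fin I.n)
    (col : Fin I.m → Fin I.n) (cur : Fin I.m) (sd : Bool) (V : Finset (Fin I.m)) (σ : Mem) :
    Prop where
  chosen : Chosen I S σ
  good : σ 6 3 = e
  colour_true : σ 6 4 = (c true : ℕ)
  colour_false : σ 6 5 = (c false : ℕ)
  current : σ 6 6 = (cur : ℕ)
  side : σ 6 7 = ind (sd = true)
  count : σ 6 9 = r
  state : KempeState (I.blocks S) (I.Allowed S) (goodsBelow I.m (e + 1)) c col cur sd V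
  colours : ∀ j ∈ goodsBelow I.m (e + 1), σ 3 j = (col j : ℕ)

/-- After `r` rounds, the recolouring is complete or has changed more than `q` goods. -/
def Chain (I : Instance) (e r q : ℕ) (σ : Mem) : Prop :=
  ∃ S c col cur sd V, HoldsChain I e r S c col cur sd V σ ∧
    ((¬ ∃ f ∈ goodsBelow I.m (e + 1), f ≠ cur ∧ I.blocks S sd f = I.blocks S sd cur ∧
      col f = col cur) ∨ q < #V)

theorem triple_startChain : Triple (ι := Instance × ℕ) (fun p => p.1.size)
    (fun p σ => p.2 < p.1.m ∧ Coloured p.1 p.2 σ) .startChain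
    (fun p σ => p.2 < p.1.m ∧ Chain p.1 p.2 0 0 σ) := by
  refine ((((Triple.setReg _ _ _ _).seq ((Triple.setReg _ _ _ _).seq
    ((Triple.assign _ _ _ _ (by norm_num)).seq ((Triple.setReg _ _ _ _).seq
      ((Triple.setReg _ _ _ _).seq (Triple.setReg _ _ _ _)))))).pure
        fun p => p.2 < p.1.m)).conseq ?_ fun _ _ h => h
  rintro ⟨I, e⟩ σ ⟨he, h3, S, col, hc, hp, ho⟩
  simp only at he h3 hp ho ⊢
  have hkey := fun {τ : Mem} (h : Chosen I S τ) (h1 : τ 6 3 = e) (h2 : τ 3 = σ 3) (s : Bool) =>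
    h.freeColour (e := ⟨e, he⟩) h1 (col := col) (fun j hj => by rw [h2]; exact ho j hj) s
  obtain ⟨x, ex, ax, fx⟩ := hkey hc h3 rfl false
  rw [ex]
  set σ₁ := σ.set 6 4 (x : ℕ) with h₁
  have c₁ : Chosen I S σ₁ := hc.set (by norm_num) _
  have r₁ : σ₁ 6 3 = e := by simp [h₁, Mem.set_apply, h3]
  obtain ⟨y, ey, ay, fy⟩ := hkey c₁ r₁ (Mem.set_array_ne _ (by norm_num) _ _) true
  rw [ey]
  set σ₂ := σ₁.set 6 5 (y : ℕ) with h₂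
  have c₂ : Chosen I S σ₂ := c₁.set (by norm_num) _
  have r₂ : σ₂ 6 3 = e := by simp [h₂, Mem.set_apply, r₁]
  have r₂' : σ₂ 6 4 = (x : ℕ) := by simp [h₂, h₁, Mem.set_apply]
  rw [(den_reg _ r₂).ev, (den_reg _ r₂').ev, Int.toNat_natCast]
  set σ₃ := σ₂.set 3 e (x : ℕ) with h₃
  have c₃ : Chosen I S σ₃ := c₂.set (by norm_num) _
  have r₃ : σ₃ 6 3 = e := by simp [h₃, Mem.set_apply, r₂]
  rw [(den_reg _ r₃).ev, (Den.const 1).ev, (Den.const 0).ev]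
  have c₆ : Chosen I S (((σ₃.set 6 6 e).set 6 7 1).set 6 9 0) :=
    ((c₃.set (by norm_num) _).set (by norm_num) _).set (by norm_num) _
  have hst := hp.kempeState (e := ⟨e, he⟩) (c := fun s => if s then x else y)
    (by simp [mem_goodsBelow]) (fun s => by
      cases s
      · exact ⟨ay, fy⟩
      · exact ⟨ax, fx⟩) true
  rw [insert_goodsBelow] at hst
  refine ⟨he, I.abs_le (x.2.le.trans I.agents_le), I.abs_le (y.2.le.trans I.agents_le),
    I.abs_le (x.2.le.trans I.agents_le), I.abs_le he.le, I.abs_le (x := 1) I.goods_pos,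
    I.abs_le (x := 0) (Nat.zero_le _), S, _, _, _, _, _,
    ⟨c₆, ?_, ?_, ?_, ?_, ?_, ?_, hst, fun j hj => ?_⟩, .inr (by simp)⟩
  · simp [Mem.set_apply, r₃]
  · simp [Mem.set_apply, h₃, r₂']
  · simp [Mem.set_apply, h₃, h₂]
  · simp [Mem.set_apply]
  · simp [Mem.set_apply, ind_of]
  · simp [Mem.set_apply]
  · by_cases hje : j = ⟨e, he⟩
    · subst hje
      simp [Mem.set_apply, h₃]
    · have hne : (j : ℕ) ≠ e := fun h => hje (Fin.ext h)
      rw [Function.update_of_ne hje]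
      rw [mem_goodsBelow] at hj
      rw [← ho j (mem_goodsBelow.2 (by omega))]
      simp [Mem.set_apply, h₃, h₂, h₁, hne]

variable {I : Instance} {e r : ℕ} {S : Finset (Fin I.m)} {c : Bool → Fin I.n}
    {col : Fin I.m → Fin I.n} {cur : Fin I.m} {sd : Bool} {V : Finset (Fin I.m)} {σ : Mem}

theorem HoldsChain.sideBlock (h : HoldsChain I e r S c col cur sd V σ) (E : Env) :
    DenFun σ E .sideBlock fun j => (I.blocks S sd j : ℤ) := by
  intro E' hE x j hx
  have hs := den_reg E' h.side
  refine ((hs.mul (h.chosen.block true E' E' (.refl _) x j hx)).add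
    (hs.not.mul (h.chosen.block false E' E' (.refl _) x j hx))).congr ?_
  cases sd <;> simp [ind]

theorem HoldsChain.conflict (h : HoldsChain I e r S c col cur sd V σ) (E : Env) :
    DenFun σ E .conflict fun f => ind (f ∈ goodsBelow I.m (e + 1) ∧ f ≠ cur ∧
      I.blocks S sd f = I.blocks S sd cur ∧ col f = col cur) := by
  intro E' hE x f hx
  have hc := den_reg E' h.current
  refine ((((den_reg E' h.good).lt hx).not.and (hx.eq hc).not).and
    (((h.sideBlock E' E' (.refl _) x f hx).eq (h.sideBlock E' E' (.refl _) _ cur hc)).and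
      ((hx.read 3 (by norm_num)).eq (hc.read 3 (by norm_num))))).congr (ind_congr ?_)
  beta_reduce
  rw [mem_goodsBelow, Int.toNat_natCast, Int.toNat_natCast,
    h.colours cur (h.state.subset h.state.cur_mem)]
  constructor
  · rintro ⟨⟨h1, h2⟩, h3, h4⟩
    have h1' : (f : ℕ) < e + 1 := by omega
    rw [h.colours f (mem_goodsBelow.2 h1')] at h4
    exact ⟨h1', fun hf => h2 (by rw [hf]), by exact_mod_cast h3, Fin.ext (by exact_mod_cast h4)⟩
  · rintro ⟨h1, h2, h3, h4⟩
    rw [h.colours f (mem_goodsBelow.2 h1), h3, h4]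
    exact ⟨⟨by omega, fun hf => h2 (Fin.ext (by exact_mod_cast hf))⟩, rfl, rfl⟩

theorem Allowed.of_blocks_eq (hS : #S = I.n₁ * I.k) (s : Bool) (j j' : Fin I.m)
    (h : I.blocks S s j = I.blocks S s j') (i : Fin I.n) : I.Allowed S j i ↔ I.Allowed S j' i :=
  blocks_allowed hS I.IsFirst s j j' h i

theorem triple_exchange : Triple (ι := (Instance × ℕ) × ℕ) (fun p => p.1.1.size)
    (fun p σ => Chain p.1.1 p.1.2 p.2 p.2 σ) .exchange
    (fun p σ => Chain p.1.1 p.1.2 p.2 (p.2 + 1) σ) := by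
  refine Triple.ite (((Triple.setReg _ _ _ _).seq ((Triple.assign _ _ _ _ (by norm_num)).seq
    ((Triple.setReg _ _ _ _).seq (Triple.setReg _ _ _ _)))).conseq ?_ fun _ _ h => h)
    (Triple.skip.conseq ?_ fun _ _ h => h)
  · rintro ⟨⟨I, e⟩, r⟩ σ ⟨⟨S, c, col, cur, sd, V, h, hq⟩, hpos⟩
    simp only at h hq ⊢
    rw [(Den.ex (den_goods .nil h.chosen.goods) (width_eq h.chosen.goods).ge (h.conflict _)).ev,
      ind_pos_iff] at hpos
    have hq := hq.resolve_left (not_not.2 (by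
      obtain ⟨f, h1, h2⟩ := hpos; exact ⟨f, h1, h2⟩))
    obtain ⟨f, hf, ef⟩ := firstIndex_spec hpos
    obtain ⟨hfV, hst⟩ := h.state.step (Allowed.of_blocks_eq h.chosen.card_eq) hf
    have hfD := hf.1
    rw [(Den.first (den_goods .nil h.chosen.goods) (width_eq h.chosen.goods).ge
      (h.conflict _)).ev, ef]
    set σ₁ := σ.set 6 8 (f : ℕ) with h₁
    have hs₁ : σ₁ 6 7 = ind (sd = true) := by simp [h₁, Mem.set_apply, h.side]
    have hcol : (((Term.reg 7).mul (.reg 5)).add ((Term.reg 7).not.mul (.reg 4))).ev σ₁ =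
        (c (!sd) : ℕ) := by
      have h7 := den_reg .nil hs₁
      have h5 : σ₁ 6 5 = (c false : ℕ) := by simp [h₁, Mem.set_apply, h.colour_false]
      have h4 : σ₁ 6 4 = (c true : ℕ) := by simp [h₁, Mem.set_apply, h.colour_true]
      refine ((h7.mul (den_reg _ h5)).add (h7.not.mul (den_reg _ h4))).ev.trans ?_
      cases sd <;> simp [ind]
    rw [hcol, (den_reg .nil (show σ₁ 6 8 = (f : ℕ) by simp [h₁, Mem.set_apply])).ev,
      Int.toNat_natCast]
    set σ₂ := σ₁.set 3 f (c (!sd) : ℕ) with h₂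
    rw [(den_reg .nil (show σ₂ 6 8 = (f : ℕ) by simp [h₂, h₁, Mem.set_apply])).ev]
    set σ₃ := σ₂.set 6 6 (f : ℕ) with h₃
    have hs₃ : (Term.reg 7).not.ev σ₃ = ind ((!sd) = true) :=
      (den_reg .nil (show σ₃ 6 7 = ind (sd = true) by
        simp [h₃, h₂, Mem.set_apply, hs₁])).not.ev.trans (ind_congr (by simp))
    rw [hs₃]
    have hch : Chosen I S (σ₃.set 6 7 (ind ((!sd) = true))) :=
      (((h.chosen.set (by norm_num) _).set (by norm_num) _).set (by norm_num) _).set (by norm_num) _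
    refine ⟨I.abs_le f.2.le, I.abs_le ((c (!sd)).2.le.trans I.agents_le), I.abs_le f.2.le, ?_,
      S, c, _, f, !sd, _, ⟨hch, ?_, ?_, ?_, ?_, ?_, ?_, hst, fun j hj => ?_⟩, .inr ?_⟩
    · cases sd
      · simpa [ind] using I.abs_le (x := 1) I.goods_pos
      · simp [ind]
    · simp [Mem.set_apply, h₃, h₂, h₁, h.good]
    · simp [Mem.set_apply, h₃, h₂, h₁, h.colour_true]
    · simp [Mem.set_apply, h₃, h₂, h₁, h.colour_false]
    · simp [Mem.set_apply, h₃]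
    · simp [Mem.set_apply]
    · simp [Mem.set_apply, h₃, h₂, h₁, h.count]
    · by_cases hjf : j = f
      · subst hjf
        simp [Mem.set_apply, h₃, h₂]
      · have hne : (j : ℕ) ≠ f := fun h => hjf (Fin.ext h)
        rw [Function.update_of_ne hjf, ← h.colours j hj]
        simp [Mem.set_apply, h₃, h₂, h₁, hne]
    · rw [card_insert_of_notMem hfV]
      exact Nat.succ_lt_succ hq
  · rintro ⟨⟨I, e⟩, r⟩ σ ⟨⟨S, c, col, cur, sd, V, h, -⟩, hneg⟩
    rw [(Den.ex (den_goods .nil h.chosen.goods) (width_eq h.chosen.goods).ge (h.conflict _)).ev,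
      ← not_lt, ind_pos_iff] at hneg
    exact ⟨S, c, col, cur, sd, V, h, .inl hneg⟩

/-- As every round recolours a new good or finds no conflict, `m` rounds complete the
recolouring. -/
theorem triple_chain : Triple (ι := Instance × ℕ) (fun p => p.1.size)
    (fun p σ => Chain p.1 p.2 0 0 σ)
    (.countLoop 9 (.seq .exchange (.setReg 9 ((Term.reg 9).add (.const 1)))))
    (fun p σ => Chain p.1 p.2 p.1.m p.1.m σ) := by
  refine Triple.countLoop (ι := Instance × ℕ) (W := fun p => p.1.m)
    (fun p r σ => Chain p.1 p.2 r r σ) ?_ ?_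
  · rintro ⟨I, e⟩ r σ ⟨S, c, col, cur, sd, V, h, -⟩
    exact ⟨width_eq h.chosen.goods, h.count⟩
  · refine (triple_exchange.pure fun p => p.2 < p.1.1.m).seq
      ((Triple.setReg _ _ _ _).conseq ?_ fun _ _ h => h)
    rintro ⟨⟨I, e⟩, r⟩ σ ⟨hr, S, c, col, cur, sd, V, h, hq⟩
    simp only at hr h hq ⊢
    rw [((den_reg .nil h.count).add (Den.const 1)).ev]
    refine ⟨I.abs_le (x := r + 1) hr, S, c, col, cur, sd, V,
      ⟨h.chosen.set (by norm_num) _, ?_, ?_, ?_, ?_, ?_, ?_, h.state, fun j hj => ?_⟩, hq⟩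
    · simp [Mem.set_apply, h.good]
    · simp [Mem.set_apply, h.colour_true]
    · simp [Mem.set_apply, h.colour_false]
    · simp [Mem.set_apply, h.current]
    · simp [Mem.set_apply, h.side]
    · simp [Mem.set_apply]
    · simp [Mem.set_apply, h.colours j hj]

theorem triple_colourGood : Triple (ι := Instance × ℕ) (fun p => p.1.size)
    (fun p σ => p.2 < p.1.m ∧ Coloured p.1 p.2 σ) .colourGood
    (fun p σ => Coloured p.1 (p.2 + 1) σ) := by
  refine ((triple_startChain.seq ((triple_chain.pure fun p => p.2 < p.1.m).seq
    ((Triple.setReg _ _ _ _).conseq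
 ?_ fun _ _ h => h))))
  rintro ⟨I, e⟩ σ ⟨he, S, c, col, cur, sd, V, h, hq⟩
  simp only at he h hq ⊢
  -- no more than all goods have been recoloured, so that the recolouring is complete
  have hno := hq.resolve_right (not_lt.2 ((card_le_univ V).trans (Fintype.card_fin _).le))
  rw [((den_reg .nil h.good).add (Den.const 1)).ev]
  exact ⟨I.abs_le (x := e + 1) he, by simp [Mem.set_apply], S, col, h.chosen.set (by norm_num) _,
    h.state.isProperOn hno, fun j hj => by simp [Mem.set_apply, h.colours j hj]⟩

theorem triple_divide : Triple Instance.size (fun I σ => ∃ S, Chosen I S σ) .divide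
    (fun I σ => Coloured I I.m σ) := by
  refine ((Triple.setReg _ _ _ _).conseq ?_ fun _ _ h => h).seq (Triple.countLoop
    (W := fun I => I.m) (fun I r σ => Coloured I r σ) ?_ triple_colourGood)
  · rintro I σ ⟨S, h⟩
    rw [(Den.const 0).ev]
    exact ⟨I.abs_le (x := 0) (Nat.zero_le _), by simp [Mem.set_apply], S, fun _ => I.zero,
      h.set (by norm_num) _, ⟨by simp [mem_goodsBelow], by simp [mem_goodsBelow]⟩,
      by simp [mem_goodsBelow]⟩
  · rintro I r σ ⟨hr, S, col, h, -⟩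
    exact ⟨width_eq h.goods, hr⟩

theorem abs_le_two_pow_of_bits_le {z : ℤ} {L : ℕ} (h : bits z ≤ L) : |z| ≤ 2 ^ L := by
  have h1 : z.natAbs < 2 ^ Nat.size z.natAbs := Nat.lt_size_self _
  have h2 : 2 ^ Nat.size z.natAbs ≤ 2 ^ L :=
    Nat.pow_le_pow_right (by norm_num) (by unfold bits at h; omega)
  rw [Int.abs_eq_natAbs]
  exact_mod_cast h1.le.trans h2

theorem within_inputMem (I : Instance) : (inputMem I.v).Within I.size 0 := by
  have hv : ∀ i j, bits (I.v i j).num + bits (I.v i j).den ≤ I.size := fun i j => by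
    have h1 := single_le_sum (f := fun j => bits (I.v i j).num + bits (I.v i j).den)
      (fun _ _ => Nat.zero_le _) (mem_univ j)
    have h2 := single_le_sum (f := fun i => ∑ j, (bits (I.v i j).num + bits (I.v i j).den))
      (fun _ _ => Nat.zero_le _) (mem_univ i)
    unfold Instance.size inputSize
    exact (h1.trans h2).trans (Nat.le_add_left _ _)
  refine ⟨fun a l _ _ => ?_, by simp, ?_⟩
  · unfold inputMem
    split_ifs with h1 h2 h3 h4 h5 h6 h7
    · exact I.abs_le I.agents_le
    · exact I.abs_le le_rfl
    · simp
    · exact abs_le_two_pow_of_bits_le ((Nat.le_add_right _ _).trans (hv _ _))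
    · simp
    · exact abs_le_two_pow_of_bits_le ((Nat.le_add_left _ _).trans (hv _ _))
    · simp
    · simp
  · rw [width_eq (m := I.m) (by simp [inputMem])]
    exact I.goods_le_size

/-- The whole algorithm is correct and takes polynomial time. -/
theorem exists_program : ∃ (P : Program) (p : Polynomial ℕ), ∀ I : Instance,
    ∃ (s : Mem) (t : ℕ) (A : Fin I.n → Finset (Fin I.m)), Run P (inputMem I.v) s t ∧
      t ≤ p.eval I.size ∧ Outputs s A ∧ IsBalanced A ∧ IsEF1 I.val A ∧ IsFPO I.val A := by
  obtain ⟨p, h⟩ := triple_search.seq triple_divide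
  refine ⟨.seq .search .divide, p, fun I => ?_⟩
  obtain ⟨s, t, σ, run, ht, ha, -, -, S, col, hc, hp, ho⟩ :=
    h I (inputMem I.v) (inputMem I.v) ⟨rfl, rfl, rfl⟩ (within_inputMem I) (fun _ _ _ => rfl)
  refine ⟨s, t, ofColouring col, run, ht, fun i j => ?_, ?_⟩
  · rw [← ha 3 (by norm_num) (by norm_num), ho j (by simp [mem_goodsBelow])]
    simp [ofColouring, Fin.ext_iff]
  · have hS := hc.card_eq
    obtain ⟨-, a, b, d, -, -, -, rfl, hacc⟩ := hc
    refine fair_of_colouring I.agents_pos I.goods_pos I.dvd I.val_nonneg I.val_eq rfl rfl rfl hS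
      (isCritical_multiplier _ _ a b).pos (I.candidate_spec a b d).2 hacc.1 hacc.2 ?_
    have : goodsBelow I.m I.m = univ := by ext j; simp [mem_goodsBelow]
    rw [this] at hp
    exact hp

end DivisionProgram

end FairDivision

theorem mainTheorem1 :
    (∀ (n m : ℕ), 0 < n → 0 < m → n ∣ m →
      ∀ v : Fin n → Fin m → ℝ, (∀ i j, 0 ≤ v i j) → FairDivision.AtMostTwoTypes v →
        ∃ A : Fin n → Finset (Fin m),
          FairDivision.IsBalanced A ∧ FairDivision.IsEF1 v A ∧ FairDivision.IsFPO v A) ∧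
    (∃ (P : FairDivision.Program) (p : Polynomial ℕ),
      ∀ (n m : ℕ), 0 < n → 0 < m → n ∣ m →
        ∀ v : Fin n → Fin m → ℚ, (∀ i j, 0 ≤ v i j) → FairDivision.AtMostTwoTypes v →
          ∃ (s : FairDivision.Mem) (t : ℕ) (A : Fin n → Finset (Fin m)),
            FairDivision.Run P (FairDivision.inputMem v) s t ∧
            t ≤ p.eval (FairDivision.inputSize v) ∧
            FairDivision.Outputs s A ∧
            FairDivision.IsBalanced A ∧
            FairDivision.IsEF1 (fun i j => (v i j : ℝ)) A ∧
            FairDivision.IsFPO (fun i j => (v i j : ℝ)) A) := by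
  refine ⟨fun n m hn hm hnm v hv ht => FairDivision.exists_balanced_ef1_fpo hn hm hnm v hv ht, ?_⟩
  obtain ⟨P, p, h⟩ := FairDivision.exists_program
  exact ⟨P, p, fun n m hn hm hnm v hv ht => h ⟨n, m, v, hn, hm, hnm, hv, ht⟩⟩
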